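/- Let $\sigma\in\{1,-1\}$ and let $\rho_1,\rho_2\in\mathbb R$ satisfy $-1<\rho_1\rho_2<0$ if $\sigma=1$, and $0<\rho_1\rho_2<1$ if $\sigma=-1$. Let $\alpha\in\mathbb R\setminus\{0\}$, and put $a=\mathrm i\alpha$, $b=a(1+\sigma\rho_1\rho_2)$, $p_0=\sqrt{b(b-a)}+b$ (here $b(b-a)>0$ and the root is positive), and $\Omega_0=-\dfrac{p_0(p_0-\mathrm i\alpha)}{p_0^*(p_0^*+\mathrm i\alpha)}$, where $^*$ is complex conjugation. Let $\hat a_1,\hat a_2,\dots$ be arbitrary complex numbers for which $\sum_{r\ge1}\hat a_r z^r$ has a positive radius of convergence (for example, all but finitely many of them zero). For $n,k,l\in\mathbb Z$ and $(x,t)\in\mathbb R^2$ let $$m^{(n,k,l)}=\frac{\mathrm i p}{p+q}\left(-\frac pq\right)^n\left(-\frac{p-a}{q+a}\right)^k\left(-\frac{p-b}{q+b}\right)^l e^{\Theta},$$ $$\Theta=\frac{\mathrm i\rho_2}{a\rho_1}(p+q)x+\frac{\mathrm i\rho_1 b}{\rho_2}\left(\frac1p+\frac1q\right)t+\sum_{r=1}^\infty\hat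 a_r\ln^r\left(\frac{p-b}{\sqrt{b(b-a)}}\right)+\sum_{r=1}^\infty\hat a_r^*\ln^r\left(\frac{q+b}{\sqrt{b(b-a)}}\right)$$ for complex $p,q$ near $p_0,p_0^*$, and for $N\in\mathbb N$ let $$\tau_{n,k,l}=\det_{1\le i,j\le N}\left(\tilde m^{(n,k,l)}_{2i-1,2j-1}\right),\qquad \tilde m^{(n,k,l)}_{i,j}=\left.\frac{[(p-b)\partial_p]^i}{i!}\frac{[(q+b)\partial_q]^j}{j!}\,m^{(n,k,l)}\right|_{p=p_0,\ q=p_0^*}.$$ Put $f=\tau_{0,0,0}$, $g=\Omega_0^{-N}\tau_{-1,1,0}$, $h=\tau_{-1,0,1}$. Then $f(x,t)\neq0$ for all $(x,t)\in\mathbb R^2$, $f^*=\tau_{-1,0,0}$, and $$u=\rho_1\frac{g}{f^*}e^{\mathrm i(1+\sigma\rho_1\rho_2)\left(\frac{\rho_2}{\rho_1}x+\frac{\rho_1}{\rho_2}t\right)},\qquad v=\rho_2\frac{h}{f}e^{\mathrm i(1+\sigma\rho_1\rho_2)\left(\frac{\rho_2}{\rho_1}x+\frac{\rho_1}{\rho_2}t\right)}$$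 are smooth on $\mathbb R^2$, solve the massive Thirring (MT) model $$\mathrm i u_x+v+\sigma u|v|^2=0,\qquad \mathrm i v_t+u+\sigma v|u|^2=0$$ on $\mathbb R^2$, and satisfy $|u|\to|\rho_1|$ and $|v|\to|\rho_2|$ as $(x,t)\to\infty$ in $\mathbb R^2$. -/

import Mathlib

open Filter Topology
open scoped ComplexConjugate ContDiff Nat

noncomputable section

namespace MT

/-- `(u, v)` is a smooth solution on the whole `(x, t)`-plane of the massive Thirring model
`i u_x + v + σ u |v|² = 0`, `i v_t + u + σ v |u|² = 0`. -/
structure IsSolution (σ : ℝ) (u v : ℝ → ℝ → ℂ) : Prop where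
  smooth_u : ContDiff ℝ ∞ (fun z : ℝ × ℝ => u z.1 z.2)
  smooth_v : ContDiff ℝ ∞ (fun z : ℝ × ℝ => v z.1 z.2)
  eq_u : ∀ x t : ℝ, Complex.I * deriv (fun y : ℝ => u y t) x + v x t
    + (σ : ℂ) * u x t * ((‖v x t‖ ^ 2 : ℝ) : ℂ) = 0
  eq_v : ∀ x t : ℝ, Complex.I * deriv (fun s : ℝ => v x s) t + u x t
    + (σ : ℂ) * v x t * ((‖u x t‖ ^ 2 : ℝ) : ℂ) = 0

/-- The moduli of `u` and `v` tend to the constant background amplitudes `|ρ₁|` and `|ρ₂|`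
as `(x, t)` goes to infinity in the plane, in every direction. -/
def TendsToBackground (ρ₁ ρ₂ : ℝ) (u v : ℝ → ℝ → ℂ) : Prop :=
  Tendsto (fun z : ℝ × ℝ => ‖u z.1 z.2‖) (cocompact (ℝ × ℝ)) (𝓝 |ρ₁|) ∧
  Tendsto (fun z : ℝ × ℝ => ‖v z.1 z.2‖) (cocompact (ℝ × ℝ)) (𝓝 |ρ₂|)

/-- `a = iα`. -/
def a (α : ℝ) : ℂ := Complex.I * (α : ℂ)

/-- `b = a (1 + σ ρ₁ ρ₂)`. -/
def b (σ ρ₁ ρ₂ α : ℝ) : ℂ := a α * (1 + (σ : ℂ) * (ρ₁ : ℂ) * (ρ₂ : ℂ))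

/-- `√(b (b - a))`; for the admissible parameters `b (b - a)` is a positive real number. -/
def rt (σ ρ₁ ρ₂ α : ℝ) : ℂ :=
  Complex.sqrt (b σ ρ₁ ρ₂ α * (b σ ρ₁ ρ₂ α - a α))

/-- `p₀ = √(b (b - a)) + b`. -/
def p₀ (σ ρ₁ ρ₂ α : ℝ) : ℂ := rt σ ρ₁ ρ₂ α + b σ ρ₁ ρ₂ α

/-- `Ω₀ = - p₀ (p₀ - iα) / (p₀* (p₀* + iα))`. -/
def Ω₀ (σ ρ₁ ρ₂ α : ℝ) : ℂ :=
  -(p₀ σ ρ₁ ρ₂ α * (p₀ σ ρ₁ ρ₂ α - Complex.I * (α : ℂ)) /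
    (conj (p₀ σ ρ₁ ρ₂ α) * (conj (p₀ σ ρ₁ ρ₂ α) + Complex.I * (α : ℂ))))

/-- The series `∑_{r ≥ 1} c_r z ^ r` (the value `c 0` plays no role). -/
def series (c : ℕ → ℂ) (z : ℂ) : ℂ := ∑' r : ℕ, c (r + 1) * z ^ (r + 1)

/-- The exponent `Θ`, as a function of `p` and `q`. -/
def Θ (σ ρ₁ ρ₂ α : ℝ) (â : ℕ → ℂ) (x t : ℝ) (p q : ℂ) : ℂ :=
  Complex.I * (ρ₂ : ℂ) / (a α * (ρ₁ : ℂ)) * (p + q) * (x : ℂ)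
  + Complex.I * (ρ₁ : ℂ) * b σ ρ₁ ρ₂ α / (ρ₂ : ℂ) * (1 / p + 1 / q) * (t : ℂ)
  + series â (Complex.log ((p - b σ ρ₁ ρ₂ α) / rt σ ρ₁ ρ₂ α))
  + series (fun r => conj (â r)) (Complex.log ((q + b σ ρ₁ ρ₂ α) / rt σ ρ₁ ρ₂ α))

/-- The function `m^{(n,k,l)}` of `p` and `q`. -/
def m (σ ρ₁ ρ₂ α : ℝ) (â : ℕ → ℂ) (n k l : ℤ) (x t : ℝ) (p q : ℂ) : ℂ :=
  Complex.I * p / (p + q) * (-(p / q)) ^ n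
    * (-((p - a α) / (q + a α))) ^ k
    * (-((p - b σ ρ₁ ρ₂ α) / (q + b σ ρ₁ ρ₂ α))) ^ l
    * Complex.exp (Θ σ ρ₁ ρ₂ α â x t p q)

/-- The first order differential operator `w(z) ∂_z` with complex derivative. -/
def weightedDeriv (w : ℂ → ℂ) (F : ℂ → ℂ) : ℂ → ℂ := fun z => w z * deriv F z

/-- The element `[(p - b) ∂_p]^i / i! · [(q + b) ∂_q]^j / j! · m^{(n,k,l)}` at
`p = p₀`, `q = p₀*`. -/
def mTilde (σ ρ₁ ρ₂ α : ℝ) (â : ℕ → ℂ) (i j : ℕ) (n k l : ℤ) (x t : ℝ) : ℂ :=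
  (weightedDeriv (fun p => p - b σ ρ₁ ρ₂ α))^[i]
    (fun p => (weightedDeriv (fun q => q + b σ ρ₁ ρ₂ α))^[j]
      (fun q => m σ ρ₁ ρ₂ α â n k l x t p q) (conj (p₀ σ ρ₁ ρ₂ α)) / (j ! : ℂ))
    (p₀ σ ρ₁ ρ₂ α) / (i ! : ℂ)

/-- `τ_{n,k,l} = det_{1 ≤ i, j ≤ N} (m̃_{2i-1,2j-1}^{(n,k,l)})`; with indices of `Fin N`
starting at `0`, `2i - 1` becomes `2i + 1`. -/
def τ (σ ρ₁ ρ₂ α : ℝ) (â : ℕ → ℂ) (N : ℕ) (n k l : ℤ) (x t : ℝ) : ℂ :=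
  Matrix.det (Matrix.of fun i j : Fin N =>
    mTilde σ ρ₁ ρ₂ α â (2 * (i : ℕ) + 1) (2 * (j : ℕ) + 1) n k l x t)

/-- `f = τ_{0,0,0}`. -/
def f (σ ρ₁ ρ₂ α : ℝ) (â : ℕ → ℂ) (N : ℕ) (x t : ℝ) : ℂ := τ σ ρ₁ ρ₂ α â N 0 0 0 x t

/-- `g = Ω₀^{-N} τ_{-1,1,0}`. -/
def g (σ ρ₁ ρ₂ α : ℝ) (â : ℕ → ℂ) (N : ℕ) (x t : ℝ) : ℂ :=
  Ω₀ σ ρ₁ ρ₂ α ^ (-(N : ℤ)) * τ σ ρ₁ ρ₂ α â N (-1) 1 0 x t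

/-- `h = τ_{-1,0,1}`. -/
def h (σ ρ₁ ρ₂ α : ℝ) (â : ℕ → ℂ) (N : ℕ) (x t : ℝ) : ℂ := τ σ ρ₁ ρ₂ α â N (-1) 0 1 x t

/-- The plane wave `exp (i (1 + σ ρ₁ ρ₂) (ρ₂ x / ρ₁ + ρ₁ t / ρ₂))`. -/
def planeWave (σ ρ₁ ρ₂ : ℝ) (x t : ℝ) : ℂ :=
  Complex.exp (Complex.I * (((1 + σ * ρ₁ * ρ₂) * (ρ₂ / ρ₁ * x + ρ₁ / ρ₂ * t) : ℝ) : ℂ))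

/-- `u = ρ₁ (g / f*) exp(…)`. -/
def u (σ ρ₁ ρ₂ α : ℝ) (â : ℕ → ℂ) (N : ℕ) (x t : ℝ) : ℂ :=
  (ρ₁ : ℂ) * (g σ ρ₁ ρ₂ α â N x t / conj (f σ ρ₁ ρ₂ α â N x t)) * planeWave σ ρ₁ ρ₂ x t

/-- `v = ρ₂ (h / f) exp(…)`. -/
def v (σ ρ₁ ρ₂ α : ℝ) (â : ℕ → ℂ) (N : ℕ) (x t : ℝ) : ℂ :=
  (ρ₂ : ℂ) * (h σ ρ₁ ρ₂ α â N x t / f σ ρ₁ ρ₂ α â N x t) * planeWave σ ρ₁ ρ₂ x t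

end MT

end

/-! ### Determinants: Jacobi's formula and low rank perturbations. -/

namespace Matrix

variable {n : Type*} [Fintype n] [DecidableEq n]

/-! Write `b = iβ` and `p₀ = iβ + r`, with `r² = β(α - β)`. The operator `(p - b)∂_p` is `d/dX` in
the coordinate `p = iβ + r e^X`, and likewise `q = -iβ + r e^Y`. So the numbers `m̃_{i,j}` are the
coefficients of a double series `F(X) H(Y) / (P(X) + Q(Y))`, and `τ` is the determinant of its
odd-odd coefficients (`jet`, `coeff_jet_jet`, `gram`, `τ_eq_gramDet`).

Two facts drive the algebra. First, multiplying the weights by `P + Q` removes the denominator and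
leaves a rank one matrix (`gram_mul_add`). Hence index shifts and flows with symbol `p` or `1/(p -
c)` perturb one matrix inside the span of four rank one matrices. By the matrix determinant lemma,
each bilinear identity between such determinants is a polynomial identity in four scalars. Second,
an even series acts on odd coefficients by a triangular matrix with constant diagonal, so it changes
a determinant only by a constant factor and a logarithmic derivative only by a constant. Since `p(p
- a)/(p - b) = iβ + 2r cosh X + (b - a)` is even, the shift `(n, k, l) ↦ (n + 1, k + 1, l - 1)`
multiplies `τ` by `Ω₀^N`. Modulo even series, `p` is a multiple of `1/(p - b)`, and `1/p` a multiple
of `1/(p - a)`. These reductions turn the general identities into four bilinear equations for `f, g,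
h`, from which the MT model follows (`isSolution_of_bilinear`).

Nonvanishing of `f`: let `y` be a null vector of its matrix. For imaginary `is` with `s/α > 1`,
choose `s'` such that `(p - b)/((p - is)(p - is'))` is even. Multiplication by this series keeps `y`
in the kernel, and partial fractions show that the skew part of the new matrix is `i(A d d* + B d'
d'*)` with `AB > 0`. So `y` is orthogonal to the odd coefficients `d` of `Φ/(p - is)`. Infinitely
many poles then force `y = 0` (`det_gram_ne_zero`).

Behaviour at infinity: the exponent has an `X`-coefficient `θ` that is affine in `(x, t)`, with
linear part independent over `ℝ` because `p₀²` is not real; so `|θ| → ∞` in every direction. The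
coefficients of the exponential are asymptotic to `θ^n/n!` times its constant term. After a row
reduction common to all the determinants, only the leading `N × N` block of the kernel survives, and
it is invertible. Ratios of determinants tend to ratios of weights at `p₀, p₀*`, which have modulus
one. -/

theorem det_updateCol_eq_sum (A : Matrix n n ℂ) (i : n) (b : n → ℂ) :
    (A.updateCol i b).det = ∑ s : Equiv.Perm n, ((Equiv.Perm.sign s : ℤ) : ℂ) *
      ((∏ j ∈ Finset.univ.erase i, A (s j) j) * b (s i)) := by
  rw [det_apply']
  refine Finset.sum_congr rfl fun s _ => ?_
  congr 1
  rw [← Finset.prod_erase_mul _ _ (Finset.mem_univ i)]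
  congr 1
  · refine Finset.prod_congr rfl fun j hj => ?_
    rw [updateCol_ne (Finset.ne_of_mem_erase hj)]
  · rw [updateCol_self]

theorem trace_adjugate_mul (A B : Matrix n n ℂ) :
    trace (adjugate A * B) = ∑ i, (A.updateCol i fun k => B k i).det := by
  unfold trace
  refine Finset.sum_congr rfl fun i _ => ?_
  rw [← cramer_apply, cramer_eq_adjugate_mulVec]
  rfl

/-- Jacobi's formula for the derivative of a determinant. -/
theorem hasDerivAt_det {M : ℝ → Matrix n n ℂ} {M' : Matrix n n ℂ} {x : ℝ}
    (h : ∀ i j, HasDerivAt (fun y => M y i j) (M' i j) x) :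
    HasDerivAt (fun y => (M y).det) (trace (adjugate (M x) * M')) x := by
  have h1 : HasDerivAt (fun y => ∑ s : Equiv.Perm n, ((Equiv.Perm.sign s : ℤ) : ℂ) *
      ∏ j, M y (s j) j) (∑ s : Equiv.Perm n, ((Equiv.Perm.sign s : ℤ) : ℂ) *
      ∑ i, (∏ j ∈ Finset.univ.erase i, M x (s j) j) • M' (s i) i) x := by
    refine HasDerivAt.fun_sum fun s _ => HasDerivAt.const_mul _ ?_
    exact HasDerivAt.fun_finsetProd fun i _ => h (s i) i
  convert h1 using 1
  · funext y; rw [det_apply']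
  · rw [trace_adjugate_mul]
    simp only [det_updateCol_eq_sum, Finset.mul_sum, smul_eq_mul]
    rw [Finset.sum_comm]

/-- As a function of `e` the determinant is the monic characteristic polynomial of `-A`. This lets
identities proved for invertible matrices pass to all matrices by continuity. -/
theorem eventually_det_add_smul_one_ne_zero (A : Matrix n n ℂ) :
    ∀ᶠ e : ℂ in 𝓝[≠] 0, (A + e • (1 : Matrix n n ℂ)).det ≠ 0 := by
  have hf : {e : ℂ | (-A).charpoly.IsRoot e}.Finite :=
    Polynomial.finite_setOfPred_isRoot (charpoly_monic _).ne_zero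
  have : ∀ᶠ e : ℂ in 𝓝[≠] 0, e ∉ {e : ℂ | (-A).charpoly.IsRoot e} := by
    -- The point `0` may itself be a root, so it is removed before the finite root set is
    -- complemented.
    have h2 := (hf.subset (Set.sdiff_subset (t := {0}))).isClosed.isOpen_compl.mem_nhds
      (x := (0 : ℂ)) (by simp)
    filter_upwards [mem_nhdsWithin_of_mem_nhds h2, self_mem_nhdsWithin] with e he h0 hr
    exact he ⟨hr, h0⟩
  filter_upwards [this] with e he h0
  apply he
  simp only [Polynomial.IsRoot.def, eval_charpoly, sub_neg_eq_add]
  rw [add_comm, ← h0, smul_one_eq_diagonal]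
  rfl

/-- The matrix determinant lemma, without invertibility. -/
theorem det_add_vecMulVec (A : Matrix n n ℂ) (u v : n → ℂ) :
    (A + vecMulVec u v).det = A.det + trace (adjugate A * vecMulVec u v) := by
  have key : ∀ B : Matrix n n ℂ, B.det ≠ 0 →
      (B + vecMulVec u v).det = B.det + trace (adjugate B * vecMulVec u v) := by
    intro B hB
    have h := det_add_replicateCol_mul_replicateRow (ι := Unit) (A := B) (isUnit_iff_ne_zero.2 hB) u v
    rw [← vecMulVec_eq] at h
    have e : (replicateRow Unit v * B⁻¹ * replicateCol Unit u) default default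
        = v ⬝ᵥ B⁻¹ *ᵥ u := by
      rw [Matrix.mul_assoc]
      rfl
    rw [h, det_unique (n := Unit), add_apply, e, one_apply_eq, mul_add, mul_one, mul_vecMulVec,
      trace_vecMulVec, inv_def, smul_mulVec, dotProduct_smul, Ring.inverse_eq_inv',
      smul_eq_mul, mul_inv_cancel_left₀ hB, dotProduct_comm]
  have c1 : Continuous fun e : ℂ => ((A + e • (1 : Matrix n n ℂ)) + vecMulVec u v).det := by fun_prop
  have c2 : Continuous fun e : ℂ => (A + e • (1 : Matrix n n ℂ)).det +
      trace (adjugate (A + e • (1 : Matrix n n ℂ)) * vecMulVec u v) := by fun_prop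
  have t1 := (c1.tendsto 0).mono_left (nhdsWithin_le_nhds (s := {0}ᶜ))
  have t2 := (c2.tendsto 0).mono_left (nhdsWithin_le_nhds (s := {0}ᶜ))
  have := tendsto_nhds_unique_of_eventuallyEq t1 t2
    ((eventually_det_add_smul_one_ne_zero A).mono fun e he => key _ he)
  simpa using this

/-- The determinant of a rank two perturbation of an invertible matrix. -/
theorem det_add_rank_two (A : Matrix n n ℂ) (hA : A.det ≠ 0) (u₁ u₂ v₁ v₂ : n → ℂ)
    (c₁₁ c₁₂ c₂₁ c₂₂ : ℂ) :
    (A + (c₁₁ • vecMulVec u₁ v₁ + c₁₂ • vecMulVec u₁ v₂ + c₂₁ • vecMulVec u₂ v₁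
      + c₂₂ • vecMulVec u₂ v₂)).det =
    A.det * ((1 + c₁₁ * (v₁ ⬝ᵥ A⁻¹ *ᵥ u₁) + c₁₂ * (v₂ ⬝ᵥ A⁻¹ *ᵥ u₁)) *
      (1 + c₂₁ * (v₁ ⬝ᵥ A⁻¹ *ᵥ u₂) + c₂₂ * (v₂ ⬝ᵥ A⁻¹ *ᵥ u₂)) -
      (c₁₁ * (v₁ ⬝ᵥ A⁻¹ *ᵥ u₂) + c₁₂ * (v₂ ⬝ᵥ A⁻¹ *ᵥ u₂)) *
      (c₂₁ * (v₁ ⬝ᵥ A⁻¹ *ᵥ u₁) + c₂₂ * (v₂ ⬝ᵥ A⁻¹ *ᵥ u₁))) := by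
  let us : Fin 2 → n → ℂ := ![u₁, u₂]
  -- The perturbation factors as `U * V` through `ℂ²`, the coefficients being absorbed in the rows
  -- of `V`; the determinant then reduces to a two by two one.
  let vs : Fin 2 → n → ℂ := ![c₁₁ • v₁ + c₁₂ • v₂, c₂₁ • v₁ + c₂₂ • v₂]
  let U : Matrix n (Fin 2) ℂ := of fun i j => us j i
  let V : Matrix (Fin 2) n ℂ := of vs
  have h1 : (c₁₁ • vecMulVec u₁ v₁ + c₁₂ • vecMulVec u₁ v₂ + c₂₁ • vecMulVec u₂ v₁
      + c₂₂ • vecMulVec u₂ v₂) = U * V := by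
    ext i j
    simp [U, V, us, vs, mul_apply, vecMulVec_apply, Fin.sum_univ_two]
    ring
  have e : ∀ i j, (V * A⁻¹ * U) i j = vs i ⬝ᵥ A⁻¹ *ᵥ us j := by
    intro i j
    rw [Matrix.mul_assoc]
    rfl
  rw [h1, det_add_mul U V (isUnit_iff_ne_zero.2 hA), det_fin_two]
  simp only [add_apply, e]
  simp only [us, vs, cons_val_zero, cons_val_one, add_dotProduct, smul_dotProduct, one_apply_eq,
    smul_eq_mul, ne_eq, one_ne_zero, zero_ne_one, not_false_eq_true, one_apply_ne]
  ring

end Matrix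

noncomputable section

namespace MT

open scoped PowerSeries

open PowerSeries Matrix

/-! ### Even series acting on odd coefficients. -/

section Even

variable {R : Type*} [CommRing R]

/-- A power series without odd coefficients. -/
def IsEvenSeries (ε : R⟦X⟧) : Prop := ∀ k, coeff (2 * k + 1) ε = 0

theorem isEvenSeries_C (c : R) : IsEvenSeries (C c) := fun k => by
  rw [coeff_C]; simp

theorem IsEvenSeries.add {ε δ : R⟦X⟧} (h : IsEvenSeries ε) (h' : IsEvenSeries δ) :
    IsEvenSeries (ε + δ) := fun k => by rw [map_add, h k, h' k, add_zero]

theorem IsEvenSeries.map {S : Type*} [CommRing S] (g : R →+* S) {ε : R⟦X⟧}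
    (h : IsEvenSeries ε) : IsEvenSeries (PowerSeries.map g ε) := fun k => by
  rw [coeff_map, h k, map_zero]

theorem isEvenSeries_iff (ε : ℂ⟦X⟧) : IsEvenSeries ε ↔ evalNegHom ε = ε := by
  constructor
  · intro h
    ext n
    rw [evalNegHom, coeff_rescale]
    rcases Nat.even_or_odd n with hn | ⟨k, rfl⟩
    · rw [hn.neg_one_pow, one_mul]
    · rw [h k, mul_zero]
  · intro h k
    have := congrArg (coeff (2 * k + 1)) h
    rw [evalNegHom, coeff_rescale, Odd.neg_one_pow ⟨k, rfl⟩] at this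
    linear_combination (-1 / 2 : ℂ) * this

/-- The substitution `X ↦ -X` fixes `ε`, hence fixes its inverse. -/
theorem IsEvenSeries.of_mul_eq_one {ε δ : ℂ⟦X⟧} (h : IsEvenSeries ε) (hm : ε * δ = 1) :
    IsEvenSeries δ := by
  rw [isEvenSeries_iff] at *
  have h1 := congrArg evalNegHom hm
  rw [map_mul, h, map_one] at h1
  calc evalNegHom δ = (ε * δ) * evalNegHom δ := by rw [hm, one_mul]
    _ = δ * (ε * evalNegHom δ) := by ring
    _ = δ := by rw [h1, mul_one]

/-- The action of multiplication by an even series on the odd coefficients. -/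
def evenMat (N : ℕ) (ε : R⟦X⟧) : Matrix (Fin N) (Fin N) R :=
  of fun i j => if j ≤ i then coeff (2 * ((i : ℕ) - j)) ε else 0

/-- An odd index is an even one plus an odd one, so odd coefficients of the product see only odd
coefficients of `F`. This is what the restriction to odd orders of differentiation in `τ` achieves.
-/
theorem coeff_odd_mul {N : ℕ} {ε : R⟦X⟧} (h : IsEvenSeries ε) (F : R⟦X⟧) (i : Fin N) :
    coeff (2 * (i : ℕ) + 1) (ε * F) = ∑ j, evenMat N ε i j * coeff (2 * (j : ℕ) + 1) F := by
  rw [coeff_mul]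
  symm
  have hs : ∑ j, evenMat N ε i j * coeff (2 * (j : ℕ) + 1) F
      = ∑ j with j ≤ i, coeff (2 * ((i : ℕ) - j)) ε * coeff (2 * (j : ℕ) + 1) F := by
    rw [Finset.sum_filter]
    refine Finset.sum_congr rfl fun j _ => ?_
    simp only [evenMat, of_apply]
    split_ifs <;> simp
  rw [hs]
  refine Finset.sum_of_injOn (fun j : Fin N => (2 * ((i : ℕ) - j), 2 * (j : ℕ) + 1)) ?_ ?_ ?_ ?_
  · intro j _ k _ hjk
    simp only [Prod.mk.injEq] at hjk
    exact Fin.ext (by omega)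
  · intro j hj
    have : (j : ℕ) ≤ i := (Finset.mem_filter.1 (Finset.mem_coe.1 hj)).2
    rw [Finset.mem_coe, Finset.HasAntidiagonal.mem_antidiagonal]
    dsimp only
    omega
  · rintro ⟨p, q⟩ hp hq
    simp only [Finset.HasAntidiagonal.mem_antidiagonal] at hp
    rcases Nat.even_or_odd' p with ⟨k, rfl | rfl⟩
    · exfalso
      apply hq
      have hi := i.2
      refine ⟨⟨(i : ℕ) - k, by omega⟩, ?_, ?_⟩
      · rw [Finset.mem_coe, Finset.mem_filter]
        refine ⟨Finset.mem_univ _, ?_⟩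
        change (i : ℕ) - k ≤ i
        omega
      · simp only [Prod.mk.injEq]
        omega
    · simp only [h k, zero_mul]
  · intro j _
    rfl

/-- The matrix is lower triangular with `ε(0)` on the diagonal, so an even weight costs only a
constant factor. -/
theorem det_evenMat (N : ℕ) (ε : R⟦X⟧) : (evenMat N ε).det = constantCoeff ε ^ N := by
  rw [det_of_isLowerTriangular]
  · simp [evenMat]
  · intro i j hij
    have : ¬ j ≤ i := not_le.2 hij
    simp [evenMat, this]

theorem trace_evenMat (N : ℕ) (ε : R⟦X⟧) : (evenMat N ε).trace = N * constantCoeff ε := by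
  simp [trace, evenMat]

end Even

/-! ### The kernel `1/(P(X) + Q(Y))` and its Gram matrices. -/

/-- The inverse of `P(X) + Q(Y)`, a power series in `Y` with coefficients in `ℂ⟦X⟧`. -/
def kernel (P Q : ℂ⟦X⟧) : ℂ⟦X⟧⟦X⟧ := Ring.inverse (C P + PowerSeries.map C Q)

theorem isUnit_kernel_inv {P Q : ℂ⟦X⟧} (h : constantCoeff P + constantCoeff Q ≠ 0) :
    IsUnit (C P + PowerSeries.map C Q : ℂ⟦X⟧⟦X⟧) := by
  rw [isUnit_iff_constantCoeff, isUnit_iff_constantCoeff, map_add, constantCoeff_C,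
    ← coeff_zero_eq_constantCoeff_apply (PowerSeries.map C Q), coeff_map,
    coeff_zero_eq_constantCoeff_apply, map_add, constantCoeff_C, isUnit_iff_ne_zero]
  exact h

theorem kernel_mul {P Q : ℂ⟦X⟧} (h : constantCoeff P + constantCoeff Q ≠ 0) :
    kernel P Q * (C P + PowerSeries.map C Q) = 1 :=
  Ring.inverse_mul_cancel _ (isUnit_kernel_inv h)

theorem eq_kernel {P Q : ℂ⟦X⟧} (h : constantCoeff P + constantCoeff Q ≠ 0) {k : ℂ⟦X⟧⟦X⟧}
    (hk : k * (C P + PowerSeries.map C Q) = 1) : k = kernel P Q := by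
  calc k = k * (kernel P Q * (C P + PowerSeries.map C Q)) := by rw [kernel_mul h, mul_one]
    _ = (k * (C P + PowerSeries.map C Q)) * kernel P Q := by ring
    _ = kernel P Q := by rw [hk, one_mul]

/-- The odd coefficients of a power series. -/
def oddVec (N : ℕ) (F : ℂ⟦X⟧) : Fin N → ℂ := fun i => coeff (2 * (i : ℕ) + 1) F

/-- The matrix of odd coefficients of `F(X) H(Y) / (P(X) + Q(Y))`. -/
def gram (N : ℕ) (P Q F H : ℂ⟦X⟧) : Matrix (Fin N) (Fin N) ℂ := of fun i j =>
  coeff (2 * (i : ℕ) + 1) (coeff (2 * (j : ℕ) + 1) (C F * PowerSeries.map C H * kernel P Q))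

section gram

variable {N : ℕ} {P Q : ℂ⟦X⟧}

theorem gram_add_left (F F' H : ℂ⟦X⟧) :
    gram N P Q (F + F') H = gram N P Q F H + gram N P Q F' H := by
  ext i j
  simp only [gram, of_apply, Matrix.add_apply, map_add, add_mul]

theorem gram_add_right (F H H' : ℂ⟦X⟧) :
    gram N P Q F (H + H') = gram N P Q F H + gram N P Q F H' := by
  ext i j
  simp only [gram, of_apply, Matrix.add_apply, map_add, add_mul, mul_add]

theorem gram_C_mul_left (c : ℂ) (F H : ℂ⟦X⟧) :
    gram N P Q (C c * F) H = c • gram N P Q F H := by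
  ext i j
  simp only [gram, of_apply, Matrix.smul_apply, map_mul, mul_assoc, coeff_C_mul, smul_eq_mul]

theorem gram_C_mul_right (c : ℂ) (F H : ℂ⟦X⟧) :
    gram N P Q F (C c * H) = c • gram N P Q F H := by
  rw [← gram_C_mul_left]
  ext i j
  simp only [gram, of_apply, map_mul, map_C]
  ring_nf

theorem coeff_coeff_C_mul_map (F H : ℂ⟦X⟧) (i j : ℕ) :
    coeff i (coeff j (C F * PowerSeries.map C H : ℂ⟦X⟧⟦X⟧)) = coeff i F * coeff j H := by
  rw [coeff_C_mul, coeff_map, coeff_mul_C]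

/-- The factor `P + Q` cancels the kernel and leaves a product of a series in `X` and a series in
`Y`. Every rank one term below originates here. -/
theorem gram_mul_add (h : constantCoeff P + constantCoeff Q ≠ 0) (F H : ℂ⟦X⟧) :
    gram N P Q (P * F) H + gram N P Q F (Q * H) = vecMulVec (oddVec N F) (oddVec N H) := by
  ext i j
  simp only [gram, of_apply, Matrix.add_apply, vecMulVec_apply, oddVec]
  rw [← coeff_coeff_C_mul_map, ← map_add, ← map_add]
  congr 2
  calc _ = (C F * PowerSeries.map C H) * (kernel P Q * (C P + PowerSeries.map C Q)) := by
        simp only [map_mul]; ring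
    _ = _ := by rw [kernel_mul h, mul_one]

theorem gram_even_left {ε : ℂ⟦X⟧} (hε : IsEvenSeries ε) (F H : ℂ⟦X⟧) :
    gram N P Q (ε * F) H = evenMat N ε * gram N P Q F H := by
  ext i j
  simp only [gram, of_apply, Matrix.mul_apply, map_mul, mul_assoc, coeff_C_mul ]
  rw [coeff_odd_mul hε]

theorem gram_even_right {ε : ℂ⟦X⟧} (hε : IsEvenSeries ε) (F H : ℂ⟦X⟧) :
    gram N P Q F (ε * H) = gram N P Q F H * (evenMat N ε)ᵀ := by
  ext i j
  simp only [gram, of_apply, Matrix.mul_apply, map_mul, transpose_apply]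
  rw [show C F * (PowerSeries.map C ε * PowerSeries.map C H) * kernel P Q =
    PowerSeries.map C ε * (C F * PowerSeries.map C H * kernel P Q) by ring,
    coeff_odd_mul (hε.map C), map_sum]
  refine Finset.sum_congr rfl fun k _ => ?_
  have : evenMat N (PowerSeries.map C ε) j k = C (evenMat N ε j k) := by
    simp only [evenMat, of_apply, coeff_map]
    split_ifs <;> simp
  rw [this, coeff_C_mul, mul_comm]

/-- Complex conjugation of the coefficients. -/
def conjSeries : ℂ⟦X⟧ →+* ℂ⟦X⟧ := PowerSeries.map (starRingEnd ℂ)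

theorem coeff_conjSeries (n : ℕ) (F : ℂ⟦X⟧) : coeff n (conjSeries F) = conj (coeff n F) :=
  coeff_map _ _ _

theorem conjSeries_conjSeries (F : ℂ⟦X⟧) : conjSeries (conjSeries F) = F := by
  ext n; simp [coeff_conjSeries]

theorem conjSeries_C (c : ℂ) : conjSeries (C c) = C (conj c) := map_C _ _

/-- Interchange of the two variables. -/
def swapSeries (F : ℂ⟦X⟧⟦X⟧) : ℂ⟦X⟧⟦X⟧ := mk fun j => mk fun i => coeff j (coeff i F)

theorem coeff_swapSeries (F : ℂ⟦X⟧⟦X⟧) (i j : ℕ) :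
    coeff i (coeff j (swapSeries F)) = coeff j (coeff i F) := by
  simp [swapSeries]

theorem swapSeries_mul (F F' : ℂ⟦X⟧⟦X⟧) :
    swapSeries (F * F') = swapSeries F * swapSeries F' := by
  ext j i
  rw [coeff_swapSeries, coeff_mul, coeff_mul, map_sum, map_sum]
  simp only [coeff_mul, coeff_swapSeries]
  exact Finset.sum_comm

theorem swapSeries_add (F F' : ℂ⟦X⟧⟦X⟧) :
    swapSeries (F + F') = swapSeries F + swapSeries F' := by
  ext j i
  simp [coeff_swapSeries]

theorem swapSeries_C (F : ℂ⟦X⟧) : swapSeries (C F) = PowerSeries.map C F := by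
  ext j i
  rw [coeff_swapSeries, coeff_map, coeff_C, coeff_C]
  split_ifs <;> simp

theorem swapSeries_map (F : ℂ⟦X⟧) : swapSeries (PowerSeries.map C F) = C F := by
  ext j i
  rw [coeff_swapSeries, coeff_map, coeff_C, coeff_C]
  split_ifs <;> simp

theorem swapSeries_one : swapSeries 1 = 1 := by
  rw [← map_one C, swapSeries_C, map_one, map_one]

/-- Complex conjugation of all the coefficients of a series in two variables. -/
def conjSeries₂ : ℂ⟦X⟧⟦X⟧ →+* ℂ⟦X⟧⟦X⟧ := PowerSeries.map conjSeries

/-- Conjugating and exchanging the variables preserves `P(X) + Q(Y)` when `Q` is the conjugate of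
`P`; inverses are unique, so the kernel is Hermitian. -/
theorem conj_swap_kernel (h : constantCoeff P + constantCoeff Q ≠ 0) (hPQ : conjSeries P = Q) :
    conjSeries₂ (swapSeries (kernel P Q)) = kernel P Q := by
  refine eq_kernel h ?_
  have h1 := congrArg conjSeries₂ (congrArg swapSeries (kernel_mul h))
  have hQP : conjSeries Q = P := by rw [← hPQ, conjSeries_conjSeries]
  have e1 : conjSeries₂ (C Q) = C P := by rw [conjSeries₂, map_C, hQP]
  have e2 : conjSeries₂ (PowerSeries.map C P) = PowerSeries.map C Q := by
    rw [← hPQ]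
    ext j i
    simp only [conjSeries₂, coeff_map, conjSeries_C, coeff_conjSeries]
  rw [swapSeries_mul, swapSeries_one, map_one, map_mul, swapSeries_add, swapSeries_C,
    swapSeries_map, map_add, e1, e2, add_comm (PowerSeries.map C Q)] at h1
  exact h1

theorem gram_conjTranspose (h : constantCoeff P + constantCoeff Q ≠ 0) (hPQ : conjSeries P = Q)
    (F H : ℂ⟦X⟧) :
    (gram N P Q F H)ᴴ = gram N P Q (conjSeries H) (conjSeries F) := by
  ext i j
  simp only [gram, of_apply, conjTranspose_apply]
  have e : C (conjSeries H) * PowerSeries.map C (conjSeries F) * kernel P Q =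
      conjSeries₂ (swapSeries (C F * PowerSeries.map C H * kernel P Q)) := by
    rw [swapSeries_mul, swapSeries_mul, map_mul, conj_swap_kernel h hPQ, map_mul, swapSeries_C,
      swapSeries_map, mul_comm (C (conjSeries H))]
    congr 2
    · ext j i
      simp only [conjSeries₂, coeff_map, conjSeries_C]
      rw [coeff_conjSeries]
    · rw [conjSeries₂, map_C]
  rw [e, conjSeries₂, coeff_map, coeff_conjSeries, coeff_swapSeries]
  rfl

end gram

/-! ### Bilinear identities for perturbations of rank two. -/

section RankTwo

variable {n : Type*} [Fintype n] [DecidableEq n]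

theorem trace_adjugate_mul_vecMulVec (A : Matrix n n ℂ) (u v : n → ℂ) :
    trace (adjugate A * vecMulVec u v) = (A + vecMulVec u v).det - A.det := by
  rw [det_add_vecMulVec]; ring

/-- The determinant of a perturbation of `A` in the span of the `uᵢ ⊗ vⱼ`. -/
theorem det_eq_of_rank_two {A B : Matrix n n ℂ} (hA : A.det ≠ 0) (u₁ u₂ v₁ v₂ : n → ℂ)
    (c₁₁ c₁₂ c₂₁ c₂₂ : ℂ)
    (hB : ∀ i j, B i j = A i j + (c₁₁ * (u₁ i * v₁ j) + c₁₂ * (u₁ i * v₂ j)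
      + c₂₁ * (u₂ i * v₁ j) + c₂₂ * (u₂ i * v₂ j))) :
    B.det =
    A.det * ((1 + c₁₁ * (v₁ ⬝ᵥ A⁻¹ *ᵥ u₁) + c₁₂ * (v₂ ⬝ᵥ A⁻¹ *ᵥ u₁)) *
      (1 + c₂₁ * (v₁ ⬝ᵥ A⁻¹ *ᵥ u₂) + c₂₂ * (v₂ ⬝ᵥ A⁻¹ *ᵥ u₂)) -
      (c₁₁ * (v₁ ⬝ᵥ A⁻¹ *ᵥ u₂) + c₁₂ * (v₂ ⬝ᵥ A⁻¹ *ᵥ u₂)) *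
      (c₂₁ * (v₁ ⬝ᵥ A⁻¹ *ᵥ u₁) + c₂₂ * (v₂ ⬝ᵥ A⁻¹ *ᵥ u₁))) := by
  rw [← det_add_rank_two A hA]
  congr 1
  ext i j
  rw [hB]
  simp [vecMulVec_apply]


/-- All the determinants involved are perturbations of `M` in the span of the `uᵢ ⊗ vⱼ`. Each is
`det M` times a polynomial in the four numbers `vⱼ · M⁻¹ uᵢ`, which leaves an identity for `ring`.
The traces are derivatives along the flow with symbol `1/(p - c)`. -/
theorem bilinear_shift_flow {M : Matrix n n ℂ} (hM : M.det ≠ 0) (u₁ u₂ v₁ v₂ : n → ℂ)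
    (c : ℂ) :
    -c * (trace (adjugate M * vecMulVec (u₁ + c • u₂) v₂) * (M - vecMulVec u₁ v₁).det
      - M.det * trace (adjugate (M - vecMulVec u₁ v₁) * -vecMulVec u₂ (v₁ - c • v₂)))
    = (M - c • vecMulVec u₁ v₂).det * (M - vecMulVec (u₁ + c • u₂) v₁).det
      - M.det * (M - vecMulVec u₁ v₁).det := by
  rw [Matrix.mul_neg, trace_neg, trace_adjugate_mul_vecMulVec, trace_adjugate_mul_vecMulVec,
    det_eq_of_rank_two (B := M + vecMulVec (u₁ + c • u₂) v₂) hM u₁ u₂ v₁ v₂ 0 1 0 c,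
    det_eq_of_rank_two (B := M - vecMulVec u₁ v₁) hM u₁ u₂ v₁ v₂ (-1) 0 0 0,
    det_eq_of_rank_two (B := M - vecMulVec u₁ v₁ + vecMulVec u₂ (v₁ - c • v₂))
      hM u₁ u₂ v₁ v₂ (-1) 0 1 (-c),
    det_eq_of_rank_two (B := M - c • vecMulVec u₁ v₂) hM u₁ u₂ v₁ v₂ 0 (-c) 0 0,
    det_eq_of_rank_two (B := M - vecMulVec (u₁ + c • u₂) v₁) hM u₁ u₂ v₁ v₂ (-1) 0 (-c) 0]
  · ring
  all_goals
    intro i j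
    simp only [Matrix.add_apply, Matrix.sub_apply, Matrix.smul_apply, vecMulVec_apply, Pi.add_apply, Pi.sub_apply,
      Pi.smul_apply, smul_eq_mul]
    ring

/-- Same mechanism for the flow with symbol `p`, the case of a pole at infinity. -/
theorem bilinear_infinite_flow {M : Matrix n n ℂ} (hM : M.det ≠ 0) (u₁ u₂ v₁ v₂ : n → ℂ)
    (c : ℂ) :
    trace (adjugate (M - c • vecMulVec u₁ v₂) * vecMulVec (u₂ - c • u₁) (v₁ - c • v₂)) * M.det
      - (M - c • vecMulVec u₁ v₂).det * trace (adjugate M * vecMulVec u₂ v₁)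
    = -c * ((M - c • vecMulVec u₁ v₂).det * M.det
      - (M - vecMulVec u₂ v₂).det * (M - vecMulVec u₁ v₁).det) := by
  rw [trace_adjugate_mul_vecMulVec, trace_adjugate_mul_vecMulVec,
    det_eq_of_rank_two (B := M - c • vecMulVec u₁ v₂ + vecMulVec (u₂ - c • u₁) (v₁ - c • v₂))
      hM u₁ u₂ v₁ v₂ (-c) (c ^ 2 - c) 1 (-c),
    det_eq_of_rank_two (B := M - c • vecMulVec u₁ v₂) hM u₁ u₂ v₁ v₂ 0 (-c) 0 0,
    det_eq_of_rank_two (B := M + vecMulVec u₂ v₁) hM u₁ u₂ v₁ v₂ 0 0 1 0,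
    det_eq_of_rank_two (B := M - vecMulVec u₂ v₂) hM u₁ u₂ v₁ v₂ 0 0 0 (-1),
    det_eq_of_rank_two (B := M - vecMulVec u₁ v₁) hM u₁ u₂ v₁ v₂ (-1) 0 0 0]
  · ring
  all_goals
    intro i j
    simp only [Matrix.add_apply, Matrix.sub_apply, Matrix.smul_apply, vecMulVec_apply, Pi.sub_apply,
      Pi.smul_apply, smul_eq_mul]
    ring

/-- Same mechanism for the flow with symbol `1/p`, compared across the index shifts attached to `p`
and to `p - c`. -/
theorem bilinear_double_shift_flow {M : Matrix n n ℂ} (hM : M.det ≠ 0) (u₁ u₂ v₁ v₂ : n → ℂ)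
    (c : ℂ) :
    c * (trace (adjugate (M - c • vecMulVec u₁ v₂) * vecMulVec (u₁ - c • u₂) v₂)
        * (M - vecMulVec u₁ v₁).det
      - (M - c • vecMulVec u₁ v₂).det
        * trace (adjugate (M - vecMulVec u₁ v₁) * -vecMulVec u₂ v₁))
      + (M - c • vecMulVec u₁ v₂).det * (M - vecMulVec u₁ v₁).det
    = (M - vecMulVec u₁ v₁ + c • vecMulVec u₂ (v₁ - c • v₂)).det * M.det := by
  rw [Matrix.mul_neg, trace_neg, trace_adjugate_mul_vecMulVec, trace_adjugate_mul_vecMulVec,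
    det_eq_of_rank_two (B := M - c • vecMulVec u₁ v₂ + vecMulVec (u₁ - c • u₂) v₂)
      hM u₁ u₂ v₁ v₂ 0 (1 - c) 0 (-c),
    det_eq_of_rank_two (B := M - c • vecMulVec u₁ v₂) hM u₁ u₂ v₁ v₂ 0 (-c) 0 0,
    det_eq_of_rank_two (B := M - vecMulVec u₁ v₁ + vecMulVec u₂ v₁)
      hM u₁ u₂ v₁ v₂ (-1) 0 1 0,
    det_eq_of_rank_two (B := M - vecMulVec u₁ v₁ + c • vecMulVec u₂ (v₁ - c • v₂))
      hM u₁ u₂ v₁ v₂ (-1) 0 c (-(c * c)),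
    det_eq_of_rank_two (B := M - vecMulVec u₁ v₁) hM u₁ u₂ v₁ v₂ (-1) 0 0 0]
  · ring
  all_goals
    intro i j
    simp only [Matrix.add_apply, Matrix.sub_apply, Matrix.smul_apply, vecMulVec_apply, Pi.sub_apply,
      Pi.smul_apply, smul_eq_mul]
    ring

end RankTwo

/-! ### Jets: Taylor series along the flow of `w ∂`. -/

/-- The generating series of the numbers `(w ∂)^i F (z₀) / i!`. -/
def jet (w : ℂ → ℂ) (z₀ : ℂ) (F : ℂ → ℂ) : ℂ⟦X⟧ :=
  mk fun i => (weightedDeriv w)^[i] F z₀ / (i ! : ℂ)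

section jet

variable {w F H : ℂ → ℂ} {z₀ : ℂ}

theorem weightedDeriv_congr (h : F =ᶠ[𝓝 z₀] H) :
    weightedDeriv w F =ᶠ[𝓝 z₀] weightedDeriv w H :=
  h.deriv.mono fun z hz => by simp only [weightedDeriv, hz]

theorem iterate_weightedDeriv_congr (n : ℕ) (h : F =ᶠ[𝓝 z₀] H) :
    (weightedDeriv w)^[n] F =ᶠ[𝓝 z₀] (weightedDeriv w)^[n] H := by
  induction n generalizing F H with
  | zero => exact h
  | succ n ih => exact ih (weightedDeriv_congr h)

theorem analyticAt_weightedDeriv (hw : AnalyticAt ℂ w z₀) (hF : AnalyticAt ℂ F z₀) :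
    AnalyticAt ℂ (weightedDeriv w F) z₀ := hw.mul hF.deriv

theorem jet_congr (h : F =ᶠ[𝓝 z₀] H) : jet w z₀ F = jet w z₀ H := by
  ext n
  simp only [jet, coeff_mk, (iterate_weightedDeriv_congr n h).eq_of_nhds]

theorem constantCoeff_jet : constantCoeff (jet w z₀ F) = F z₀ := by
  rw [← coeff_zero_eq_constantCoeff_apply]
  simp [jet]

theorem coeff_succ_jet (n : ℕ) :
    coeff (n + 1) (jet w z₀ F) * (n + 1) = coeff n (jet w z₀ (weightedDeriv w F)) := by
  simp only [jet, coeff_mk, Function.iterate_succ_apply, Nat.factorial_succ, Nat.cast_mul,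
    Nat.cast_add, Nat.cast_one]
  have := Nat.cast_add_one_ne_zero (R := ℂ) n
  have := Nat.cast_ne_zero (R := ℂ).2 n.factorial_ne_zero
  field_simp

/-- The jet is the expansion of `F` along the flow of the vector field `w ∂`, so `w ∂` becomes
`d/dX`. All rules for jets rest on this. -/
theorem derivative_jet : d⁄dX ℂ (jet w z₀ F) = jet w z₀ (weightedDeriv w F) := by
  ext n
  rw [coeff_derivative, coeff_succ_jet]

theorem jet_eq_of_derivative {G : ℂ⟦X⟧} (h0 : F z₀ = constantCoeff G)
    (hd : jet w z₀ (weightedDeriv w F) = d⁄dX ℂ G) : jet w z₀ F = G :=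
  derivative.ext (derivative_jet.trans hd) (constantCoeff_jet.trans h0)

theorem jet_const (c : ℂ) : jet w z₀ (fun _ => c) = C c := by
  have hz : ∀ n, (weightedDeriv w)^[n] (fun _ => (0 : ℂ)) = fun _ => 0 := by
    intro n
    induction n with
    | zero => rfl
    | succ n ih =>
      rw [Function.iterate_succ_apply]
      convert ih using 2
      funext z
      simp [weightedDeriv]
  refine jet_eq_of_derivative (by simp) ?_
  rw [derivative_C]
  ext n
  have : weightedDeriv w (fun _ => c) = fun _ => 0 := by
    funext z
    simp [weightedDeriv]
  rw [this, jet, coeff_mk, hz]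
  simp

theorem jet_add (hw : AnalyticAt ℂ w z₀) (hF : AnalyticAt ℂ F z₀) (hH : AnalyticAt ℂ H z₀) :
    jet w z₀ (fun z => F z + H z) = jet w z₀ F + jet w z₀ H := by
  ext n
  induction n generalizing F H with
  | zero => simp [constantCoeff_jet]
  | succ n ih =>
    have h0 : (n + 1 : ℂ) ≠ 0 := Nat.cast_add_one_ne_zero n
    refine mul_right_cancel₀ h0 ?_
    have e : weightedDeriv w (fun z => F z + H z) =ᶠ[𝓝 z₀]
        fun z => weightedDeriv w F z + weightedDeriv w H z := by
      filter_upwards [hF.eventually_analyticAt, hH.eventually_analyticAt] with z h1 h2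
      simp only [weightedDeriv]
      rw [deriv_fun_add h1.differentiableAt h2.differentiableAt, mul_add]
    rw [coeff_succ_jet, jet_congr e,
      ih (analyticAt_weightedDeriv hw hF) (analyticAt_weightedDeriv hw hH), map_add, map_add,
      add_mul, coeff_succ_jet, coeff_succ_jet]

/-- `w ∂` is a derivation; the coefficients are compared by induction through the Leibniz rule. -/
theorem jet_mul (hw : AnalyticAt ℂ w z₀) (hF : AnalyticAt ℂ F z₀) (hH : AnalyticAt ℂ H z₀) :
    jet w z₀ (fun z => F z * H z) = jet w z₀ F * jet w z₀ H := by
  ext n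
  induction n generalizing F H with
  | zero => simp [constantCoeff_jet]
  | succ n ih =>
    have h0 : (n + 1 : ℂ) ≠ 0 := Nat.cast_add_one_ne_zero n
    refine mul_right_cancel₀ h0 ?_
    have hF' := analyticAt_weightedDeriv hw hF
    have hH' := analyticAt_weightedDeriv hw hH
    have e : weightedDeriv w (fun z => F z * H z) =ᶠ[𝓝 z₀]
        fun z => weightedDeriv w F z * H z + F z * weightedDeriv w H z := by
      filter_upwards [hF.eventually_analyticAt, hH.eventually_analyticAt] with z h1 h2
      simp only [weightedDeriv]
      rw [deriv_fun_mul h1.differentiableAt h2.differentiableAt]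
      ring
    rw [coeff_succ_jet, jet_congr e, jet_add hw (hF'.fun_mul hH) (hF.fun_mul hH'), map_add, ih hF' hH,
      ih hF hH', ← coeff_derivative, Derivation.leibniz, derivative_jet, derivative_jet, map_add,
      smul_eq_mul, smul_eq_mul, mul_comm (jet w z₀ H)]
    ring

theorem jet_const_mul (hw : AnalyticAt ℂ w z₀) (c : ℂ) (hF : AnalyticAt ℂ F z₀) :
    jet w z₀ (fun z => c * F z) = C c * jet w z₀ F := by
  rw [jet_mul hw analyticAt_const hF, jet_const]

theorem jet_sum {ι : Type*} (hw : AnalyticAt ℂ w z₀) (s : Finset ι) {F : ι → ℂ → ℂ}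
    (hF : ∀ i ∈ s, AnalyticAt ℂ (F i) z₀) :
    jet w z₀ (fun z => ∑ i ∈ s, F i z) = ∑ i ∈ s, jet w z₀ (F i) := by
  classical
  induction s using Finset.induction_on with
  | empty => simp [jet_const]
  | insert i s hi ih =>
    simp only [Finset.sum_insert hi]
    rw [jet_add hw (hF i (by simp))
      (Finset.analyticAt_fun_sum s fun j hj => hF j (by simp [hj])),
      ih fun j hj => hF j (by simp [hj])]

theorem jet_mul_inv (hw : AnalyticAt ℂ w z₀) (hF : AnalyticAt ℂ F z₀) (h0 : F z₀ ≠ 0) :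
    jet w z₀ F * jet w z₀ (fun z => (F z)⁻¹) = 1 := by
  rw [← jet_mul hw hF (hF.fun_inv h0), ← map_one C, ← jet_const (w := w) (z₀ := z₀)]
  refine jet_congr ?_
  filter_upwards [hF.continuousAt.eventually_ne h0] with z hz
  exact mul_inv_cancel₀ hz

theorem jet_inv (hw : AnalyticAt ℂ w z₀) (hF : AnalyticAt ℂ F z₀) (h0 : F z₀ ≠ 0) :
    jet w z₀ (fun z => (F z)⁻¹) = (jet w z₀ F)⁻¹ := by
  rw [PowerSeries.eq_inv_iff_mul_eq_one (by rwa [constantCoeff_jet]), mul_comm,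
    jet_mul_inv hw hF h0]

/-- The exponential is recorded only through its differential equation `Φ' = L'Φ`. This gives
recursions for the coefficients without composing power series. -/
theorem derivative_jet_exp (hw : AnalyticAt ℂ w z₀) (hF : AnalyticAt ℂ F z₀) :
    d⁄dX ℂ (jet w z₀ fun z => Complex.exp (F z)) =
      d⁄dX ℂ (jet w z₀ F) * jet w z₀ (fun z => Complex.exp (F z)) := by
  have hE : AnalyticAt ℂ (fun z => Complex.exp (F z)) z₀ := hF.cexp'
  rw [derivative_jet, derivative_jet, ← jet_mul hw (analyticAt_weightedDeriv hw hF) hE]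
  refine jet_congr ?_
  filter_upwards [hF.eventually_analyticAt] with z hz
  simp only [weightedDeriv]
  rw [deriv_cexp hz.differentiableAt]
  ring

theorem jet_conj (w F : ℂ → ℂ) (z₀ : ℂ) :
    jet (fun z => conj (w (conj z))) (conj z₀) (fun z => conj (F (conj z)))
      = conjSeries (jet w z₀ F) := by
  have key : ∀ n, (weightedDeriv fun z => conj (w (conj z)))^[n] (fun z => conj (F (conj z)))
      = fun z => conj ((weightedDeriv w)^[n] F (conj z)) := by
    intro n
    induction n generalizing F with
    | zero => rfl
    | succ n ih =>
      rw [Function.iterate_succ_apply, Function.iterate_succ_apply, ← ih]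
      congr 1
      funext z
      simp only [weightedDeriv, map_mul]
      congr 1
      exact congrFun (deriv_conj_conj (f := F)) z
  ext n
  rw [coeff_conjSeries, jet, jet, coeff_mk, coeff_mk, key]
  simp

end jet

/-! ### Jets in two variables. -/

section TwoVariables

variable {wp wq : ℂ → ℂ} {z₁ z₂ : ℂ}

/-- The inner jet in `q` must be analytic in `p` before the outer jet can be taken; the recursion
for the coefficients of an inverse series gives this by strong induction. -/
theorem analyticAt_coeff_inv_add (Q : ℂ⟦X⟧) (h : z₁ + constantCoeff Q ≠ 0) (n : ℕ) :
    AnalyticAt ℂ (fun p => coeff n (C p + Q)⁻¹) z₁ := by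
  have h0 : AnalyticAt ℂ (fun p => (p + constantCoeff Q)⁻¹) z₁ :=
    (analyticAt_id.add analyticAt_const).fun_inv h
  induction n using Nat.strong_induction_on with
  | _ n ih =>
    have e : (fun p : ℂ => coeff n (C p + Q)⁻¹) = fun p => if n = 0 then (p + constantCoeff Q)⁻¹
        else -(p + constantCoeff Q)⁻¹ * ∑ x ∈ Finset.HasAntidiagonal.antidiagonal n,
          if x.2 < n then (coeff x.1 (C p) + coeff x.1 Q) * coeff x.2 (C p + Q)⁻¹ else 0 := by
      funext p
      rw [coeff_inv]
      simp only [map_add, constantCoeff_C]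
    rw [e]
    split_ifs with hn
    · exact h0
    · refine h0.neg.mul (Finset.analyticAt_fun_sum _ fun x _ => ?_)
      split_ifs with hx
      · have h1 : AnalyticAt ℂ (fun p => coeff x.1 (C p) + coeff x.1 Q) z₁ := by
          simp only [coeff_C]
          split_ifs
          · exact analyticAt_id.add analyticAt_const
          · exact analyticAt_const
        exact h1.mul (ih x.2 hx)
      · exact analyticAt_const

/-- The two variable jet of `A(p) B(q) / (p + q)` is `A(X) B(Y) / (P(X) + Q(Y))`. -/
theorem coeff_jet_jet (hwp : AnalyticAt ℂ wp z₁) (hwq : AnalyticAt ℂ wq z₂) (h : z₁ + z₂ ≠ 0)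
    {A B : ℂ → ℂ} (hA : AnalyticAt ℂ A z₁) (hB : AnalyticAt ℂ B z₂) (i j : ℕ) :
    coeff i (jet wp z₁ fun p => coeff j (jet wq z₂ fun q => A p * B q * (p + q)⁻¹)) =
    coeff i (coeff j (C (jet wp z₁ A) * PowerSeries.map C (jet wq z₂ B) *
      kernel (jet wp z₁ fun p => p) (jet wq z₂ fun q => q))) := by
  set P := jet wp z₁ fun p => p with hP
  set Q := jet wq z₂ fun q => q with hQ
  have hcP : constantCoeff P = z₁ := constantCoeff_jet
  have hcQ : constantCoeff Q = z₂ := constantCoeff_jet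
  set k : ℕ → ℂ → ℂ := fun n p => coeff n (C p + Q)⁻¹ with hk
  have hka : ∀ n, AnalyticAt ℂ (k n) z₁ := analyticAt_coeff_inv_add Q (by rwa [hcQ])
  have hne : ∀ᶠ p in 𝓝 z₁, p + z₂ ≠ 0 :=
    (continuousAt_id.add continuousAt_const).eventually_ne h
  have hC : ∀ p, p + z₂ ≠ 0 → (C p + Q) * (C p + Q)⁻¹ = 1 := fun p hp =>
    PowerSeries.mul_inv_cancel _ (by simpa [hcQ] using hp)
  -- Taking the `p`-jet of each `Y`-coefficient of `1/(p + Q(Y))` gives a series satisfying the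
  -- defining equation of the kernel, and that equation has one solution.
  have hkernel : (mk fun n => jet wp z₁ (k n)) = kernel P Q := by
    refine eq_kernel (by rwa [hcP, hcQ]) ?_
    ext1 n
    rw [mul_add, map_add, coeff_mul_C, coeff_mul]
    simp only [coeff_mk, coeff_map]
    have e1 : jet wp z₁ (k n) * P = jet wp z₁ fun p => k n p * p :=
      (jet_mul hwp (hka n) analyticAt_id).symm
    have e2 : ∀ x ∈ Finset.HasAntidiagonal.antidiagonal n, jet wp z₁ (k x.1) * C (coeff x.2 Q) =
        jet wp z₁ fun p => k x.1 p * coeff x.2 Q := fun x _ => by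
      rw [jet_mul hwp (hka _) analyticAt_const, jet_const]
    rw [Finset.sum_congr rfl e2, ← jet_sum hwp _ fun x _ => (hka _).fun_mul analyticAt_const, e1,
      ← jet_add hwp ((hka n).fun_mul (by fun_prop))
        (Finset.analyticAt_fun_sum _ fun x _ => (hka _).fun_mul analyticAt_const)]
    have e3 : (fun p => k n p * p + ∑ x ∈ Finset.HasAntidiagonal.antidiagonal n, k x.1 p * coeff x.2 Q)
        =ᶠ[𝓝 z₁] fun _ => coeff n (1 : ℂ⟦X⟧) := by
      filter_upwards [hne] with p hp
      rw [← hC p hp, mul_comm (C p + Q), mul_add, map_add, coeff_mul_C, coeff_mul]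
    rw [jet_congr e3, jet_const, coeff_one, coeff_one]
    split_ifs <;> simp
  have e : (fun p => coeff j (jet wq z₂ fun q => A p * B q * (p + q)⁻¹)) =ᶠ[𝓝 z₁]
      fun p => A p * ∑ x ∈ Finset.HasAntidiagonal.antidiagonal j, coeff x.1 (jet wq z₂ B) * k x.2 p := by
    filter_upwards [hne] with p hp
    have hpq : AnalyticAt ℂ (fun q => p + q) z₂ := analyticAt_const.add analyticAt_id
    have hi : AnalyticAt ℂ (fun q => (p + q)⁻¹) z₂ := hpq.fun_inv hp
    have hj : jet wq z₂ (fun q => p + q) = C p + Q := by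
      rw [jet_add hwq analyticAt_const (by fun_prop), jet_const]
    simp only [mul_assoc]
    rw [jet_const_mul hwq _ (hB.fun_mul hi), jet_mul hwq hB hi, coeff_C_mul, jet_inv hwq hpq hp, hj,
      coeff_mul]
  rw [jet_congr e, jet_mul hwp hA (Finset.analyticAt_fun_sum _ fun x _ =>
    analyticAt_const.fun_mul (hka _)), jet_sum hwp _ fun x _ => analyticAt_const.fun_mul (hka _),
    ← hkernel, mul_assoc (C _), coeff_C_mul]
  refine congrArg (fun s => coeff i (jet wp z₁ A * s)) ?_
  rw [coeff_mul]
  refine Finset.sum_congr rfl fun x _ => ?_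
  rw [jet_const_mul hwp _ (hka _), coeff_map, coeff_mk]

end TwoVariables

/-! ### The spectral parameter `p = iβ + r e^X`. -/

/-- The expansion `i β + r e^X` of the spectral parameter. -/
def spec (β r : ℝ) : ℂ⟦X⟧ := C (Complex.I * β) + C (r : ℂ) * exp ℂ

/-- The series `r⁻¹ e^{-X}`. -/
def specInv (r : ℝ) : ℂ⟦X⟧ := C (r : ℂ)⁻¹ * evalNegHom (exp ℂ)

section spec

variable {β r : ℝ}

theorem constantCoeff_spec : constantCoeff (spec β r) = Complex.I * β + r := by
  simp [spec]

theorem spec_sub_mul_specInv (hr : r ≠ 0) :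
    (spec β r - C (Complex.I * β)) * specInv r = 1 := by
  have h : C (r : ℂ) * C (r : ℂ)⁻¹ = 1 := by
    rw [← map_mul, mul_inv_cancel₀ (by exact_mod_cast hr), map_one]
  have h' := exp_mul_exp_neg_eq_one (A := ℂ)
  rw [spec, specInv]
  linear_combination (exp ℂ * evalNegHom (exp ℂ)) * h + h'

/-- The sum is `iβ + 2r cosh X`. -/
theorem isEvenSeries_spec_add (hr : r ≠ 0) :
    IsEvenSeries (spec β r + C ((r : ℂ) ^ 2) * specInv r) := by
  have h : C ((r : ℂ) ^ 2) * C (r : ℂ)⁻¹ = C (r : ℂ) := by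
    rw [← map_mul]
    congr 1
    have : (r : ℂ) ≠ 0 := by exact_mod_cast hr
    field_simp
  rw [spec, specInv, ← mul_assoc, h, add_assoc, ← mul_add]
  refine (isEvenSeries_C _).add ?_
  intro k
  rw [coeff_C_mul, map_add, evalNegHom, coeff_rescale, Odd.neg_one_pow ⟨k, rfl⟩]
  ring

theorem conjSeries_spec : conjSeries (spec β r) = spec (-β) r := by
  ext n
  rw [coeff_conjSeries, spec, spec]
  simp [coeff_exp, coeff_C]
  split_ifs <;> simp

theorem constantCoeff_add_ne_zero (hr : r ≠ 0) :
    constantCoeff (spec β r) + constantCoeff (spec (-β) r) ≠ 0 := by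
  rw [constantCoeff_spec, constantCoeff_spec]
  have : (r : ℂ) ≠ 0 := by exact_mod_cast hr
  intro h
  apply this
  push_cast at h
  linear_combination h / 2

theorem spec_sub_mul_inv (hr : r ≠ 0) (s : ℝ) :
    (spec β r - C (Complex.I * s)) * (spec β r - C (Complex.I * s))⁻¹ = 1 := by
  refine PowerSeries.mul_inv_cancel _ fun h => hr ?_
  have := congrArg Complex.re h
  simpa [constantCoeff_spec] using this

end spec

theorem conjSeries_inv {F : ℂ⟦X⟧} (h : constantCoeff F ≠ 0) :
    conjSeries F⁻¹ = (conjSeries F)⁻¹ := by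
  have hc : constantCoeff (conjSeries F) ≠ 0 := by
    rw [← coeff_zero_eq_constantCoeff_apply, coeff_conjSeries, coeff_zero_eq_constantCoeff_apply]
    simpa using h
  rw [PowerSeries.eq_inv_iff_mul_eq_one hc, ← map_mul, PowerSeries.inv_mul_cancel _ h, map_one]

/-! ### Nonvanishing of the Gram determinant. -/

section Nonvanishing

variable {N : ℕ} {P Q : ℂ⟦X⟧}

/-- The constants in `P - c` and `Q + c` cancel in the sum `P + Q`, so the flow of a resolvent `1/(p
- c)` also acts by a rank one matrix. -/
theorem gram_add_of_shift (h : constantCoeff P + constantCoeff Q ≠ 0) (c : ℂ) {F F' H H' : ℂ⟦X⟧}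
    (hF : F = (P - C c) * F') (hH : H = (Q + C c) * H') :
    gram N P Q F H' + gram N P Q F' H = vecMulVec (oddVec N F') (oddVec N H') := by
  rw [← gram_mul_add h, hF, hH, sub_eq_add_neg, ← map_neg, add_mul, add_mul, gram_add_left,
    gram_add_right, gram_C_mul_left, gram_C_mul_right, neg_smul]
  abel

theorem star_dotProduct_vecMulVec (y u v : Fin N → ℂ) (huv : v = star u) :
    star y ⬝ᵥ (vecMulVec u v *ᵥ y) = ((‖star y ⬝ᵥ u‖ ^ 2 : ℝ) : ℂ) := by
  have h1 : vecMulVec u v *ᵥ y = (v ⬝ᵥ y) • u := by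
    ext i
    simp only [mulVec, dotProduct, vecMulVec_apply, Pi.smul_apply, smul_eq_mul, Finset.sum_mul]
    exact Finset.sum_congr rfl fun j _ => by ring
  have h2 : v ⬝ᵥ y = star (star y ⬝ᵥ u) := by
    rw [huv, star_dotProduct]
  rw [h1, dotProduct_smul, h2, smul_eq_mul]
  push_cast
  rw [← Complex.conj_mul']
  rfl

theorem oddVec_conjSeries (F : ℂ⟦X⟧) : oddVec N (conjSeries F) = star (oddVec N F) := by
  ext i
  simp [oddVec, coeff_conjSeries]

/-- The second zero of `w(p) - w(is)` and the residues of `p (p - b) / ((p - is) (p - is'))`. -/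
theorem exists_residues {α β r : ℝ} (hβ : 0 < β * α) (hr : r ≠ 0)
    (hαβ : r ^ 2 = β * (α - β)) {c : ℝ} (hc : 1 < c) :
    ∃ s' A B : ℝ, (α * c - β) * (s' - β) = -r ^ 2 ∧ A + B = α * c + s' - β ∧
      (α * c) * s' = A * s' + B * (α * c) ∧ 0 < A * B := by
  have hr2 : 0 < r ^ 2 := by positivity
  have hα2 : 0 < α ^ 2 := by
    have : α ≠ 0 := by rintro rfl; simp at hβ
    positivity
  have hlt : 0 < α * (α - β) := by
    have h1 : 0 < (β * α) * (α * (α - β)) := by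
      have : (β * α) * (α * (α - β)) = α ^ 2 * r ^ 2 := by rw [hαβ]; ring
      rw [this]; positivity
    exact (mul_pos_iff_of_pos_left hβ).1 h1
  set s : ℝ := α * c with hs
  have hsβ' : 0 < α * (s - β) := by
    have : α * (s - β) = α * (α - β) + α ^ 2 * (c - 1) := by rw [hs]; ring
    rw [this]
    have := mul_pos hα2 (sub_pos.2 hc)
    linarith
  have hsβ : s - β ≠ 0 := by
    intro h0; rw [h0] at hsβ'; simp at hsβ'
  set s' : ℝ := β - r ^ 2 / (s - β) with hs'
  have hss : (s - β) * (s' - β) = -r ^ 2 := by rw [hs']; field_simp; ring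
  have hne : s - s' ≠ 0 := by
    intro h0
    have : s' = s := by linarith
    rw [this] at hss
    nlinarith [sq_nonneg (s - β)]
  -- The relations give `s'(s - β) = β(s - α)`, so `s'` has the sign of `s` as soon as `s` lies
  -- beyond `α`; this is where `1 < c` enters.
  have hpos : 0 < s * s' := by
    have e : (s * s') * (α * (s - β)) = (β * α) * (α ^ 2 * (c * (c - 1))) := by
      have : s' * (s - β) = β * (s - β) - r ^ 2 := by linear_combination hss
      linear_combination (s * α) * this - s * α * hαβ + (β * α * (s + α * c - α)) * hs
    have : 0 < (β * α) * (α ^ 2 * (c * (c - 1))) :=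
      mul_pos hβ (mul_pos hα2 (mul_pos (by linarith) (by linarith)))
    rw [← e] at this
    exact (mul_pos_iff_of_pos_right hsβ').1 this
  -- `iA` and `iB` are the residues of `p(p - iβ)/((p - is)(p - is'))` at its two poles.
  set A : ℝ := s * (s - β) / (s - s') with hA
  set B : ℝ := s' * (s' - β) / (s' - s) with hB
  have hne' : s' - s ≠ 0 := fun h0 => hne (by linarith)
  have hAe : A * (s - s') = s * (s - β) := by rw [hA]; field_simp
  have hBe : B * (s' - s) = s' * (s' - β) := by rw [hB]; field_simp
  have hAB : 0 < A * B := by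
    have : (A * B) * (s - s') ^ 2 = r ^ 2 * (s * s') := by
      linear_combination (-B * (s' - s)) * hAe - s * (s - β) * hBe - s * s' * hss
    have h2 : 0 < (A * B) * (s - s') ^ 2 := by rw [this]; positivity
    exact (mul_pos_iff_of_pos_right (by positivity)).1 h2
  refine ⟨s', A, B, hss, ?_, ?_, hAB⟩
  · refine mul_right_cancel₀ hne ?_
    linear_combination hAe - hBe
  · refine mul_right_cancel₀ hne ?_
    linear_combination (-s') * hAe + s * hBe

theorem C_I_mul_C_I : (C Complex.I : ℂ⟦X⟧) * C Complex.I = -1 := by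
  rw [← map_mul, Complex.I_mul_I, map_neg, map_one]

/-- The reciprocal `(p - is)(p - is')/(p - b)` equals `p + r²/(p - b)` plus a constant, because its
numerator takes the value `r²` at `p = b`. -/
theorem isEvenSeries_resolvent_product {β r s s' : ℝ} (hr : r ≠ 0)
    (hss : (s - β) * (s' - β) = -r ^ 2) :
    IsEvenSeries ((spec β r - C (Complex.I * β)) * (spec β r - C (Complex.I * s))⁻¹ *
      (spec β r - C (Complex.I * s'))⁻¹) := by
  have hDm := spec_sub_mul_inv (β := β) hr s
  have hDm' := spec_sub_mul_inv (β := β) hr s'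
  have hEi := spec_sub_mul_specInv (β := β) hr
  set P := spec β r with hP
  set D := (P - C (Complex.I * s))⁻¹
  set D' := (P - C (Complex.I * s'))⁻¹
  refine IsEvenSeries.of_mul_eq_one (ε := (P - C (Complex.I * s)) * (P - C (Complex.I * s'))
    * specInv r) ?_ ?_
  · have : (P - C (Complex.I * s)) * (P - C (Complex.I * s')) * specInv r =
        (P + C ((r : ℂ) ^ 2) * specInv r) + C (Complex.I * (β - s - s')) := by
      have hss' : (C (s : ℂ) - C (β : ℂ)) * (C (s' : ℂ) - C (β : ℂ)) = -C ((r : ℂ) ^ 2) := by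
        rw [← map_sub, ← map_sub, ← map_mul, ← map_neg]
        congr 1
        exact_mod_cast hss
      simp only [map_sub, map_mul] at hEi ⊢
      linear_combination (P + C Complex.I * (C (β : ℂ) - C (s : ℂ) - C (s' : ℂ))) * hEi
        - specInv r * hss' + specInv r * (C (s : ℂ) - C (β : ℂ)) * (C (s' : ℂ) - C (β : ℂ))
          * C_I_mul_C_I
    rw [this]
    exact (isEvenSeries_spec_add hr).add (isEvenSeries_C _)
  · linear_combination ((P - C (Complex.I * β)) * specInv r * (P - C (Complex.I * s')) * D') * hDm
      + (P - C (Complex.I * β)) * specInv r * hDm' + hEi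

/-- Partial fractions; the two hypotheses compare the coefficients of `p` and of `1` after clearing
denominators. -/
theorem resolvent_product_mul_eq {β r s s' A B : ℝ} (hr : r ≠ 0)
    (hsum₀ : A + B = s + s' - β) (hprod₀ : s * s' = A * s' + B * s) :
    (spec β r - C (Complex.I * β)) * (spec β r - C (Complex.I * s))⁻¹ *
      (spec β r - C (Complex.I * s'))⁻¹ * spec β r =
    1 + C (Complex.I * A) * (spec β r - C (Complex.I * s))⁻¹
      + C (Complex.I * B) * (spec β r - C (Complex.I * s'))⁻¹ := by
  have hDm := spec_sub_mul_inv (β := β) hr s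
  have hDm' := spec_sub_mul_inv (β := β) hr s'
  set P := spec β r with hP
  set D := (P - C (Complex.I * s))⁻¹
  set D' := (P - C (Complex.I * s'))⁻¹
  set E := P - C (Complex.I * β) with hE
  have hsum : C (A : ℂ) + C (B : ℂ) = C (s : ℂ) + C (s' : ℂ) - C (β : ℂ) := by
    rw [← map_add, ← map_add, ← map_sub]
    congr 1
    exact_mod_cast hsum₀
  have key : E * P = (P - C (Complex.I * s)) * (P - C (Complex.I * s'))
      + C (Complex.I * A) * (P - C (Complex.I * s'))
      + C (Complex.I * B) * (P - C (Complex.I * s)) := by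
    have hprod : C (s : ℂ) * C (s' : ℂ) = C (A : ℂ) * C (s' : ℂ) + C (B : ℂ) * C (s : ℂ) := by
      rw [← map_mul, ← map_mul, ← map_mul, ← map_add]
      congr 1
      exact_mod_cast hprod₀
    rw [hE]
    simp only [map_mul]
    linear_combination (-P * C Complex.I) * hsum
      + (-(C (s : ℂ) * C (s' : ℂ)) + C (A : ℂ) * C (s' : ℂ) + C (B : ℂ) * C (s : ℂ)) * C_I_mul_C_I
      + hprod
  calc E * D * D' * P = (E * P) * D * D' := by ring
    _ = _ := by
      rw [key]
      linear_combination ((P - C (Complex.I * s')) * D' + C (Complex.I * B) * D') * hDm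
        + (1 + C (Complex.I * A) * D) * hDm'

/-- For a pole on the imaginary axis the factors `P - is` and `Q + is` are conjugate, so the rank
one term has the form `d d*`. -/
theorem gram_resolvent_add {β r : ℝ} (hr : r ≠ 0) (s : ℝ) (Φ : ℂ⟦X⟧) :
    gram N (spec β r) (spec (-β) r) ((spec β r - C (Complex.I * s))⁻¹ * Φ) (conjSeries Φ)
      + gram N (spec β r) (spec (-β) r) Φ
          (conjSeries ((spec β r - C (Complex.I * s))⁻¹ * Φ))
    = vecMulVec (oddVec N ((spec β r - C (Complex.I * s))⁻¹ * Φ))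
        (star (oddVec N ((spec β r - C (Complex.I * s))⁻¹ * Φ))) := by
  have hDm := spec_sub_mul_inv (β := β) hr s
  have hconj : conjSeries (spec β r - C (Complex.I * s)) = spec (-β) r + C (Complex.I * s) := by
    rw [map_sub, conjSeries_spec, conjSeries_C]
    simp
  rw [← oddVec_conjSeries, add_comm]
  refine gram_add_of_shift (constantCoeff_add_ne_zero hr) (Complex.I * s) ?_ ?_
  · rw [← mul_assoc, hDm, one_mul]
  · rw [← hconj, ← map_mul, ← mul_assoc, hDm, one_mul]

/-- A positivity certificate: if `Z` kills `y` and its skew part is a combination of two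
rank one projectors with coefficients of the same sign, the projectors kill `y`. -/
theorem dotProduct_eq_zero_of_skew {Z : Matrix (Fin N) (Fin N) ℂ} {y d d' : Fin N → ℂ} {A B : ℝ}
    (hAB : 0 < A * B) (hZ1 : Z *ᵥ y = 0)
    (hdiff : Z - Zᴴ = (Complex.I * A) • vecMulVec d (star d)
      + (Complex.I * B) • vecMulVec d' (star d')) : star y ⬝ᵥ d = 0 := by
  have hzero : star y ⬝ᵥ ((Z - Zᴴ) *ᵥ y) = 0 := by
    rw [sub_mulVec, hZ1, zero_sub, dotProduct_neg, neg_eq_zero, dotProduct_mulVec,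
      ← star_mulVec, hZ1, star_zero, zero_dotProduct]
  rw [hdiff, add_mulVec, smul_mulVec, smul_mulVec, dotProduct_add, dotProduct_smul,
    dotProduct_smul, star_dotProduct_vecMulVec _ _ _ rfl, star_dotProduct_vecMulVec _ _ _ rfl,
    smul_eq_mul, smul_eq_mul] at hzero
  set x := ‖star y ⬝ᵥ d‖ with hx
  set x' := ‖star y ⬝ᵥ d'‖ with hx'
  have hreal : A * x ^ 2 + B * x' ^ 2 = 0 := by
    have h1 : Complex.I * ((A * x ^ 2 + B * x' ^ 2 : ℝ) : ℂ) = 0 := by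
      push_cast at hzero ⊢
      linear_combination hzero
    have h2 := (mul_eq_zero.1 h1).resolve_left Complex.I_ne_zero
    exact_mod_cast h2
  have hx0 : x ^ 2 = 0 := by
    -- After multiplication by `A` both terms are nonnegative, since `AB > 0`.
    have h1 : A ^ 2 * x ^ 2 + A * B * x' ^ 2 = 0 := by linear_combination A * hreal
    have h2 : 0 ≤ A * B * x' ^ 2 := by positivity
    have h3 : 0 ≤ A ^ 2 * x ^ 2 := by positivity
    have h4 : A ^ 2 * x ^ 2 = 0 := by linarith
    have hA0 : A ^ 2 ≠ 0 := by
      intro h0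
      have : A = 0 := by simpa using h0
      rw [this] at hAB; simp at hAB
    exact (mul_eq_zero.1 h4).resolve_left hA0
  exact norm_eq_zero.1 (pow_eq_zero_iff (two_ne_zero)|>.1 hx0)

/-- An even factor on the left keeps `y` in the kernel. In the expanded matrix the Gram matrix of
`Φ` with its conjugate is Hermitian and drops out of the skew part, leaving the two resolvent terms.
-/
theorem dotProduct_oddVec_resolvent_eq_zero {α β r : ℝ} (hβ : 0 < β * α) (hr : r ≠ 0)
    (hαβ : r ^ 2 = β * (α - β)) (Φ : ℂ⟦X⟧) {y : Fin N → ℂ}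
    (hy : gram N (spec β r) (spec (-β) r) (spec β r * Φ) (conjSeries Φ) *ᵥ y = 0)
    {c : ℝ} (hc : 1 < c) :
    star y ⬝ᵥ oddVec N ((spec β r - C (Complex.I * (α * c : ℝ)))⁻¹ * Φ) = 0 := by
  obtain ⟨s', A, B, hss, hsum, hprod, hAB⟩ := exists_residues hβ hr hαβ hc
  set s : ℝ := α * c
  have heven := isEvenSeries_resolvent_product hr hss
  have hpf := resolvent_product_mul_eq hr hsum hprod
  have hcc := constantCoeff_add_ne_zero (β := β) hr
  have hPQ : conjSeries (spec β r) = spec (-β) r := conjSeries_spec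
  have h1 := gram_resolvent_add (N := N) (β := β) hr s Φ
  have h2 := gram_resolvent_add (N := N) (β := β) hr s' Φ
  set P := spec β r
  set Q := spec (-β) r
  set D := (P - C (Complex.I * s))⁻¹
  set D' := (P - C (Complex.I * s'))⁻¹
  refine dotProduct_eq_zero_of_skew hAB (B := B) (d' := oddVec N (D' * Φ))
    (Z := gram N P Q ((P - C (Complex.I * β)) * D * D' * P * Φ) (conjSeries Φ)) ?_ ?_
  · rw [mul_assoc, gram_even_left heven, ← mulVec_mulVec, hy, mulVec_zero]
  · have hZe : gram N P Q ((P - C (Complex.I * β)) * D * D' * P * Φ) (conjSeries Φ)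
        = gram N P Q Φ (conjSeries Φ) + (Complex.I * A) • gram N P Q (D * Φ) (conjSeries Φ)
      + (Complex.I * B) • gram N P Q (D' * Φ) (conjSeries Φ) := by
      rw [hpf, add_mul, add_mul, one_mul, mul_assoc, mul_assoc, gram_add_left, gram_add_left,
        gram_C_mul_left, gram_C_mul_left]
    rw [hZe, conjTranspose_add, conjTranspose_add, conjTranspose_smul, conjTranspose_smul,
      gram_conjTranspose hcc hPQ, gram_conjTranspose hcc hPQ, gram_conjTranspose hcc hPQ,
      conjSeries_conjSeries, ← h1, ← h2, smul_add, smul_add]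
    simp only [star_mul', Complex.star_def, Complex.conj_I, Complex.conj_ofReal, neg_mul, neg_smul]
    abel

end Nonvanishing

section Nonvanishing

variable {N : ℕ}

theorem oddVec_add (F H : ℂ⟦X⟧) : oddVec N (F + H) = oddVec N F + oddVec N H := by
  ext i; simp [oddVec]

theorem oddVec_C_mul (c : ℂ) (F : ℂ⟦X⟧) : oddVec N (C c * F) = c • oddVec N F := by
  ext i; simp [oddVec, coeff_C_mul]

theorem oddVec_sum {ι : Type*} (s : Finset ι) (F : ι → ℂ⟦X⟧) :
    oddVec N (∑ i ∈ s, F i) = ∑ i ∈ s, oddVec N (F i) := by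
  ext j; simp [oddVec]

theorem oddVec_eq_zero_of_dvd {F : ℂ⟦X⟧} (h : X ^ (2 * N) ∣ F) : oddVec N F = 0 := by
  ext i
  exact X_pow_dvd_iff.1 h _ (by have := i.2; omega)

/-- A functional on odd coefficients that annihilates all resolvents of `P` annihilates
all powers of `P - P(0)`. -/
theorem dotProduct_oddVec_pow_eq_zero {P Φ : ℂ⟦X⟧} (y : Fin N → ℂ) (S : Set ℂ) (hS : S.Infinite)
    (hne : ∀ z ∈ S, constantCoeff P - z ≠ 0)
    (h : ∀ z ∈ S, y ⬝ᵥ oddVec N ((P - C z)⁻¹ * Φ) = 0) (k : ℕ) :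
    y ⬝ᵥ oddVec N ((P - C (constantCoeff P)) ^ k * Φ) = 0 := by
  set M := P - C (constantCoeff P) with hM
  have hX : X ∣ M := by
    rw [X_dvd_iff, hM, map_sub, constantCoeff_C, sub_self]
  rcases le_or_gt (2 * N) k with hk | hk
  · rw [oddVec_eq_zero_of_dvd, dotProduct_zero]
    exact ((pow_dvd_pow _ hk).trans (pow_dvd_pow_of_dvd hX k)).mul_right _
  -- With `t = (P(0) - z)⁻¹`, the geometric series of `(P - z)⁻¹` in powers of `P - P(0)` pairs with
  -- `y` to `t p(t)`. It may be cut at `2N`, since later powers have no odd coefficient in range.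
  -- Each `z` in `S` gives a root `t` of `p`.
  let p : Polynomial ℂ := ∑ j ∈ Finset.range (2 * N),
    Polynomial.monomial j ((-1) ^ j * (y ⬝ᵥ oddVec N (M ^ j * Φ)))
  have hp : p = 0 := by
    refine Polynomial.eq_zero_of_infinite_isRoot p ?_
    have hinj : Set.InjOn (fun z => (constantCoeff P - z)⁻¹) S := by
      intro z _ z' _ hzz
      have := inv_injective hzz
      exact sub_right_injective this
    refine (hS.image hinj).mono ?_
    rintro _ ⟨z, hz, rfl⟩
    set t := (constantCoeff P - z)⁻¹ with ht
    have ht0 : t ≠ 0 := inv_ne_zero (hne z hz)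
    set D := (P - C z)⁻¹ with hD
    have hDm : (P - C z) * D = 1 :=
      PowerSeries.mul_inv_cancel _ (by rw [map_sub, constantCoeff_C]; exact hne z hz)
    have hPz : C t * (P - C z) = 1 + C t * M := by
      have : C t * (C (constantCoeff P) - C z) = (1 : ℂ⟦X⟧) := by
        rw [← map_sub, ← map_mul, ht, inv_mul_cancel₀ (hne z hz), map_one]
      rw [hM]
      linear_combination this
    have hgeom := mul_neg_geom_sum (-(C t * M)) (2 * N)
    have hDe : D = C t * ∑ j ∈ Finset.range (2 * N), (-(C t * M)) ^ j
        + D * (-(C t * M)) ^ (2 * N) := by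
      rw [sub_neg_eq_add, ← hPz] at hgeom
      linear_combination (-D) * hgeom
        + (C t * ∑ j ∈ Finset.range (2 * N), (-(C t * M)) ^ j) * hDm
    have h1 : y ⬝ᵥ oddVec N (D * Φ) = 0 := h z hz
    rw [hDe, add_mul, oddVec_add, oddVec_eq_zero_of_dvd (F := D * _ * Φ), add_zero, mul_assoc,
      oddVec_C_mul, dotProduct_smul, Finset.sum_mul, oddVec_sum, dotProduct_sum, smul_eq_mul] at h1
    · have h2 := (mul_eq_zero.1 h1).resolve_left ht0
      change p.eval t = 0
      rw [Polynomial.eval_finsetSum, ← h2]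
      refine Finset.sum_congr rfl fun j _ => ?_
      have : (-(C t * M)) ^ j * Φ = C ((-1) ^ j * t ^ j) * (M ^ j * Φ) := by
        rw [neg_pow, mul_pow, map_mul, map_pow, map_pow, map_neg, map_one]
        ring
      rw [Polynomial.eval_monomial, this, oddVec_C_mul, dotProduct_smul, smul_eq_mul]
      ring
    · refine Dvd.dvd.mul_right (Dvd.dvd.mul_left ?_ _) _
      exact pow_dvd_pow_of_dvd ((hX.mul_left _).neg_right) _
  have hcoeff : p.coeff k = (-1) ^ k * (y ⬝ᵥ oddVec N (M ^ k * Φ)) := by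
    rw [Polynomial.finsetSum_coeff, Finset.sum_eq_single_of_mem k (Finset.mem_range.2 hk)]
    · rw [Polynomial.coeff_monomial, if_pos rfl]
    · intro j _ hj
      rw [Polynomial.coeff_monomial, if_neg hj]
  rw [hp, Polynomial.coeff_zero] at hcoeff
  exact (mul_eq_zero.1 hcoeff.symm).resolve_left (pow_ne_zero _ (by norm_num))

/-- Finitely many coefficient functionals are separated by the powers of a series of order one. -/
theorem eq_zero_of_sum_coeff_pow {P Φ : ℂ⟦X⟧} (hP : coeff 1 P ≠ 0) (hΦ : constantCoeff Φ ≠ 0)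
    {e : Fin N → ℕ} (he : StrictMono e) (y : Fin N → ℂ)
    (h : ∀ k, ∑ i, y i * coeff (e i) ((P - C (constantCoeff P)) ^ k * Φ) = 0) : y = 0 := by
  by_contra hy
  obtain ⟨i₀, hi₀⟩ := Function.ne_iff.1 hy
  let s : Finset (Fin N) := Finset.univ.filter fun i => y i ≠ 0
  have hs : s.Nonempty := ⟨i₀, by simpa [s] using hi₀⟩
  obtain ⟨i, his, himax⟩ := s.exists_max_image id hs
  have hyi : y i ≠ 0 := by simpa [s] using his
  have hX : X ∣ P - C (constantCoeff P) := by
    rw [X_dvd_iff, map_sub, constantCoeff_C, sub_self]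
  obtain ⟨G, hG⟩ := hX
  have hG0 : constantCoeff G = coeff 1 P := by
    have := congrArg (coeff 1) hG
    rw [← zero_add 1, coeff_succ_X_mul, map_sub, coeff_C] at this
    simpa using this.symm
  -- At the largest index `i` with `y i ≠ 0`, the power `k = e i` isolates one term: smaller indices
  -- lie below the order of the series, larger ones have `y = 0`.
  have hk := h (e i)
  rw [hG, mul_pow, mul_assoc, Finset.sum_eq_single i] at hk
  · rw [coeff_X_pow_mul', if_pos le_rfl, Nat.sub_self, coeff_zero_eq_constantCoeff_apply,
      map_mul, map_pow, hG0] at hk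
    exact mul_ne_zero hyi (mul_ne_zero (pow_ne_zero _ hP) hΦ) hk
  · intro j _ hj
    rcases lt_or_gt_of_ne hj with hlt | hgt
    · rw [coeff_X_pow_mul', if_neg (not_le.2 (he hlt)), mul_zero]
    · have : y j = 0 := by
        by_contra hyj
        exact absurd (himax j (by simpa [s] using hyj)) (not_le.2 hgt)
      rw [this, zero_mul]
  · intro hi; exact absurd (Finset.mem_univ i) hi

/-- A null vector is orthogonal to the odd coefficients of `Φ/(p - iαc)` for every `c > 1`, hence to
those of `(P - P(0))^k Φ` for all `k`, and these separate vectors. -/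
theorem det_gram_ne_zero {α β r : ℝ} (hβ : 0 < β * α) (hr : r ≠ 0)
    (hαβ : r ^ 2 = β * (α - β)) {Φ : ℂ⟦X⟧} (hΦ : constantCoeff Φ ≠ 0) :
    (gram N (spec β r) (spec (-β) r) (spec β r * Φ) (conjSeries Φ)).det ≠ 0 := by
  intro hdet
  obtain ⟨y, hy0, hy⟩ := exists_mulVec_eq_zero_iff.2 hdet
  have hα : α ≠ 0 := by rintro rfl; simp at hβ
  have hr' : (r : ℂ) ≠ 0 := by exact_mod_cast hr
  refine hy0 (star_eq_zero.1 (eq_zero_of_sum_coeff_pow (P := spec β r) (Φ := Φ) ?_ hΦ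
    (e := fun i : Fin N => 2 * (i : ℕ) + 1) (fun i j hij => ?_) (star y)
    fun k => dotProduct_oddVec_pow_eq_zero (star y)
      ((fun c : ℝ => Complex.I * (α * c : ℝ)) '' Set.Ioi 1) ?_ ?_ ?_ k))
  · simp [spec, coeff_exp, hr']
  · have : (i : ℕ) < j := hij
    dsimp only
    omega
  · refine (Set.Ioi_infinite _).image ?_
    intro c _ c' _ hcc
    have h1 := mul_left_cancel₀ Complex.I_ne_zero hcc
    have h2 : α * c = α * c' := by exact_mod_cast h1
    exact mul_left_cancel₀ hα h2
  · rintro _ ⟨c, _, rfl⟩ h0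
    have := congrArg Complex.re h0
    simp [constantCoeff_spec] at this
    exact hr this
  · rintro _ ⟨c, hc, rfl⟩
    exact dotProduct_oddVec_resolvent_eq_zero hβ hr hαβ Φ hy hc

end Nonvanishing

/-! ### Index shifts as low rank perturbations. -/

section Shifts

variable {N : ℕ} {P Q : ℂ⟦X⟧}

theorem oddVec_sub_C_mul (c : ℂ) (F G : ℂ⟦X⟧) :
    oddVec N (F - C c * G) = oddVec N F - c • oddVec N G := by
  rw [← oddVec_C_mul]
  ext i; simp [oddVec]

theorem oddVec_neg (F : ℂ⟦X⟧) : oddVec N (-F) = -oddVec N F := by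
  ext i; simp [oddVec]

theorem gram_neg_left (F H : ℂ⟦X⟧) : gram N P Q (-F) H = -gram N P Q F H := by
  have := gram_C_mul_left (N := N) (P := P) (Q := Q) (-1) F H
  rw [map_neg, map_one, neg_one_mul, neg_one_smul] at this
  exact this

theorem gram_sub_left (F F' H : ℂ⟦X⟧) :
    gram N P Q (F - F') H = gram N P Q F H - gram N P Q F' H := by
  rw [sub_eq_add_neg, gram_add_left, gram_neg_left, sub_eq_add_neg]

theorem gram_mul_left_eq (h : constantCoeff P + constantCoeff Q ≠ 0) (F H : ℂ⟦X⟧) :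
    gram N P Q (P * F) H = vecMulVec (oddVec N F) (oddVec N H) - gram N P Q F (Q * H) := by
  rw [← gram_mul_add h]; abel

/-- The shift `n ↦ n - 1`. -/
theorem gram_neg_mul_right (h : constantCoeff P + constantCoeff Q ≠ 0) (F H : ℂ⟦X⟧) :
    gram N P Q (-F) (Q * H)
      = gram N P Q (P * F) H - vecMulVec (oddVec N F) (oddVec N H) := by
  rw [gram_neg_left, gram_mul_left_eq h]; abel

/-- The simultaneous shift of `n` and of the index attached to `c`. -/
theorem gram_shift (h : constantCoeff P + constantCoeff Q ≠ 0) (c : ℂ) (F H : ℂ⟦X⟧) :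
    gram N P Q ((P - C c) * F) (Q * H) = gram N P Q (P * F) ((Q + C c) * H)
      - c • vecMulVec (oddVec N F) (oddVec N H) := by
  rw [sub_mul, gram_sub_left, add_mul, gram_add_right, gram_C_mul_left, gram_C_mul_right,
    ← gram_mul_add h, smul_add]
  abel

/-- This and the next two identities express the shifted matrices through one reference matrix and
rank one terms, as the rank two identities require. -/
theorem gram_shift_inv (h : constantCoeff P + constantCoeff Q ≠ 0) (c : ℂ) (F H : ℂ⟦X⟧) :
    gram N P Q (-(P * F)) ((Q + C c) * H) = gram N P Q (P * ((P - C c) * F)) H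
      - vecMulVec (oddVec N ((P - C c) * F) + c • oddVec N F) (oddVec N H) := by
  have e : (P - C c) * F = P * F - C c * F := by ring
  have e1 : oddVec N ((P - C c) * F) + c • oddVec N F = oddVec N (P * F) := by
    rw [e, oddVec_sub_C_mul, sub_add_cancel]
  have e2 : P * ((P - C c) * F) = P * (P * F) - C c * (P * F) := by ring
  rw [e1, e2, gram_sub_left, gram_C_mul_left, gram_neg_left, add_mul, gram_add_right,
    gram_C_mul_right, ← gram_mul_add h]
  abel

theorem gram_shift_left (h : constantCoeff P + constantCoeff Q ≠ 0) (c : ℂ) (F H : ℂ⟦X⟧) :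
    gram N P Q (-(P * ((P - C c) * F))) H = gram N P Q (P * F) ((Q + C c) * H)
      - vecMulVec (oddVec N (P * F)) (oddVec N H) := by
  have e2 : P * ((P - C c) * F) = P * (P * F) - C c * (P * F) := by ring
  rw [gram_neg_left, e2, gram_sub_left, gram_C_mul_left, add_mul, gram_add_right,
    gram_C_mul_right, ← gram_mul_add h]
  abel

theorem gram_shift_right (h : constantCoeff P + constantCoeff Q ≠ 0) (c : ℂ) (F H : ℂ⟦X⟧) :
    gram N P Q (-((P - C c) * F)) (Q * (Q * H))
      = gram N P Q (P * (P * F)) ((Q + C c) * H)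
        - vecMulVec (oddVec N (P * F)) (oddVec N ((Q + C c) * H))
        + c • vecMulVec (oddVec N F) (oddVec N ((Q + C c) * H) - c • oddVec N H) := by
  have e1 : oddVec N ((Q + C c) * H) - c • oddVec N H = oddVec N (Q * H) := by
    rw [← oddVec_sub_C_mul]
    congr 1
    ring
  have h1 := gram_shift (N := N) h c (P * F) H
  have h2 := gram_mul_left_eq (N := N) h ((P - C c) * F) (Q * H)
  have e3 : P * ((P - C c) * F) = (P - C c) * (P * F) := by ring
  have e4 : oddVec N ((P - C c) * F) = oddVec N (P * F) - c • oddVec N F := by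
    rw [← oddVec_sub_C_mul]; congr 1; ring
  rw [e3, h1, e4] at h2
  rw [gram_neg_left, e1]
  have e6 : oddVec N (Q * H) = oddVec N ((Q + C c) * H) - c • oddVec N H := e1.symm
  rw [e6] at h2 ⊢
  ext i j
  have h3 := congrArg (fun M : Matrix (Fin N) (Fin N) ℂ => M i j) h2
  simp only [Matrix.add_apply, Matrix.sub_apply, Matrix.smul_apply, Matrix.neg_apply,
    vecMulVec_apply, Pi.sub_apply, Pi.smul_apply, smul_eq_mul] at h3 ⊢
  linear_combination -h3

/-- Two flows whose symbols differ by even series act proportionally on `log τ`, up to a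
constant. -/
theorem trace_adjugate_gram_reduction {U V U' V' : ℂ⟦X⟧} {k : ℂ}
    (he : IsEvenSeries (U - C k * V)) (he' : IsEvenSeries (U' - C k * V')) (A B : ℂ⟦X⟧) :
    trace (adjugate (gram N P Q A B) * (gram N P Q (U * A) B + gram N P Q A (U' * B)))
    = (gram N P Q A B).det
        * (N * (constantCoeff (U - C k * V) + constantCoeff (U' - C k * V')))
      + k * trace (adjugate (gram N P Q A B) *
          (gram N P Q (V * A) B + gram N P Q A (V' * B))) := by
  have e1 : gram N P Q (U * A) B
      = evenMat N (U - C k * V) * gram N P Q A B + k • gram N P Q (V * A) B := by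
    rw [← gram_even_left he, ← gram_C_mul_left, ← gram_add_left]
    congr 1
    ring
  have e2 : gram N P Q A (U' * B)
      = gram N P Q A B * (evenMat N (U' - C k * V'))ᵀ + k • gram N P Q A (V' * B) := by
    rw [← gram_even_right he', ← gram_C_mul_right, ← gram_add_right]
    congr 1
    ring
  set M := gram N P Q A B
  -- The even part acts by a matrix factor of `M`; since `adj M · M = det M`, it contributes only
  -- its trace.
  have t1 : trace (adjugate M * (evenMat N (U - C k * V) * M))
      = M.det * (N * constantCoeff (U - C k * V)) := by
    rw [← mul_assoc, trace_mul_comm, ← mul_assoc, mul_adjugate, smul_mul, one_mul, trace_smul,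
      trace_evenMat, smul_eq_mul]
  have t2 : trace (adjugate M * (M * (evenMat N (U' - C k * V'))ᵀ))
      = M.det * (N * constantCoeff (U' - C k * V')) := by
    rw [← mul_assoc, adjugate_mul, smul_mul, one_mul, trace_smul, trace_transpose,
      trace_evenMat, smul_eq_mul]
  rw [e1, e2]
  simp only [mul_add, trace_add, Matrix.mul_smul, trace_smul, t1, t2, smul_eq_mul]
  ring

end Shifts

/-! ### Bilinear equations for Gram determinants. -/

section Bilinear

variable {N : ℕ} {P Q : ℂ⟦X⟧}

theorem gram_flow (h : constantCoeff P + constantCoeff Q ≠ 0) {c : ℂ} {R S : ℂ⟦X⟧}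
    (hR : (P - C c) * R = 1) (hS : (Q + C c) * S = 1) (A B : ℂ⟦X⟧) :
    gram N P Q (R * A) B + gram N P Q A (S * B) = vecMulVec (oddVec N (R * A)) (oddVec N (S * B)) := by
  rw [add_comm]
  exact gram_add_of_shift h c (by rw [← mul_assoc, hR, one_mul]) (by rw [← mul_assoc, hS, one_mul])

/-- The bilinear equation of the flow with symbol `1 / (p - c)`. -/
theorem bilinear_resolvent_flow (h : constantCoeff P + constantCoeff Q ≠ 0) {c : ℂ} {R S : ℂ⟦X⟧}
    (hR : (P - C c) * R = 1) (hS : (Q + C c) * S = 1) (F H : ℂ⟦X⟧)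
    (h0 : (gram N P Q (P * F) H).det ≠ 0) :
    -c * (trace (adjugate (gram N P Q (P * F) H) *
          (gram N P Q (R * (P * F)) H + gram N P Q (P * F) (S * H)))
        * (gram N P Q (-F) (Q * H)).det
      - (gram N P Q (P * F) H).det * trace (adjugate (gram N P Q (-F) (Q * H)) *
          (gram N P Q (R * -F) (Q * H) + gram N P Q (-F) (S * (Q * H)))))
    = (gram N P Q ((P - C c) * F) (Q * (S * H))).det
        * (gram N P Q (-(P * (R * F))) ((Q + C c) * H)).det
      - (gram N P Q (P * F) H).det * (gram N P Q (-F) (Q * H)).det := by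
  have eF : (P - C c) * (R * F) = F := by rw [← mul_assoc, hR, one_mul]
  have eH : (Q + C c) * (S * H) = H := by rw [← mul_assoc, hS, one_mul]
  have e1 : oddVec N (R * (P * F)) = oddVec N F + c • oddVec N (R * F) := by
    rw [← oddVec_C_mul, ← oddVec_add]
    congr 1
    linear_combination eF
  have e2 : oddVec N (S * (Q * H)) = oddVec N H - c • oddVec N (S * H) := by
    rw [← oddVec_sub_C_mul]
    congr 1
    linear_combination eH
  have e3 : oddVec N (R * -F) = -oddVec N (R * F) := by rw [mul_neg, oddVec_neg]
  rw [gram_flow h hR hS, gram_flow h hR hS, e1, e2, e3, gram_shift h, gram_shift_inv h, eF, eH,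
    gram_neg_mul_right h, neg_vecMulVec]
  exact bilinear_shift_flow h0 _ _ _ _ _

/-- Changing the symbol by an even series adds the same constant to both logarithmic derivatives,
and it cancels in the antisymmetric combination. -/
theorem bilinear_reduced_flow (h : constantCoeff P + constantCoeff Q ≠ 0) {c k : ℂ}
    {R S U U' : ℂ⟦X⟧} (hR : (P - C c) * R = 1) (hS : (Q + C c) * S = 1)
    (he : IsEvenSeries (U - C k * R)) (he' : IsEvenSeries (U' - C k * S)) (F H : ℂ⟦X⟧)
    (h0 : (gram N P Q (P * F) H).det ≠ 0) :
    -c * (trace (adjugate (gram N P Q (P * F) H) *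
          (gram N P Q (U * (P * F)) H + gram N P Q (P * F) (U' * H)))
        * (gram N P Q (-F) (Q * H)).det
      - (gram N P Q (P * F) H).det * trace (adjugate (gram N P Q (-F) (Q * H)) *
          (gram N P Q (U * -F) (Q * H) + gram N P Q (-F) (U' * (Q * H)))))
    = k * ((gram N P Q ((P - C c) * F) (Q * (S * H))).det
        * (gram N P Q (-(P * (R * F))) ((Q + C c) * H)).det
      - (gram N P Q (P * F) H).det * (gram N P Q (-F) (Q * H)).det) := by
  rw [← bilinear_resolvent_flow h hR hS F H h0, trace_adjugate_gram_reduction he he',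
    trace_adjugate_gram_reduction he he']
  ring

theorem bilinear_infinite (h : constantCoeff P + constantCoeff Q ≠ 0) (c : ℂ) (F H : ℂ⟦X⟧)
    (h0 : (gram N P Q (P * F) ((Q + C c) * H)).det ≠ 0) :
    trace (adjugate (gram N P Q ((P - C c) * F) (Q * H)) *
        vecMulVec (oddVec N ((P - C c) * F)) (oddVec N (Q * H)))
      * (gram N P Q (P * F) ((Q + C c) * H)).det
      - (gram N P Q ((P - C c) * F) (Q * H)).det *
        trace (adjugate (gram N P Q (P * F) ((Q + C c) * H)) *
          vecMulVec (oddVec N (P * F)) (oddVec N ((Q + C c) * H)))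
    = -c * ((gram N P Q ((P - C c) * F) (Q * H)).det
        * (gram N P Q (P * F) ((Q + C c) * H)).det
      - (gram N P Q (-(P * ((P - C c) * F))) H).det
        * (gram N P Q (-F) (Q * ((Q + C c) * H))).det) := by
  have e1 : oddVec N ((P - C c) * F) = oddVec N (P * F) - c • oddVec N F := by
    rw [← oddVec_sub_C_mul]; congr 1; ring
  have e2 : oddVec N (Q * H) = oddVec N ((Q + C c) * H) - c • oddVec N H := by
    rw [← oddVec_sub_C_mul]; congr 1; ring
  rw [gram_shift h, gram_shift_left h, gram_neg_mul_right h, e1, e2]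
  exact bilinear_infinite_flow h0 _ _ _ _ _

theorem bilinear_double_shift (h : constantCoeff P + constantCoeff Q ≠ 0) (c : ℂ) (F H : ℂ⟦X⟧)
    (h0 : (gram N P Q (P * (P * F)) ((Q + C c) * H)).det ≠ 0) :
    c * (trace (adjugate (gram N P Q ((P - C c) * (P * F)) (Q * H)) *
          vecMulVec (oddVec N ((P - C c) * F)) (oddVec N H))
        * (gram N P Q (-(P * F)) (Q * ((Q + C c) * H))).det
      - (gram N P Q ((P - C c) * (P * F)) (Q * H)).det *
        trace (adjugate (gram N P Q (-(P * F)) (Q * ((Q + C c) * H))) *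
          -vecMulVec (oddVec N F) (oddVec N ((Q + C c) * H))))
      + (gram N P Q ((P - C c) * (P * F)) (Q * H)).det
        * (gram N P Q (-(P * F)) (Q * ((Q + C c) * H))).det
    = (gram N P Q (-((P - C c) * F)) (Q * (Q * H))).det
        * (gram N P Q (P * (P * F)) ((Q + C c) * H)).det := by
  have e1 : oddVec N ((P - C c) * F) = oddVec N (P * F) - c • oddVec N F := by
    rw [← oddVec_sub_C_mul]; congr 1; ring
  rw [gram_shift h, gram_shift_right h, gram_neg_mul_right h, e1]
  exact bilinear_double_shift_flow h0 _ _ _ _ _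

/-- Both determinants are constants times the determinant without the even weight. This identifies
`τ` functions with different indices. -/
theorem det_gram_even {ε ε' : ℂ⟦X⟧} (hε : IsEvenSeries ε) (hε' : IsEvenSeries ε') (F H : ℂ⟦X⟧) :
    (constantCoeff ε') ^ N * (gram N P Q (-(ε * F)) H).det
      = (-constantCoeff ε) ^ N * (gram N P Q F (ε' * H)).det := by
  rw [gram_neg_left, gram_even_left hε, gram_even_right hε', det_neg, det_mul, det_mul,
    det_transpose, det_evenMat, det_evenMat, Fintype.card_fin, neg_pow (constantCoeff ε)]
  ring

end Bilinear

/-! ### Dependence on the parameters `x` and `t`. -/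

theorem coeff_succ_of_derivative {L' Φ : ℂ⟦X⟧} (h : d⁄dX ℂ Φ = L' * Φ) (n : ℕ) :
    coeff (n + 1) Φ = ((n : ℂ) + 1)⁻¹ *
      ∑ x ∈ Finset.HasAntidiagonal.antidiagonal n, coeff x.1 L' * coeff x.2 Φ := by
  have h0 : (n + 1 : ℂ) ≠ 0 := Nat.cast_add_one_ne_zero n
  rw [← coeff_mul, ← h, coeff_derivative]
  field_simp

/-- The coefficients of a family of exponentials `exp (L₀ + y V)`. -/
theorem hasDerivAt_coeff_exp {Φ : ℝ → ℂ⟦X⟧} {L₀ V : ℂ⟦X⟧}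
    (hd : ∀ y, d⁄dX ℂ (Φ y) = d⁄dX ℂ (L₀ + C (y : ℂ) * V) * Φ y)
    (h0 : ∀ y, HasDerivAt (fun y => constantCoeff (Φ y)) (constantCoeff V * constantCoeff (Φ y)) y)
    (n : ℕ) (y : ℝ) : HasDerivAt (fun y => coeff n (Φ y)) (coeff n (V * Φ y)) y := by
  have hL : ∀ y : ℝ, d⁄dX ℂ (L₀ + C (y : ℂ) * V) = d⁄dX ℂ L₀ + C (y : ℂ) * d⁄dX ℂ V := by
    intro y
    rw [map_add, Derivation.leibniz, derivative_C, smul_zero, add_zero, smul_eq_mul]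
  induction n using Nat.strong_induction_on with
  | _ n ih =>
    cases n with
    | zero => simpa using h0 y
    | succ n =>
      have hn : (n + 1 : ℂ) ≠ 0 := Nat.cast_add_one_ne_zero n
      have e : (fun y => coeff (n + 1) (Φ y)) = fun y : ℝ => ((n : ℂ) + 1)⁻¹ *
          ∑ x ∈ Finset.HasAntidiagonal.antidiagonal n,
            (coeff x.1 (d⁄dX ℂ L₀) + (y : ℂ) * coeff x.1 (d⁄dX ℂ V)) * coeff x.2 (Φ y) := by
        funext y
        rw [coeff_succ_of_derivative (hd y), hL]
        simp only [map_add, coeff_C_mul]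
      have hsum : HasDerivAt (fun y : ℝ => ∑ x ∈ Finset.HasAntidiagonal.antidiagonal n,
            (coeff x.1 (d⁄dX ℂ L₀) + (y : ℂ) * coeff x.1 (d⁄dX ℂ V)) * coeff x.2 (Φ y))
          (∑ x ∈ Finset.HasAntidiagonal.antidiagonal n,
            (coeff x.1 (d⁄dX ℂ V) * coeff x.2 (Φ y) +
              coeff x.1 (d⁄dX ℂ (L₀ + C (y : ℂ) * V)) * coeff x.2 (V * Φ y))) y := by
        refine HasDerivAt.fun_sum fun x hx => ?_
        have hx2 : x.2 < n + 1 := by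
          have := Finset.HasAntidiagonal.mem_antidiagonal.1 hx
          omega
        have h1 : HasDerivAt (fun y : ℝ => coeff x.1 (d⁄dX ℂ L₀) + (y : ℂ) * coeff x.1 (d⁄dX ℂ V))
            (coeff x.1 (d⁄dX ℂ V)) y := by
          have := (((hasDerivAt_id y).ofReal_comp).mul_const (coeff x.1 (d⁄dX ℂ V))).const_add
            (coeff x.1 (d⁄dX ℂ L₀))
          simpa using this
        have := h1.mul (ih x.2 hx2)
        rw [hL, map_add, coeff_C_mul]
        exact this
      -- The product `VΦ` satisfies the `X`-equation obtained by formally differentiating `Φ' = L'Φ`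
      -- in `y`, so it obeys the differentiated recursion.
      have he : coeff (n + 1) (V * Φ y) = ((n : ℂ) + 1)⁻¹ *
          ∑ x ∈ Finset.HasAntidiagonal.antidiagonal n,
            (coeff x.1 (d⁄dX ℂ V) * coeff x.2 (Φ y) +
              coeff x.1 (d⁄dX ℂ (L₀ + C (y : ℂ) * V)) * coeff x.2 (V * Φ y)) := by
        have : coeff (n + 1) (V * Φ y) * ((n : ℂ) + 1) = coeff n (d⁄dX ℂ (V * Φ y)) := by
          rw [coeff_derivative]
        rw [Finset.sum_add_distrib, ← coeff_mul, ← coeff_mul, ← map_add,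
          eq_inv_mul_iff_mul_eq₀ hn, mul_comm, this, Derivation.leibniz, hd, smul_eq_mul,
          smul_eq_mul]
        congr 1
        ring
      rw [e, he]
      exact hsum.const_mul _

/-- `Φ' = L'Φ` expresses each coefficient polynomially through earlier ones, so smoothness
propagates from the constant term. -/
theorem contDiff_coeff_of_derivative {E : Type*} [NormedAddCommGroup E] [NormedSpace ℝ E]
    {Φ L' : E → ℂ⟦X⟧} (hd : ∀ z, d⁄dX ℂ (Φ z) = L' z * Φ z)
    (hL : ∀ n, ContDiff ℝ ∞ fun z => coeff n (L' z))
    (h0 : ContDiff ℝ ∞ fun z => constantCoeff (Φ z)) (n : ℕ) :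
    ContDiff ℝ ∞ fun z => coeff n (Φ z) := by
  induction n using Nat.strong_induction_on with
  | _ n ih =>
    cases n with
    | zero => simpa using h0
    | succ n =>
      simp only [fun z => coeff_succ_of_derivative (hd z) n]
      refine contDiff_const.mul (ContDiff.sum fun x hx => (hL x.1).mul (ih x.2 ?_))
      have := Finset.HasAntidiagonal.mem_antidiagonal.1 hx
      omega

section gram

variable {N : ℕ} {P Q : ℂ⟦X⟧}

/-- The entries are finite bilinear sums with constant kernel coefficients, so they can be
differentiated term by term. -/
theorem gram_apply_eq_sum (F H : ℂ⟦X⟧) (i j : Fin N) :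
    gram N P Q F H i j = ∑ x ∈ Finset.HasAntidiagonal.antidiagonal (2 * (j : ℕ) + 1),
      ∑ y ∈ Finset.HasAntidiagonal.antidiagonal (2 * (i : ℕ) + 1),
        coeff y.1 F * coeff x.1 H * coeff y.2 (coeff x.2 (kernel P Q)) := by
  simp only [gram, of_apply]
  have e : coeff (2 * (j : ℕ) + 1) (PowerSeries.map C H * kernel P Q) =
      ∑ x ∈ Finset.HasAntidiagonal.antidiagonal (2 * (j : ℕ) + 1),
        coeff x.1 (PowerSeries.map C H) * coeff x.2 (kernel P Q) := coeff_mul _ _ _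
  rw [mul_assoc, coeff_C_mul, e, Finset.mul_sum, map_sum]
  refine Finset.sum_congr rfl fun x _ => ?_
  rw [coeff_map, mul_left_comm, coeff_C_mul, coeff_mul, Finset.mul_sum]
  exact Finset.sum_congr rfl fun y _ => by ring

theorem hasDerivAt_coeff_mul {F : ℝ → ℂ⟦X⟧} {F' : ℂ⟦X⟧} {y : ℝ}
    (hF : ∀ n, HasDerivAt (fun y => coeff n (F y)) (coeff n F') y) (A : ℂ⟦X⟧) (n : ℕ) :
    HasDerivAt (fun y => coeff n (A * F y)) (coeff n (A * F')) y := by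
  simp only [coeff_mul]
  exact HasDerivAt.fun_sum fun x _ => (hF x.2).const_mul _

theorem hasDerivAt_gram {F H : ℝ → ℂ⟦X⟧} {F' H' : ℂ⟦X⟧} {y : ℝ}
    (hF : ∀ n, HasDerivAt (fun y => coeff n (F y)) (coeff n F') y)
    (hH : ∀ n, HasDerivAt (fun y => coeff n (H y)) (coeff n H') y) (i j : Fin N) :
    HasDerivAt (fun y => gram N P Q (F y) (H y) i j)
      ((gram N P Q F' (H y) + gram N P Q (F y) H') i j) y := by
  simp only [Matrix.add_apply, gram_apply_eq_sum, ← Finset.sum_add_distrib, ← add_mul]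
  exact HasDerivAt.fun_sum fun x _ => HasDerivAt.fun_sum fun z _ =>
    ((hF z.1).mul (hH x.1)).mul_const _

theorem hasDerivAt_det_gram {F H : ℝ → ℂ⟦X⟧} {F' H' : ℂ⟦X⟧} {y : ℝ}
    (hF : ∀ n, HasDerivAt (fun y => coeff n (F y)) (coeff n F') y)
    (hH : ∀ n, HasDerivAt (fun y => coeff n (H y)) (coeff n H') y) :
    HasDerivAt (fun y => (gram N P Q (F y) (H y)).det)
      (trace (adjugate (gram N P Q (F y) (H y)) *
        (gram N P Q F' (H y) + gram N P Q (F y) H'))) y :=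
  hasDerivAt_det fun i j => hasDerivAt_gram hF hH i j

theorem contDiff_coeff_mul {E : Type*} [NormedAddCommGroup E] [NormedSpace ℝ E] {F : E → ℂ⟦X⟧}
    (hF : ∀ n, ContDiff ℝ ∞ fun z => coeff n (F z)) (A : ℂ⟦X⟧) (n : ℕ) :
    ContDiff ℝ ∞ fun z => coeff n (A * F z) := by
  simp only [coeff_mul]
  exact ContDiff.sum fun x _ => contDiff_const.mul (hF x.2)

theorem contDiff_det_gram {E : Type*} [NormedAddCommGroup E] [NormedSpace ℝ E] {F H : E → ℂ⟦X⟧}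
    (hF : ∀ n, ContDiff ℝ ∞ fun z => coeff n (F z))
    (hH : ∀ n, ContDiff ℝ ∞ fun z => coeff n (H z)) :
    ContDiff ℝ ∞ fun z => (gram N P Q (F z) (H z)).det := by
  simp only [det_apply', gram_apply_eq_sum]
  exact ContDiff.sum fun s _ => contDiff_const.mul (contDiff_prod fun i _ =>
    ContDiff.sum fun x _ => ContDiff.sum fun y _ => ((hF y.1).mul (hH x.1)).mul contDiff_const)

end gram

/-! ### Jets of the exponential factor. -/

/-- The jet of the exponential `exp (c₁ p x + c₂ t / p + S p)`. -/
def expJet (w : ℂ → ℂ) (z₀ c₁ c₂ : ℂ) (S : ℂ → ℂ) (x t : ℝ) : ℂ⟦X⟧ :=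
  jet w z₀ fun p => Complex.exp (c₁ * p * x + c₂ * p⁻¹ * t + S p)

section expJet

variable {w S : ℂ → ℂ} {z₀ c₁ c₂ : ℂ}

theorem constantCoeff_expJet (x t : ℝ) : constantCoeff (expJet w z₀ c₁ c₂ S x t)
    = Complex.exp (c₁ * z₀ * x + c₂ * z₀⁻¹ * t + S z₀) := constantCoeff_jet

theorem jet_exponent (hw : AnalyticAt ℂ w z₀) (hS : AnalyticAt ℂ S z₀) (hz : z₀ ≠ 0) (x t : ℝ) :
    jet w z₀ (fun p => c₁ * p * x + c₂ * p⁻¹ * t + S p)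
      = C (x : ℂ) * (C c₁ * jet w z₀ fun p => p) +
        C (t : ℂ) * (C c₂ * (jet w z₀ fun p => p)⁻¹) + jet w z₀ S := by
  have hi : AnalyticAt ℂ (fun p : ℂ => p⁻¹) z₀ := analyticAt_id.fun_inv hz
  have hid : AnalyticAt ℂ (fun p : ℂ => p) z₀ := analyticAt_id
  have e : (fun p => c₁ * p * x + c₂ * p⁻¹ * t + S p)
      = fun p => (x : ℂ) * (c₁ * p) + (t : ℂ) * (c₂ * p⁻¹) + S p := by
    funext p; ring
  have h1 : AnalyticAt ℂ (fun p => (x : ℂ) * (c₁ * p)) z₀ := by fun_prop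
  have h2 : AnalyticAt ℂ (fun p => (t : ℂ) * (c₂ * p⁻¹)) z₀ :=
    analyticAt_const.fun_mul (analyticAt_const.fun_mul hi)
  rw [e, jet_add hw (h1.fun_add h2) hS, jet_add hw h1 h2,
    jet_const_mul hw _ (analyticAt_const.fun_mul hid), jet_const_mul hw _ hid,
    jet_const_mul hw _ (analyticAt_const.fun_mul hi), jet_const_mul hw _ hi, jet_inv hw hid hz]

theorem derivative_expJet (hw : AnalyticAt ℂ w z₀) (hS : AnalyticAt ℂ S z₀) (hz : z₀ ≠ 0)
    (x t : ℝ) : d⁄dX ℂ (expJet w z₀ c₁ c₂ S x t) =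
      d⁄dX ℂ (C (x : ℂ) * (C c₁ * jet w z₀ fun p => p) +
        C (t : ℂ) * (C c₂ * (jet w z₀ fun p => p)⁻¹) + jet w z₀ S)
      * expJet w z₀ c₁ c₂ S x t := by
  have hi : AnalyticAt ℂ (fun p : ℂ => p⁻¹) z₀ := analyticAt_id.fun_inv hz
  rw [← jet_exponent hw hS hz, expJet, derivative_jet_exp hw]
  exact ((analyticAt_const.fun_mul analyticAt_id).fun_mul analyticAt_const).fun_add
    ((analyticAt_const.fun_mul hi).fun_mul analyticAt_const) |>.fun_add hS

theorem hasDerivAt_expJet_left (hw : AnalyticAt ℂ w z₀) (hS : AnalyticAt ℂ S z₀) (hz : z₀ ≠ 0)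
    (x t : ℝ) (n : ℕ) : HasDerivAt (fun x => coeff n (expJet w z₀ c₁ c₂ S x t))
      (coeff n ((C c₁ * jet w z₀ fun p => p) * expJet w z₀ c₁ c₂ S x t)) x := by
  refine hasDerivAt_coeff_exp (L₀ := C (t : ℂ) * (C c₂ * (jet w z₀ fun p => p)⁻¹) + jet w z₀ S)
    (fun y => ?_) (fun y => ?_) n x
  · rw [derivative_expJet hw hS hz]
    congr 2
    ring
  · simp only [constantCoeff_expJet, map_mul, constantCoeff_C, constantCoeff_jet]
    have h1 : HasDerivAt (fun y : ℝ => c₁ * z₀ * (y : ℂ) + c₂ * z₀⁻¹ * t + S z₀) (c₁ * z₀) y := by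
      have := (((hasDerivAt_id y).ofReal_comp.const_mul (c₁ * z₀)).add_const
        (c₂ * z₀⁻¹ * t)).add_const (S z₀)
      simpa using this
    have := h1.cexp
    rwa [mul_comm (Complex.exp _)] at this

theorem hasDerivAt_expJet_right (hw : AnalyticAt ℂ w z₀) (hS : AnalyticAt ℂ S z₀) (hz : z₀ ≠ 0)
    (x t : ℝ) (n : ℕ) : HasDerivAt (fun t => coeff n (expJet w z₀ c₁ c₂ S x t))
      (coeff n ((C c₂ * (jet w z₀ fun p => p)⁻¹) * expJet w z₀ c₁ c₂ S x t)) t := by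
  refine hasDerivAt_coeff_exp (L₀ := C (x : ℂ) * (C c₁ * (jet w z₀ fun p => p)) + jet w z₀ S)
    (fun y => ?_) (fun y => ?_) n t
  · rw [derivative_expJet hw hS hz]
    congr 2
    ring
  · simp only [constantCoeff_expJet, map_mul, constantCoeff_C, constantCoeff_inv, constantCoeff_jet]
    have h1 : HasDerivAt (fun y : ℝ => c₁ * z₀ * (x : ℂ) + c₂ * z₀⁻¹ * (y : ℂ) + S z₀)
        (c₂ * z₀⁻¹) y := by
      have := (((hasDerivAt_id y).ofReal_comp.const_mul (c₂ * z₀⁻¹)).const_add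
        (c₁ * z₀ * x)).add_const (S z₀)
      simpa using this
    have := h1.cexp
    rwa [mul_comm (Complex.exp _)] at this

theorem contDiff_expJet (hw : AnalyticAt ℂ w z₀) (hS : AnalyticAt ℂ S z₀) (hz : z₀ ≠ 0)
    (n : ℕ) : ContDiff ℝ ∞ fun z : ℝ × ℝ => coeff n (expJet w z₀ c₁ c₂ S z.1 z.2) := by
  have h1 : ContDiff ℝ ∞ fun z : ℝ × ℝ => (z.1 : ℂ) := Complex.ofRealCLM.contDiff.comp contDiff_fst
  have h2 : ContDiff ℝ ∞ fun z : ℝ × ℝ => (z.2 : ℂ) := Complex.ofRealCLM.contDiff.comp contDiff_snd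
  set P := jet w z₀ fun p => p
  have hL : ∀ m, ContDiff ℝ ∞ fun z : ℝ × ℝ => coeff m (d⁄dX ℂ (C (z.1 : ℂ) * (C c₁ * P) +
        C (z.2 : ℂ) * (C c₂ * P⁻¹) + jet w z₀ S)) := by
    intro m
    have e : (fun z : ℝ × ℝ => coeff m (d⁄dX ℂ (C (z.1 : ℂ) * (C c₁ * P) +
        C (z.2 : ℂ) * (C c₂ * P⁻¹) + jet w z₀ S))) = fun z : ℝ × ℝ =>
        ((z.1 : ℂ) * coeff (m + 1) (C c₁ * P) + (z.2 : ℂ) * coeff (m + 1) (C c₂ * P⁻¹)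
          + coeff (m + 1) (jet w z₀ S)) * ((m : ℂ) + 1) := by
      funext z
      rw [coeff_derivative, map_add, map_add, coeff_C_mul (m + 1) _ (z.1 : ℂ),
        coeff_C_mul (m + 1) _ (z.2 : ℂ)]
    rw [e]
    exact (((h1.mul contDiff_const).add (h2.mul contDiff_const)).add contDiff_const).mul
      contDiff_const
  have hE : ContDiff ℝ ∞ fun z : ℝ × ℝ => constantCoeff (expJet w z₀ c₁ c₂ S z.1 z.2) := by
    simp only [constantCoeff_expJet]
    exact (((contDiff_const.mul h1).add (contDiff_const.mul h2)).add contDiff_const).cexp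
  exact contDiff_coeff_of_derivative (Φ := fun z : ℝ × ℝ => expJet w z₀ c₁ c₂ S z.1 z.2)
    (L' := fun z : ℝ × ℝ => d⁄dX ℂ (C (z.1 : ℂ) * (C c₁ * P) +
        C (z.2 : ℂ) * (C c₂ * P⁻¹) + jet w z₀ S))
    (fun z => derivative_expJet hw hS hz z.1 z.2) hL hE n

end expJet

/-! ### Leading minors of the kernel. -/

section Leading

variable {N : ℕ}

theorem coeff_mul_eq_sum (M : ℕ) {m : ℕ} (hm : m < M) (F G : ℂ⟦X⟧) :
    coeff m (F * G) = ∑ j : Fin M, coeff m (X ^ (j : ℕ) * F) * coeff j G := by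
  rw [mul_comm, coeff_mul, Finset.Nat.sum_antidiagonal_eq_sum_range_succ
    (fun i j => coeff i G * coeff j F), Fin.sum_univ_eq_sum_range
    (fun j => coeff m (X ^ j * F) * coeff j G) M, ← Finset.sum_range_add_sum_Ico _
    (Nat.succ_le_of_lt hm), Finset.sum_eq_zero (s := Finset.Ico _ _), add_zero]
  · refine Finset.sum_congr rfl fun j hj => ?_
    have := Finset.mem_range.1 hj
    rw [coeff_X_pow_mul', if_pos (by omega), mul_comm]
  · intro j hj
    have := (Finset.mem_Ico.1 hj).1
    rw [coeff_X_pow_mul', if_neg (by omega), zero_mul]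

/-- The matrix of multiplication by `F` on power series truncated at order `N`. -/
def mulMat (N : ℕ) (F : ℂ⟦X⟧) : Matrix (Fin N) (Fin N) ℂ := of fun i j =>
  coeff (i : ℕ) (X ^ (j : ℕ) * F)

theorem det_mulMat (F : ℂ⟦X⟧) : (mulMat N F).det = constantCoeff F ^ N := by
  rw [det_of_isLowerTriangular]
  · simp [mulMat, coeff_X_pow_mul']
  · intro i j hij
    have : ¬ (j : ℕ) ≤ i := not_le.2 hij
    rw [mulMat, of_apply, coeff_X_pow_mul', if_neg this]

/-- The leading block of coefficients of a series in two variables. -/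
def leadingBlock (N : ℕ) (F : ℂ⟦X⟧⟦X⟧) : Matrix (Fin N) (Fin N) ℂ := of fun i j =>
  coeff (i : ℕ) (coeff (j : ℕ) F)

theorem coeff_coeff_C_mul_map_mul (M : ℕ) {i j : ℕ} (hi : i < M) (hj : j < M) (F H : ℂ⟦X⟧)
    (K : ℂ⟦X⟧⟦X⟧) : coeff i (coeff j (C F * PowerSeries.map C H * K)) =
      ∑ μ : Fin M, ∑ ν : Fin M, coeff i (X ^ (μ : ℕ) * F) * coeff (μ : ℕ) (coeff (ν : ℕ) K) *
        coeff j (X ^ (ν : ℕ) * H) := by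
  have e : coeff j (PowerSeries.map C H * K) =
      ∑ ν : Fin M, C (coeff j (X ^ (ν : ℕ) * H)) * coeff (ν : ℕ) K := by
    ext m
    rw [← coeff_swapSeries, swapSeries_mul, swapSeries_map, coeff_C_mul, coeff_mul_eq_sum M hj,
      map_sum]
    simp only [coeff_swapSeries, coeff_C_mul]
  rw [mul_assoc, coeff_C_mul, coeff_mul_eq_sum M hi, e]
  refine Finset.sum_congr rfl fun μ _ => ?_
  rw [map_sum, Finset.mul_sum]
  refine Finset.sum_congr rfl fun ν _ => ?_
  rw [coeff_C_mul]
  ring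

theorem leadingBlock_mul (F H : ℂ⟦X⟧) (K : ℂ⟦X⟧⟦X⟧) :
    leadingBlock N (C F * PowerSeries.map C H * K)
      = mulMat N F * leadingBlock N K * (mulMat N H)ᵀ := by
  ext i j
  simp only [leadingBlock, of_apply, Matrix.mul_apply, transpose_apply, mulMat]
  rw [coeff_coeff_C_mul_map_mul N i.2 j.2, Finset.sum_comm]
  exact Finset.sum_congr rfl fun ν _ => by rw [Finset.sum_mul]

/-- A Hermitian matrix with a cyclic rank one displacement is invertible. -/
theorem det_ne_zero_of_displacement {K L R : Matrix (Fin N) (Fin N) ℂ} {e : Fin N → ℂ}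
    (hK : Kᴴ = K) (he : star e = e) (h : L * K + K * R = vecMulVec e e)
    (hc : ∀ y, (∀ k : ℕ, e ⬝ᵥ (R ^ k *ᵥ y) = 0) → y = 0) : K.det ≠ 0 := by
  intro hdet
  obtain ⟨y, hy0, hy⟩ := exists_mulVec_eq_zero_iff.2 hdet
  -- Pairing the displacement equation with a null vector `z` on both sides gives `|z* e|² = 0`, as
  -- `K` is Hermitian; the equation then shows that the kernel of `K` is stable under `R`.
  have hstep : ∀ z, K *ᵥ z = 0 → e ⬝ᵥ z = 0 ∧ K *ᵥ (R *ᵥ z) = 0 := by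
    intro z hz
    have h1 : (L * K + K * R) *ᵥ z = K *ᵥ (R *ᵥ z) := by
      rw [add_mulVec, ← mulVec_mulVec, ← mulVec_mulVec, hz, mulVec_zero, zero_add]
    have h2 : star z ⬝ᵥ (K *ᵥ (R *ᵥ z)) = 0 := by
      have : star z ᵥ* K = 0 := by
        have := star_mulVec K z
        rw [hz, star_zero, hK] at this
        exact this.symm
      rw [dotProduct_mulVec, this, zero_dotProduct]
    rw [← h1, h, star_dotProduct_vecMulVec z e e he.symm] at h2
    have h3 : star z ⬝ᵥ e = 0 := by
      rw [← norm_eq_zero]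
      exact pow_eq_zero_iff (two_ne_zero) |>.1 (by exact_mod_cast h2)
    have h4 : e ⬝ᵥ z = 0 := by
      have := congrArg star h3
      rw [star_dotProduct, star_star, star_zero] at this
      rw [← he, star_dotProduct, h3, star_zero]
    refine ⟨h4, ?_⟩
    rw [← h1, h]
    ext i
    simp only [mulVec, dotProduct, vecMulVec_apply, mul_assoc, ← Finset.mul_sum]
    change e i * (e ⬝ᵥ z) = 0
    rw [h4, mul_zero]
  have hall : ∀ k : ℕ, K *ᵥ (R ^ k *ᵥ y) = 0 := by
    intro k
    induction k with
    | zero => simpa using hy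
    | succ k ih =>
      rw [pow_succ', ← mulVec_mulVec]
      exact (hstep _ ih).2
  exact hy0 (hc y fun k => (hstep _ (hall k)).1)

/-- Multiplication by `P + q` in `X` and by `Q - q` in `Y` adds up to the defining factor, so it
displaces the kernel to `1`, a rank one block. With `q = Q(0)` the series `Q - q` has order one,
which makes the displacement cyclic. -/
theorem det_leadingBlock_kernel_ne_zero {P Q : ℂ⟦X⟧}
    (h : constantCoeff P + constantCoeff Q ≠ 0) (hPQ : conjSeries P = Q) (hQ : coeff 1 Q ≠ 0) :
    (leadingBlock N (kernel P Q)).det ≠ 0 := by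
  set q := constantCoeff Q
  let e : Fin N → ℂ := fun i => coeff (i : ℕ) (1 : ℂ⟦X⟧)
  have hmul : ∀ F G : ℂ⟦X⟧, mulMat N F *ᵥ (fun i : Fin N => coeff (i : ℕ) G)
      = fun i : Fin N => coeff (i : ℕ) (F * G) := by
    intro F G
    ext i
    rw [coeff_mul_eq_sum N i.2]
    rfl
  refine det_ne_zero_of_displacement (L := mulMat N (P + C q)) (R := (mulMat N (Q - C q))ᵀ)
    (e := e) ?_ ?_ ?_ ?_
  · ext i j
    rw [conjTranspose_apply]
    simp only [leadingBlock, of_apply]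
    conv_rhs => rw [← conj_swap_kernel h hPQ]
    rw [conjSeries₂, coeff_map, coeff_conjSeries, coeff_swapSeries]
    rfl
  · ext i
    simp only [e, Pi.star_apply, coeff_one]
    split_ifs <;> simp
  · have h1 := leadingBlock_mul (N := N) (P + C q) 1 (kernel P Q)
    have h2 := leadingBlock_mul (N := N) 1 (Q - C q) (kernel P Q)
    have hone : mulMat N 1 = 1 := by
      ext i j
      simp only [mulMat, of_apply, mul_one, coeff_X_pow, Matrix.one_apply, Fin.ext_iff]
    rw [hone, transpose_one, Matrix.mul_one, map_one, mul_one] at h1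
    rw [hone, Matrix.one_mul, map_one, one_mul] at h2
    rw [← h1, ← h2]
    have h3 := kernel_mul h
    have h4 : C (P + C q) * kernel P Q + PowerSeries.map C (Q - C q) * kernel P Q = 1 := by
      have : (C (C q) : ℂ⟦X⟧⟦X⟧) = PowerSeries.map C (C q) := by rw [map_C]
      rw [map_add, map_sub, ← h3, this]
      ring
    ext i j
    simp only [leadingBlock, Matrix.add_apply, of_apply]
    rw [← map_add, ← map_add, h4, vecMulVec_apply]
    simp only [e]
    rw [coeff_one, coeff_one, coeff_one]
    split_ifs <;> simp [coeff_one, *]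
  · intro y hy
    refine eq_zero_of_sum_coeff_pow (P := Q) (Φ := 1) hQ (by simp) (e := fun i : Fin N => (i : ℕ))
      (fun i j hij => hij) y fun k => ?_
    have hk : (mulMat N (Q - C q)) ^ k *ᵥ e = fun i : Fin N => coeff (i : ℕ) ((Q - C q) ^ k * 1) := by
      induction k with
      | zero => simp [e]
      | succ k ih => rw [pow_succ', ← mulVec_mulVec, ih, hmul, pow_succ', mul_assoc]
    have := hy k
    rw [← transpose_pow, mulVec_transpose, dotProduct_comm, ← dotProduct_mulVec, hk] at this
    exact this

/-- The matrix of inverse factorials that governs the leading behaviour. -/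
theorem det_inv_factorial_ne_zero :
    (of fun i j : Fin N => if (j : ℕ) ≤ 2 * (i : ℕ) + 1 then
      (((2 * (i : ℕ) + 1 - j)! : ℕ) : ℂ)⁻¹ else 0).det ≠ 0 := by
  -- Extracting `1/(2i+1)!` from each row leaves falling factorials, which vanish for `j > 2i + 1`
  -- and so match the default `0`. They are monic of degree `j`, so the determinant is a Vandermonde
  -- at the distinct nodes `2i + 1`.
  have e : (of fun i j : Fin N => if (j : ℕ) ≤ 2 * (i : ℕ) + 1 then
      (((2 * (i : ℕ) + 1 - j)! : ℕ) : ℂ)⁻¹ else 0) =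
      diagonal (fun i : Fin N => (((2 * (i : ℕ) + 1)! : ℕ) : ℂ)⁻¹) *
      of fun i j : Fin N => (descPochhammer ℂ j).eval (((2 * (i : ℕ) + 1 : ℕ) : ℂ)) := by
    ext i j
    rw [diagonal_mul, of_apply, of_apply, descPochhammer_eval_eq_descFactorial]
    split_ifs with hij
    · have h1 := Nat.factorial_mul_descFactorial hij
      have h2 : (((2 * (i : ℕ) + 1 - j)! : ℕ) : ℂ) ≠ 0 := Nat.cast_ne_zero.2 (Nat.factorial_ne_zero _)
      have h3 : (((2 * (i : ℕ) + 1)! : ℕ) : ℂ) ≠ 0 := Nat.cast_ne_zero.2 (Nat.factorial_ne_zero _)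
      rw [← h1] at h3 ⊢
      push_cast at h3 ⊢
      have h4 := right_ne_zero_of_mul h3
      field_simp
    · rw [Nat.descFactorial_eq_zero_iff_lt.2 (not_le.1 hij)]
      simp
  rw [e, det_mul, det_diagonal]
  refine mul_ne_zero (Finset.prod_ne_zero_iff.2 fun i _ =>
    inv_ne_zero (Nat.cast_ne_zero.2 (Nat.factorial_ne_zero _))) ?_
  rw [← det_eval_matrixOfPolynomials_eq_det_vandermonde
    (fun i : Fin N => ((2 * (i : ℕ) + 1 : ℕ) : ℂ)) (fun j => descPochhammer ℂ j)
    (fun j => descPochhammer_natDegree _ _) (fun j => monic_descPochhammer _ _),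
    det_vandermonde_ne_zero_iff]
  intro i j hij
  dsimp only at hij
  have : 2 * (i : ℕ) + 1 = 2 * (j : ℕ) + 1 := by exact_mod_cast hij
  exact Fin.ext (by omega)

end Leading

/-! ### Asymptotics of Gram determinants for a large exponent. -/

section Asymptotics

variable {N : ℕ} {ι : Type*} {l : Filter ι} {Φ L' : ι → ℂ⟦X⟧}

/-- With `θ = L'(0)`, the recursion keeps in the limit only the term `θ · coeff n Φ`: the hypothesis
on the higher coefficients of `L'` makes the others of lower order. The coefficients thus behave
like those of `exp (θX)`. -/
theorem tendsto_coeff_div_pow (hd : ∀ z, d⁄dX ℂ (Φ z) = L' z * Φ z)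
    (h0 : ∀ z, constantCoeff (Φ z) ≠ 0) (hθ : ∀ᶠ z in l, constantCoeff (L' z) ≠ 0)
    (hL : ∀ k, 1 ≤ k → Tendsto (fun z => coeff k (L' z) / constantCoeff (L' z) ^ (k + 1)) l (𝓝 0))
    (n : ℕ) :
    Tendsto (fun z => coeff n (Φ z) / (constantCoeff (Φ z) * constantCoeff (L' z) ^ n)) l
      (𝓝 ((n ! : ℕ) : ℂ)⁻¹) := by
  induction n using Nat.strong_induction_on with
  | _ n ih =>
    cases n with
    | zero =>
      refine tendsto_const_nhds.congr fun z => ?_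
      simp [h0 z]
    | succ n =>
      have hterm : ∀ x ∈ Finset.HasAntidiagonal.antidiagonal n,
          Tendsto (fun z => (coeff x.1 (L' z) / constantCoeff (L' z) ^ (x.1 + 1)) *
            (coeff x.2 (Φ z) / (constantCoeff (Φ z) * constantCoeff (L' z) ^ x.2))) l
          (𝓝 (if x = (0, n) then ((n ! : ℕ) : ℂ)⁻¹ else 0)) := by
        intro x hx
        have hx' := Finset.HasAntidiagonal.mem_antidiagonal.1 hx
        have h2 := ih x.2 (by omega)
        rcases Nat.eq_zero_or_pos x.1 with h1 | h1
        · have hxn : x = (0, n) := by ext <;> simp <;> omega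
          subst hxn
          rw [if_pos rfl]
          refine h2.congr' ?_
          filter_upwards [hθ] with z hz
          simp [hz]
        · have hxn : x ≠ (0, n) := by rintro rfl; simp at h1
          rw [if_neg hxn]
          simpa using (hL x.1 h1).mul h2
      have hsum := (tendsto_finsetSum _ hterm).const_mul (((n : ℂ) + 1)⁻¹)
      rw [Finset.sum_ite_eq' (Finset.HasAntidiagonal.antidiagonal n) (0, n),
        if_pos (by simp)] at hsum
      have hv : ((n : ℂ) + 1)⁻¹ * ((n ! : ℕ) : ℂ)⁻¹ = (((n + 1)! : ℕ) : ℂ)⁻¹ := by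
        rw [Nat.factorial_succ]
        push_cast
        rw [mul_inv]
      rw [hv] at hsum
      refine hsum.congr' ?_
      filter_upwards [hθ] with z hz
      rw [coeff_succ_of_derivative (hd z), mul_div_assoc, Finset.sum_div]
      congr 1
      refine Finset.sum_congr rfl fun x hx => ?_
      have hx' := Finset.HasAntidiagonal.mem_antidiagonal.1 hx
      have : n + 1 = (x.1 + 1) + x.2 := by omega
      rw [this, pow_add, div_mul_div_comm]
      congr 1
      ring

/-- The normalised coefficient matrix of `Φ`. -/
def scaledMat (N M : ℕ) (Φ : ℂ⟦X⟧) (θ : ℂ) : Matrix (Fin N) (Fin M) ℂ := of fun i j =>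
  if (j : ℕ) ≤ 2 * (i : ℕ) + 1 then
    coeff (2 * (i : ℕ) + 1 - j) Φ / (constantCoeff Φ * θ ^ (2 * (i : ℕ) + 1 - j)) else 0

/-- The coefficient matrix of `Φ` in echelon form. -/
def echelonMat (N M : ℕ) (Φ : ℂ⟦X⟧) (θ : ℂ) : Matrix (Fin N) (Fin M) ℂ := of fun i j =>
  θ ^ (i : ℕ) * ((scaledMat N N Φ θ)⁻¹ * scaledMat N M Φ θ) i j * (θ ^ (j : ℕ))⁻¹

/-- The square factor `G` does not involve the weights, so it cancels in ratios of determinants,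
whatever its size at infinity. -/
theorem coeffMat_eq {M : ℕ} {Φ : ℂ⟦X⟧} {θ : ℂ} (h0 : constantCoeff Φ ≠ 0) (hθ : θ ≠ 0)
    (hdet : (scaledMat N N Φ θ).det ≠ 0) :
    ∃ G : Matrix (Fin N) (Fin N) ℂ, G.det ≠ 0 ∧
      (of fun (i : Fin N) (j : Fin M) => coeff (2 * (i : ℕ) + 1) (X ^ (j : ℕ) * Φ))
        = G * echelonMat N M Φ θ := by
  refine ⟨diagonal (fun i : Fin N => constantCoeff Φ * θ ^ (2 * (i : ℕ) + 1)) *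
    scaledMat N N Φ θ * diagonal (fun i : Fin N => (θ ^ (i : ℕ))⁻¹), ?_, ?_⟩
  · rw [det_mul, det_mul, det_diagonal, det_diagonal]
    refine mul_ne_zero (mul_ne_zero (Finset.prod_ne_zero_iff.2 fun i _ => ?_) hdet)
      (Finset.prod_ne_zero_iff.2 fun i _ => ?_)
    · exact mul_ne_zero h0 (pow_ne_zero _ hθ)
    · exact inv_ne_zero (pow_ne_zero _ hθ)
  · have e1 : echelonMat N M Φ θ = diagonal (fun i : Fin N => θ ^ (i : ℕ)) *
        ((scaledMat N N Φ θ)⁻¹ * scaledMat N M Φ θ) *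
        diagonal (fun j : Fin M => (θ ^ (j : ℕ))⁻¹) := by
      ext i j
      rw [mul_diagonal, diagonal_mul]
      rfl
    have e2 : diagonal (fun i : Fin N => (θ ^ (i : ℕ))⁻¹) * diagonal (fun i : Fin N => θ ^ (i : ℕ))
        = 1 := by
      rw [diagonal_mul_diagonal, ← diagonal_one]
      congr 1
      funext i
      exact inv_mul_cancel₀ (pow_ne_zero _ hθ)
    have e3 : scaledMat N N Φ θ * (scaledMat N N Φ θ)⁻¹ = 1 :=
      mul_nonsing_inv _ (isUnit_iff_ne_zero.2 hdet)
    rw [e1]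
    have e4 : ∀ (D S E E' : Matrix (Fin N) (Fin N) ℂ) (T : Matrix (Fin N) (Fin M) ℂ)
        (F : Matrix (Fin M) (Fin M) ℂ), E * E' = 1 → S * S⁻¹ = 1 →
        D * S * E * (E' * (S⁻¹ * T) * F) = D * T * F := by
      intro D S E E' T F h1 h2
      calc D * S * E * (E' * (S⁻¹ * T) * F) = D * (S * ((E * E') * (S⁻¹ * T))) * F := by
            simp only [Matrix.mul_assoc]
        _ = D * ((S * S⁻¹) * T) * F := by rw [h1, Matrix.one_mul, Matrix.mul_assoc S]
        _ = D * T * F := by rw [h2, Matrix.one_mul]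
    rw [e4 _ _ _ _ _ _ e2 e3]
    ext i j
    rw [mul_diagonal, diagonal_mul, of_apply, coeff_X_pow_mul', scaledMat, of_apply]
    split_ifs with hij
    · obtain ⟨k, hk⟩ := Nat.exists_eq_add_of_le hij
      have : 2 * (i : ℕ) + 1 - j = k := by omega
      rw [this, hk, pow_add]
      field_simp
    · simp

theorem tendsto_scaledMat (M : ℕ) {θ : ι → ℂ}
    (h : ∀ n, Tendsto (fun z => coeff n (Φ z) / (constantCoeff (Φ z) * θ z ^ n)) l
      (𝓝 ((n ! : ℕ) : ℂ)⁻¹)) :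
    Tendsto (fun z => scaledMat N M (Φ z) (θ z)) l
      (𝓝 (of fun (i : Fin N) (j : Fin M) => if (j : ℕ) ≤ 2 * (i : ℕ) + 1 then
      (((2 * (i : ℕ) + 1 - j)! : ℕ) : ℂ)⁻¹ else 0)) := by
  refine tendsto_pi_nhds.2 fun i => tendsto_pi_nhds.2 fun j => ?_
  change Tendsto (fun z => if (j : ℕ) ≤ 2 * (i : ℕ) + 1 then coeff (2 * (i : ℕ) + 1 - j) (Φ z) /
    (constantCoeff (Φ z) * θ z ^ (2 * (i : ℕ) + 1 - j)) else 0) l (𝓝 (if (j : ℕ) ≤ 2 * (i : ℕ) + 1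
      then (((2 * (i : ℕ) + 1 - j)! : ℕ) : ℂ)⁻¹ else 0))
  split_ifs
  · exact h _
  · exact tendsto_const_nhds

theorem tendsto_matrix_inv {S : ι → Matrix (Fin N) (Fin N) ℂ} {S₀ : Matrix (Fin N) (Fin N) ℂ}
    (h : Tendsto S l (𝓝 S₀)) (h0 : S₀.det ≠ 0) : Tendsto (fun z => (S z)⁻¹) l (𝓝 S₀⁻¹) := by
  have hdet : Tendsto (fun z => (S z).det) l (𝓝 S₀.det) :=
    ((continuous_id.matrix_det).tendsto S₀).comp h
  have hadj : Tendsto (fun z => (S z).adjugate) l (𝓝 S₀.adjugate) :=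
    ((continuous_id.matrix_adjugate).tendsto S₀).comp h
  simp only [inv_def, Ring.inverse_eq_inv']
  exact (hdet.inv₀ h0).smul hadj

theorem tendsto_matrix_mul_apply {m n k : Type*} [Fintype n] {S : ι → Matrix m n ℂ}
    {T : ι → Matrix n k ℂ} {S₀ : Matrix m n ℂ} {T₀ : Matrix n k ℂ} (hS : Tendsto S l (𝓝 S₀))
    (hT : Tendsto T l (𝓝 T₀)) (i : m) (j : k) :
    Tendsto (fun z => (S z * T z) i j) l (𝓝 ((S₀ * T₀) i j)) := by
  simp only [Matrix.mul_apply]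
  exact tendsto_finsetSum _ fun ν _ => (tendsto_pi_nhds.1 (tendsto_pi_nhds.1 hS i) ν).mul
    (tendsto_pi_nhds.1 (tendsto_pi_nhds.1 hT ν) j)

/-- The first `N` columns are eventually exactly the identity. A later column carries `θ^(i-j)` with
`j ≥ N > i` against a bounded entry, and tends to zero. -/
theorem tendsto_echelonMat (M : ℕ) {θ : ι → ℂ}
    (h : ∀ n, Tendsto (fun z => coeff n (Φ z) / (constantCoeff (Φ z) * θ z ^ n)) l
      (𝓝 ((n ! : ℕ) : ℂ)⁻¹)) (hθ : Tendsto (fun z => ‖θ z‖) l atTop) :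
    Tendsto (fun z => echelonMat N M (Φ z) (θ z)) l
      (𝓝 (of fun (i : Fin N) (j : Fin M) => if (i : ℕ) = j then 1 else 0)) := by
  have hS := tendsto_scaledMat (N := N) N h
  have hinv := tendsto_matrix_inv hS det_inv_factorial_ne_zero
  have hdet : ∀ᶠ z in l, (scaledMat N N (Φ z) (θ z)).det ≠ 0 :=
    (((continuous_id.matrix_det).tendsto _).comp hS).eventually_ne det_inv_factorial_ne_zero
  have hθ0 : ∀ᶠ z in l, θ z ≠ 0 := by
    filter_upwards [hθ.eventually_gt_atTop 0] with z hz
    exact norm_pos_iff.1 hz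
  have hS' := tendsto_scaledMat (N := N) M h
  refine tendsto_pi_nhds.2 fun i => tendsto_pi_nhds.2 fun j => ?_
  change Tendsto (fun z => θ z ^ (i : ℕ) *
    ((scaledMat N N (Φ z) (θ z))⁻¹ * scaledMat N M (Φ z) (θ z)) i j * (θ z ^ (j : ℕ))⁻¹) l
    (𝓝 (if (i : ℕ) = j then 1 else 0))
  rcases lt_or_ge (j : ℕ) N with hj | hj
  · refine tendsto_const_nhds.congr' ?_
    filter_upwards [hdet, hθ0] with z hz hz0
    have e : ((scaledMat N N (Φ z) (θ z))⁻¹ * scaledMat N M (Φ z) (θ z)) i j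
        = ((scaledMat N N (Φ z) (θ z))⁻¹ * scaledMat N N (Φ z) (θ z)) i ⟨j, hj⟩ := rfl
    rw [e, nonsing_inv_mul _ (isUnit_iff_ne_zero.2 hz), Matrix.one_apply]
    have hiff : i = ⟨j, hj⟩ ↔ (i : ℕ) = j := Fin.ext_iff
    simp only [hiff]
    split_ifs with hij
    · rw [hij, mul_one, mul_inv_cancel₀ (pow_ne_zero _ hz0)]
    · rw [mul_zero, zero_mul]
  · have hi := i.2
    rw [if_neg (by omega)]
    have hent := tendsto_matrix_mul_apply hinv hS' i j
    have hpow : Tendsto (fun z => (θ z)⁻¹ ^ ((j : ℕ) - i)) l (𝓝 0) := by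
      have h1 : Tendsto (fun z => (θ z)⁻¹) l (𝓝 0) :=
        tendsto_inv₀_cobounded.comp (tendsto_norm_atTop_iff_cobounded.1 hθ)
      have := h1.pow ((j : ℕ) - i)
      rwa [zero_pow (by omega)] at this
    have := hpow.mul hent
    rw [zero_mul] at this
    refine this.congr' ?_
    filter_upwards [hθ0] with z hz0
    have e : θ z ^ (j : ℕ) = θ z ^ (i : ℕ) * θ z ^ ((j : ℕ) - i) := by
      rw [← pow_add]; congr 1; omega
    rw [e, inv_pow]
    field_simp

/-- Separates the exponential, in the outer factors, from the weights, in the middle block. Size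
`2N` suffices since the largest index is `2N - 1`. -/
theorem gram_eq_mul {P Q F A B : ℂ⟦X⟧} :
    gram N P Q (A * F) (B * conjSeries F) =
      (of fun (i : Fin N) (j : Fin (2 * N)) => coeff (2 * (i : ℕ) + 1) (X ^ (j : ℕ) * F)) *
      leadingBlock (2 * N) (C A * PowerSeries.map C B * kernel P Q) *
      (of fun (i : Fin N) (j : Fin (2 * N)) => coeff (2 * (i : ℕ) + 1) (X ^ (j : ℕ) * F))ᴴ := by
  ext i j
  have hi := i.2
  have hj := j.2
  simp only [gram, of_apply, Matrix.mul_apply, conjTranspose_apply, leadingBlock]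
  have e : C (A * F) * PowerSeries.map C (B * conjSeries F) * kernel P Q =
      C F * PowerSeries.map C (conjSeries F) * (C A * PowerSeries.map C B * kernel P Q) := by
    simp only [map_mul]; ring
  rw [e, coeff_coeff_C_mul_map_mul (2 * N) (by omega) (by omega), Finset.sum_comm]
  refine Finset.sum_congr rfl fun ν _ => ?_
  rw [Finset.sum_mul]
  refine Finset.sum_congr rfl fun μ _ => ?_
  congr 1
  have : X ^ (ν : ℕ) * conjSeries F = conjSeries (X ^ (ν : ℕ) * F) := by
    rw [map_mul, map_pow, conjSeries, map_X]
  rw [this, coeff_conjSeries]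
  rfl

/-- Far away, ratios of Gram determinants converge to ratios of leading minors. -/
theorem tendsto_det_gram_div {P Q : ℂ⟦X⟧} (hcc : constantCoeff P + constantCoeff Q ≠ 0)
    (hPQ : conjSeries P = Q) (hQ : coeff 1 Q ≠ 0)
    (hd : ∀ z, d⁄dX ℂ (Φ z) = L' z * Φ z) (h0 : ∀ z, constantCoeff (Φ z) ≠ 0)
    (hθ : Tendsto (fun z => ‖constantCoeff (L' z)‖) l atTop)
    (hL : ∀ k, 1 ≤ k → Tendsto (fun z => coeff k (L' z) / constantCoeff (L' z) ^ (k + 1)) l (𝓝 0))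
    (A B A' B' : ℂ⟦X⟧) (hA : constantCoeff A ≠ 0) (hB : constantCoeff B ≠ 0) :
    Tendsto (fun z => (gram N P Q (A' * Φ z) (B' * conjSeries (Φ z))).det /
      (gram N P Q (A * Φ z) (B * conjSeries (Φ z))).det) l
      (𝓝 ((constantCoeff A' * constantCoeff B' / (constantCoeff A * constantCoeff B)) ^ N)) := by
  have hθ0 : ∀ᶠ z in l, constantCoeff (L' z) ≠ 0 := by
    filter_upwards [hθ.eventually_gt_atTop 0] with z hz
    exact norm_pos_iff.1 hz
  have hco := tendsto_coeff_div_pow hd h0 hθ0 hL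
  have hE := tendsto_echelonMat (N := N) (2 * N) hco hθ
  have hdet : ∀ᶠ z in l, (scaledMat N N (Φ z) (constantCoeff (L' z))).det ≠ 0 :=
    (((continuous_id.matrix_det).tendsto _).comp (tendsto_scaledMat (N := N) N hco)).eventually_ne
      det_inv_factorial_ne_zero
  set J : Matrix (Fin N) (Fin (2 * N)) ℂ := of fun i j => if (i : ℕ) = j then 1 else 0 with hJ
  have hlim : ∀ A B : ℂ⟦X⟧, Tendsto (fun z =>
      (echelonMat N (2 * N) (Φ z) (constantCoeff (L' z)) *
        leadingBlock (2 * N) (C A * PowerSeries.map C B * kernel P Q) *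
        (echelonMat N (2 * N) (Φ z) (constantCoeff (L' z)))ᴴ).det) l
      (𝓝 (constantCoeff A ^ N * (leadingBlock N (kernel P Q)).det * constantCoeff B ^ N)) := by
    intro A B
    set K := leadingBlock (2 * N) (C A * PowerSeries.map C B * kernel P Q) with hK
    have hcont : Continuous fun S : Matrix (Fin N) (Fin (2 * N)) ℂ => (S * K * Sᴴ).det :=
      ((continuous_id.matrix_mul continuous_const).matrix_mul
        continuous_id.matrix_conjTranspose).matrix_det
    -- The limit `J` selects the leading block, on which the weights act by triangular matrices and
    -- enter the determinant only through their constant terms.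
    have hJK : J * K * Jᴴ = leadingBlock N (C A * PowerSeries.map C B * kernel P Q) := by
      ext i j
      have hi : (i : ℕ) < 2 * N := by have := i.2; omega
      have hj : (j : ℕ) < 2 * N := by have := j.2; omega
      have hJi : ∀ (i : Fin N) (hi : (i : ℕ) < 2 * N) (k : Fin (2 * N)),
          J i k = if k = ⟨i, hi⟩ then 1 else 0 := by
        intro i hi k
        simp only [hJ, of_apply, Fin.ext_iff, eq_comm]
      simp only [Matrix.mul_apply, conjTranspose_apply, hJi i hi, hJi j hj]
      simp [hK, leadingBlock]
    have := (hcont.tendsto J).comp hE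
    rw [hJK, leadingBlock_mul, det_mul, det_mul, det_transpose, det_mulMat, det_mulMat] at this
    exact this
  have hκ := det_leadingBlock_kernel_ne_zero (N := N) hcc hPQ hQ
  have hdiv := (hlim A' B').div (hlim A B)
    (mul_ne_zero (mul_ne_zero (pow_ne_zero _ hA) hκ) (pow_ne_zero _ hB))
  have hval : constantCoeff A' ^ N * (leadingBlock N (kernel P Q)).det * constantCoeff B' ^ N /
      (constantCoeff A ^ N * (leadingBlock N (kernel P Q)).det * constantCoeff B ^ N) =
      (constantCoeff A' * constantCoeff B' / (constantCoeff A * constantCoeff B)) ^ N := by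
    rw [div_pow, mul_pow, mul_pow]
    have := pow_ne_zero N hA
    have := pow_ne_zero N hB
    field_simp
  rw [hval] at hdiv
  refine hdiv.congr' ?_
  filter_upwards [hdet, hθ0] with z hz hz0
  obtain ⟨G, hG, hGe⟩ := coeffMat_eq (M := 2 * N) (h0 z) hz0 hz
  have hGd : ∀ K : Matrix (Fin (2 * N)) (Fin (2 * N)) ℂ,
      (G * echelonMat N (2 * N) (Φ z) (constantCoeff (L' z)) * K *
        (G * echelonMat N (2 * N) (Φ z) (constantCoeff (L' z)))ᴴ).det =
      (G.det * Gᴴ.det) * (echelonMat N (2 * N) (Φ z) (constantCoeff (L' z)) * K *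
        (echelonMat N (2 * N) (Φ z) (constantCoeff (L' z)))ᴴ).det := by
    intro K
    set S := echelonMat N (2 * N) (Φ z) (constantCoeff (L' z))
    have : G * S * K * (G * S)ᴴ = G * (S * K * Sᴴ) * Gᴴ := by
      rw [conjTranspose_mul]
      simp only [Matrix.mul_assoc]
    rw [this, det_mul, det_mul]
    ring
  have hGG : G.det * Gᴴ.det ≠ 0 := by
    rw [det_conjTranspose]
    exact mul_ne_zero hG (star_ne_zero.2 hG)
  dsimp only [Pi.div_apply]
  rw [gram_eq_mul, gram_eq_mul, hGe, hGd, hGd, mul_div_mul_left _ _ hGG]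

end Asymptotics

/-! ### The determinants on the spectral curve and their reduction. -/

/-- The determinant `τ` attached to the weights `A(p)`, `B(q)` and the exponential `Φ`. -/
def gramDet (N : ℕ) (β r : ℝ) (A B Φ : ℂ⟦X⟧) : ℂ :=
  (gram N (spec β r) (spec (-β) r) (A * (C Complex.I * Φ)) (B * conjSeries Φ)).det

/-- The derivative of `gramDet` along the flow with symbols `U(p)`, `U'(q)`. -/
def flowTrace (N : ℕ) (β r : ℝ) (U U' A B Φ : ℂ⟦X⟧) : ℂ :=
  trace (adjugate (gram N (spec β r) (spec (-β) r) (A * (C Complex.I * Φ)) (B * conjSeries Φ)) *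
    (gram N (spec β r) (spec (-β) r) (U * (A * (C Complex.I * Φ))) (B * conjSeries Φ) +
      gram N (spec β r) (spec (-β) r) (A * (C Complex.I * Φ)) (U' * (B * conjSeries Φ))))

section gramDet

variable {N : ℕ} {α β r : ℝ}

/-- Hermitian transposition exchanges the weights; the factor `i` changes sign, and the sign is
moved to the left weight. -/
theorem conj_gramDet (hr : r ≠ 0) (A B Φ : ℂ⟦X⟧) :
    conj (gramDet N β r A B Φ) = gramDet N β r (-conjSeries B) (conjSeries A) Φ := by
  rw [gramDet, gramDet, starRingEnd_apply, ← det_conjTranspose,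
    gram_conjTranspose (constantCoeff_add_ne_zero hr) conjSeries_spec]
  have e1 : conjSeries (A * (C Complex.I * Φ)) =
      C (-Complex.I) * (conjSeries A * conjSeries Φ) := by
    rw [map_mul, map_mul, conjSeries_C, Complex.conj_I]; ring
  have e2 : -conjSeries B * (C Complex.I * Φ) =
      C (-Complex.I) * conjSeries (B * conjSeries Φ) := by
    rw [map_mul, conjSeries_conjSeries, map_neg]; ring
  rw [e1, e2, gram_C_mul_left, gram_C_mul_right]

theorem hasDerivAt_gramDet {Φ : ℝ → ℂ⟦X⟧} {U : ℂ⟦X⟧} {c y : ℝ}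
    (hΦ : ∀ n, HasDerivAt (fun y => coeff n (Φ y)) (coeff n ((C (c : ℂ) * U) * Φ y)) y)
    (A B : ℂ⟦X⟧) :
    HasDerivAt (fun y => gramDet N β r A B (Φ y))
      (c * flowTrace N β r U (conjSeries U) A B (Φ y)) y := by
  have h1 := fun n => hasDerivAt_coeff_mul (fun n => hasDerivAt_coeff_mul hΦ (C Complex.I) n) A n
  have hc : ∀ n, HasDerivAt (fun y => coeff n (conjSeries (Φ y)))
      (coeff n (conjSeries ((C (c : ℂ) * U) * Φ y))) y := by
    intro n
    simp only [coeff_conjSeries]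
    exact (hΦ n).star
  have h2 := fun n => hasDerivAt_coeff_mul hc B n
  have h := hasDerivAt_det_gram (N := N) (P := spec β r) (Q := spec (-β) r) h1 h2
  have e1 : A * (C Complex.I * (C (c : ℂ) * U * Φ y)) =
      C (c : ℂ) * (U * (A * (C Complex.I * Φ y))) := by ring
  have e2 : B * conjSeries (C (c : ℂ) * U * Φ y) =
      C (c : ℂ) * (conjSeries U * (B * conjSeries (Φ y))) := by
    rw [map_mul, map_mul, conjSeries_C, Complex.conj_ofReal]; ring
  rw [e1, e2, gram_C_mul_left, gram_C_mul_right, ← smul_add, Matrix.mul_smul, trace_smul,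
    smul_eq_mul] at h
  exact h

theorem contDiff_gramDet {E : Type*} [NormedAddCommGroup E] [NormedSpace ℝ E] {Φ : E → ℂ⟦X⟧}
    (hΦ : ∀ n, ContDiff ℝ ∞ fun z => coeff n (Φ z)) (A B : ℂ⟦X⟧) :
    ContDiff ℝ ∞ fun z => gramDet N β r A B (Φ z) := by
  refine contDiff_det_gram (fun n => contDiff_coeff_mul (fun n => contDiff_coeff_mul hΦ _ n) A n)
    fun n => contDiff_coeff_mul (fun n => ?_) B n
  simp only [coeff_conjSeries]
  exact Complex.conjCLE.contDiff.comp (hΦ n)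

theorem gramDet_ne_zero (hβ : 0 < β * α) (hr : r ≠ 0) (hαβ : r ^ 2 = β * (α - β)) {Φ : ℂ⟦X⟧}
    (hΦ : constantCoeff Φ ≠ 0) : gramDet N β r (spec β r) 1 Φ ≠ 0 := by
  have e : spec β r * (C Complex.I * Φ) = C Complex.I * (spec β r * Φ) := by ring
  rw [gramDet, e, one_mul, gram_C_mul_left, det_smul]
  exact mul_ne_zero (pow_ne_zero _ Complex.I_ne_zero) (det_gram_ne_zero hβ hr hαβ hΦ)

/-- The series `p (p - a) / (p - b)` is even when `r² = b (b - a)`. -/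
theorem isEvenSeries_ratio (hr : r ≠ 0) (hαβ : r ^ 2 = β * (α - β)) :
    IsEvenSeries (spec β r * (spec β r - C (Complex.I * α)) *
      (spec β r - C (Complex.I * β))⁻¹) := by
  have h1 := spec_sub_mul_inv (β := β) hr β
  have h2 := spec_sub_mul_specInv (β := β) hr
  have h3 := isEvenSeries_spec_add (β := β) hr
  set P := spec β r
  have e0 : (P - C (Complex.I * β))⁻¹ = specInv r := by
    linear_combination specInv r * h1 - (P - C (Complex.I * β))⁻¹ * h2
  have e : P * (P - C (Complex.I * α)) * (P - C (Complex.I * β))⁻¹ =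
      (P + C ((r : ℂ) ^ 2) * specInv r) + C (Complex.I * β - Complex.I * α) := by
    have hk : (r : ℂ) ^ 2 = (Complex.I * β) * (Complex.I * β - Complex.I * α) := by
      have : ((r ^ 2 : ℝ) : ℂ) = ((β * (α - β) : ℝ) : ℂ) := by rw [hαβ]
      push_cast at this
      linear_combination this + (β * (β - α) : ℂ) * -Complex.I_sq
    have hk' : C ((r : ℂ) ^ 2) = C (Complex.I * β) * (C (Complex.I * β) - C (Complex.I * α)) := by
      rw [hk, map_mul C (Complex.I * β : ℂ), map_sub]
    rw [e0, hk', map_sub]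
    linear_combination (P + C (Complex.I * β) - C (Complex.I * α)) * h2
  rw [e]
  exact h3.add (isEvenSeries_C _)

theorem spec_neg_add_mul_inv (hr : r ≠ 0) (s : ℝ) :
    (spec (-β) r + C (Complex.I * s)) * (spec (-β) r + C (Complex.I * s))⁻¹ = 1 := by
  have := spec_sub_mul_inv (β := -β) hr (-s)
  rwa [Complex.ofReal_neg, mul_neg, map_neg, sub_neg_eq_add] at this

theorem isEvenSeries_ratio_neg (hr : r ≠ 0) (hαβ : r ^ 2 = β * (α - β)) :
    IsEvenSeries (spec (-β) r * (spec (-β) r + C (Complex.I * α)) *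
      (spec (-β) r + C (Complex.I * β))⁻¹) := by
  have := isEvenSeries_ratio (α := -α) (β := -β) hr (by rw [hαβ]; ring)
  rwa [Complex.ofReal_neg, Complex.ofReal_neg, mul_neg, mul_neg, map_neg, map_neg, sub_neg_eq_add,
    sub_neg_eq_add] at this

/-- The difference is `p + r²/(p - b)`; it lets the `x`-flow be replaced by the resolvent flow at
`b`. -/
theorem isEvenSeries_spec_sub_resolvent (hr : r ≠ 0) :
    IsEvenSeries (spec β r - C (-(r : ℂ) ^ 2) * (spec β r - C (Complex.I * β))⁻¹) := by
  have h1 := spec_sub_mul_inv (β := β) hr β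
  have h2 := spec_sub_mul_specInv (β := β) hr
  have e : (spec β r - C (Complex.I * β))⁻¹ = specInv r := by
    linear_combination specInv r * h1 - (spec β r - C (Complex.I * β))⁻¹ * h2
  rw [e, map_neg, neg_mul, sub_neg_eq_add]
  exact isEvenSeries_spec_add hr

theorem constantCoeff_spec_sub_ne_zero (hr : r ≠ 0) (s : ℝ) :
    constantCoeff (spec β r - C (Complex.I * s)) ≠ 0 := by
  intro h
  have := congrArg constantCoeff (spec_sub_mul_inv (β := β) hr s)
  rw [map_mul, h, zero_mul, map_one] at this
  exact zero_ne_one this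

theorem spec_mul_inv (hr : r ≠ 0) : spec β r * (spec β r)⁻¹ = 1 := by
  have := spec_sub_mul_inv (β := β) hr 0
  simpa using this

/-- The series `b / p + (a - b) / (p - a)` is even when `r² = b (b - a)`. -/
theorem isEvenSeries_inv_sub_resolvent (hr : r ≠ 0) (hβ : β ≠ 0) (hαβ : r ^ 2 = β * (α - β)) :
    IsEvenSeries ((spec β r)⁻¹ -
      C (-((α - β) / β : ℂ)) * (spec β r - C (Complex.I * α))⁻¹) := by
  have h1 := spec_sub_mul_inv (β := β) hr β
  have h2 := spec_sub_mul_inv (β := β) hr α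
  have h3 := spec_mul_inv (β := β) hr
  have hW := isEvenSeries_ratio hr hαβ
  set P := spec β r
  -- The combination `b/p + (a - b)/(p - a)` equals `a(p - b)/(p(p - a))`, a multiple of the
  -- reciprocal of an even series.
  have hV : IsEvenSeries ((P - C (Complex.I * β)) * (P - C (Complex.I * α))⁻¹ * P⁻¹) := by
    refine hW.of_mul_eq_one ?_
    linear_combination P * P⁻¹ * (P - C (Complex.I * α)) * (P - C (Complex.I * α))⁻¹ * h1 +
      P * P⁻¹ * h2 + h3
  have hβ' : (β : ℂ) ≠ 0 := by exact_mod_cast hβ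
  have hα : α ≠ 0 := by
    rintro rfl
    have : 0 < r ^ 2 := by positivity
    nlinarith [sq_nonneg β]
  have hα' : (α : ℂ) ≠ 0 := by exact_mod_cast hα
  have e : P⁻¹ - C (-((α - β) / β : ℂ)) * (P - C (Complex.I * α))⁻¹ =
      C ((α : ℂ) / β) * ((P - C (Complex.I * β)) * (P - C (Complex.I * α))⁻¹ * P⁻¹) := by
    have k1 : C (-((α - β) / β : ℂ)) = 1 - C ((α : ℂ) / β) := by
      rw [← map_one C, ← map_sub]; congr 1; field_simp; ring
    have k2 : C ((α : ℂ) / β) * C (Complex.I * β) = C (Complex.I * α) := by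
      rw [← map_mul]; congr 1; field_simp
    rw [k1]
    linear_combination -P⁻¹ * h2 + (P - C (Complex.I * α))⁻¹ * h3 +
      P⁻¹ * (P - C (Complex.I * α))⁻¹ * k2 - C ((α : ℂ) / β) * (P - C (Complex.I * α))⁻¹ * h3
  rw [e]
  intro k
  rw [coeff_C_mul, hV k, mul_zero]

end gramDet

section gramDet

variable {N : ℕ} {α β r : ℝ}

theorem flowTrace_spec (hr : r ≠ 0) (A B Φ : ℂ⟦X⟧) :
    flowTrace N β r (spec β r) (spec (-β) r) A B Φ =
      trace (adjugate (gram N (spec β r) (spec (-β) r) (A * (C Complex.I * Φ))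
        (B * conjSeries Φ)) * vecMulVec (oddVec N (A * (C Complex.I * Φ)))
          (oddVec N (B * conjSeries Φ))) := by
  rw [flowTrace, gram_mul_add (constantCoeff_add_ne_zero hr)]

theorem flowTrace_inv (hr : r ≠ 0) (A B Φ : ℂ⟦X⟧) :
    flowTrace N β r (spec β r)⁻¹ (spec (-β) r)⁻¹ A B Φ =
      trace (adjugate (gram N (spec β r) (spec (-β) r) (A * (C Complex.I * Φ))
        (B * conjSeries Φ)) * vecMulVec (oddVec N ((spec β r)⁻¹ * (A * (C Complex.I * Φ))))
          (oddVec N ((spec (-β) r)⁻¹ * (B * conjSeries Φ)))) := by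
  rw [flowTrace, gram_flow (constantCoeff_add_ne_zero hr) (c := 0)]
  · rw [map_zero, sub_zero, spec_mul_inv hr]
  · rw [map_zero, add_zero, spec_mul_inv hr]

/-- The multiplier `Ω₀` of the reduction. -/
def multiplier (α β r : ℝ) : ℂ :=
  -((Complex.I * β + r) * (Complex.I * β + r - Complex.I * α) /
    ((-(Complex.I * β) + r) * (-(Complex.I * β) + r + Complex.I * α)))

theorem ofReal_add_I_mul_ne_zero (hr : r ≠ 0) (s : ℝ) : Complex.I * s + (r : ℂ) ≠ 0 := by
  intro h
  apply hr
  simpa using congrArg Complex.re h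

theorem multiplier_ne_zero (hr : r ≠ 0) : multiplier α β r ≠ 0 := by
  have h1 := ofReal_add_I_mul_ne_zero hr β
  have h2 := ofReal_add_I_mul_ne_zero hr (β - α)
  have h3 := ofReal_add_I_mul_ne_zero hr (-β)
  have h4 := ofReal_add_I_mul_ne_zero hr (α - β)
  push_cast at h2 h3 h4
  rw [multiplier, neg_ne_zero]
  refine div_ne_zero (mul_ne_zero h1 ?_) (mul_ne_zero ?_ ?_)
  · convert h2 using 1; ring
  · convert h3 using 1; ring
  · convert h4 using 1; ring

/-- `Ω₀` is minus the quotient of the constant terms of `p(p - a)/(p - b)` and `q(q + a)/(q + b)`;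
the denominators `p₀ - b` and `p₀* + b` both equal `r`. -/
theorem constantCoeff_ratio (hr : r ≠ 0) :
    -constantCoeff (spec β r * (spec β r - C (Complex.I * α)) * (spec β r - C (Complex.I * β))⁻¹) =
    multiplier α β r * constantCoeff (spec (-β) r * (spec (-β) r + C (Complex.I * α)) *
      (spec (-β) r + C (Complex.I * β))⁻¹) := by
  have h3 := ofReal_add_I_mul_ne_zero hr (-β)
  have h4 := ofReal_add_I_mul_ne_zero hr (α - β)
  push_cast at h3 h4
  have h3' : -(Complex.I * β) + (r : ℂ) ≠ 0 := by convert h3 using 1; ring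
  have h4' : -(Complex.I * β) + r + Complex.I * α ≠ 0 := by convert h4 using 1; ring
  simp only [map_mul, map_sub, map_add, constantCoeff_inv, constantCoeff_spec, constantCoeff_C,
    multiplier, Complex.ofReal_neg, mul_neg]
  rw [add_sub_cancel_left, neg_add_cancel_comm]
  field_simp

theorem constantCoeff_ratio_ne_zero (hr : r ≠ 0) :
    constantCoeff (spec (-β) r * (spec (-β) r + C (Complex.I * α)) *
      (spec (-β) r + C (Complex.I * β))⁻¹) ≠ 0 := by
  have h3 := ofReal_add_I_mul_ne_zero hr (-β)
  have h4 := ofReal_add_I_mul_ne_zero hr (α - β)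
  have hr' : (r : ℂ) ≠ 0 := by exact_mod_cast hr
  push_cast at h3 h4
  simp only [map_mul, map_add, constantCoeff_inv, constantCoeff_spec, constantCoeff_C,
    Complex.ofReal_neg]
  refine mul_ne_zero (mul_ne_zero h3 ?_) (inv_ne_zero ?_)
  · convert h4 using 1; ring
  · convert hr' using 1; ring

theorem eq_pow_mul_of_mul_eq {c c' k x y : ℂ} (hc : -c = k * c') (h0 : c' ≠ 0)
    (h : c' ^ N * x = (-c) ^ N * y) : x = k ^ N * y := by
  rw [hc, mul_pow, mul_right_comm, mul_comm] at h
  exact mul_right_cancel₀ (pow_ne_zero _ h0) h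

/-- The weight moved from `q` to `p` is that of the shift `(n, k, l) ↦ (n + 1, k + 1, l - 1)`, whose
effect is therefore the factor `Ω₀^N`. -/
theorem det_gram_reduction (hr : r ≠ 0) (hαβ : r ^ 2 = β * (α - β)) (F H : ℂ⟦X⟧) :
    (gram N (spec β r) (spec (-β) r) (-(spec β r * (spec β r - C (Complex.I * α)) *
      (spec β r - C (Complex.I * β))⁻¹ * F)) H).det =
    multiplier α β r ^ N * (gram N (spec β r) (spec (-β) r) F
      (spec (-β) r * (spec (-β) r + C (Complex.I * α)) *
      (spec (-β) r + C (Complex.I * β))⁻¹ * H)).det := by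
  have h := det_gram_even (N := N) (P := spec β r) (Q := spec (-β) r) (isEvenSeries_ratio hr hαβ)
    (isEvenSeries_ratio_neg hr hαβ) F H
  exact eq_pow_mul_of_mul_eq (constantCoeff_ratio hr) (constantCoeff_ratio_ne_zero hr) h

variable {Φ : ℂ⟦X⟧}

/-- The `p`-flow equation at `c = a`. The reduction rewrites one of its determinants as `Ω₀^N h`,
which explains the normalisation of `g`. -/
theorem bilinear_spec_shift (hr : r ≠ 0) (hαβ : r ^ 2 = β * (α - β))
    (h0 : gramDet N β r (spec β r) 1 Φ ≠ 0) :
    flowTrace N β r (spec β r) (spec (-β) r) (spec β r - C (Complex.I * α))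
        (spec (-β) r * (spec (-β) r + C (Complex.I * α))⁻¹) Φ * gramDet N β r (spec β r) 1 Φ
      - gramDet N β r (spec β r - C (Complex.I * α))
        (spec (-β) r * (spec (-β) r + C (Complex.I * α))⁻¹) Φ *
        flowTrace N β r (spec β r) (spec (-β) r) (spec β r) 1 Φ
    = -(Complex.I * α) * (gramDet N β r (spec β r - C (Complex.I * α))
        (spec (-β) r * (spec (-β) r + C (Complex.I * α))⁻¹) Φ * gramDet N β r (spec β r) 1 Φ
      - multiplier α β r ^ N * gramDet N β r (spec β r - C (Complex.I * β))
        (spec (-β) r * (spec (-β) r + C (Complex.I * β))⁻¹) Φ *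
        gramDet N β r (-1) (spec (-β) r) Φ) := by
  have hcc := constantCoeff_add_ne_zero (β := β) hr
  have ha := spec_neg_add_mul_inv (β := β) hr α
  have hb := spec_sub_mul_inv (β := β) hr β
  have hred := det_gram_reduction (N := N) (α := α) hr hαβ
    ((spec β r - C (Complex.I * β)) * (C Complex.I * Φ))
    ((spec (-β) r + C (Complex.I * α))⁻¹ * conjSeries Φ)
  simp only [gramDet, flowTrace_spec hr, one_mul, neg_mul] at h0 ⊢
  generalize C Complex.I * Φ = F at h0 hred ⊢
  generalize conjSeries Φ = H at h0 hred ⊢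
  generalize spec β r = P at *
  generalize spec (-β) r = Q at *
  have eH : (Q + C (Complex.I * α)) * ((Q + C (Complex.I * α))⁻¹ * H) = H := by
    rw [← mul_assoc, ha, one_mul]
  have h := bilinear_infinite (N := N) hcc (Complex.I * α) F ((Q + C (Complex.I * α))⁻¹ * H)
    (by rwa [eH])
  have e1 : P * (P - C (Complex.I * α)) * (P - C (Complex.I * β))⁻¹ *
      ((P - C (Complex.I * β)) * F) = P * ((P - C (Complex.I * α)) * F) := by
    linear_combination P * (P - C (Complex.I * α)) * F * hb
  have e2 : Q * (Q + C (Complex.I * α)) * (Q + C (Complex.I * β))⁻¹ *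
      ((Q + C (Complex.I * α))⁻¹ * H) = Q * (Q + C (Complex.I * β))⁻¹ * H := by
    linear_combination Q * (Q + C (Complex.I * β))⁻¹ * H * ha
  rw [e1, e2] at hred
  rw [eH, hred, ← mul_assoc Q] at h
  rw [h, neg_mul]

/-- The resolvent flow at `b`, to which `p` reduces modulo even series. The two shifted determinants
are `h` and its conjugate. -/
theorem bilinear_spec_norm (hr : r ≠ 0) (h0 : gramDet N β r (spec β r) 1 Φ ≠ 0) :
    -(Complex.I * β) * (flowTrace N β r (spec β r) (spec (-β) r) (spec β r) 1 Φ *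
        gramDet N β r (-1) (spec (-β) r) Φ
      - gramDet N β r (spec β r) 1 Φ *
        flowTrace N β r (spec β r) (spec (-β) r) (-1) (spec (-β) r) Φ)
    = -(r : ℂ) ^ 2 * (gramDet N β r (spec β r - C (Complex.I * β))
        (spec (-β) r * (spec (-β) r + C (Complex.I * β))⁻¹) Φ *
        gramDet N β r (-(spec β r * (spec β r - C (Complex.I * β))⁻¹))
          (spec (-β) r + C (Complex.I * β)) Φ
      - gramDet N β r (spec β r) 1 Φ * gramDet N β r (-1) (spec (-β) r) Φ) := by
  have hcc := constantCoeff_add_ne_zero (β := β) hr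
  have he := isEvenSeries_spec_sub_resolvent (β := β) hr
  have he' := isEvenSeries_spec_sub_resolvent (β := -β) hr
  rw [Complex.ofReal_neg, mul_neg, map_neg C (Complex.I * β : ℂ), sub_neg_eq_add] at he'
  have h := bilinear_reduced_flow (N := N) hcc (spec_sub_mul_inv (β := β) hr β)
    (spec_neg_add_mul_inv (β := β) hr β) he he' (C Complex.I * Φ) (conjSeries Φ)
  simp only [gramDet, flowTrace, one_mul, neg_mul] at h0 h ⊢
  simp only [mul_assoc (spec β r), mul_assoc (spec (-β) r)]
  exact h h0

/-- The resolvent flow at `a`, to which `1/p` reduces; here the shifted determinants are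
`τ_{-1,1,0}` and its conjugate. -/
theorem bilinear_inv_norm (hr : r ≠ 0) (hβ : β ≠ 0) (hαβ : r ^ 2 = β * (α - β))
    (h0 : gramDet N β r (spec β r) 1 Φ ≠ 0) :
    -(Complex.I * α) * (flowTrace N β r (spec β r)⁻¹ (spec (-β) r)⁻¹ (spec β r) 1 Φ *
        gramDet N β r (-1) (spec (-β) r) Φ
      - gramDet N β r (spec β r) 1 Φ *
        flowTrace N β r (spec β r)⁻¹ (spec (-β) r)⁻¹ (-1) (spec (-β) r) Φ)
    = -((α - β) / β : ℂ) * (gramDet N β r (spec β r - C (Complex.I * α))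
        (spec (-β) r * (spec (-β) r + C (Complex.I * α))⁻¹) Φ *
        gramDet N β r (-(spec β r * (spec β r - C (Complex.I * α))⁻¹))
          (spec (-β) r + C (Complex.I * α)) Φ
      - gramDet N β r (spec β r) 1 Φ * gramDet N β r (-1) (spec (-β) r) Φ) := by
  have he := isEvenSeries_inv_sub_resolvent hr hβ hαβ
  have he' := isEvenSeries_inv_sub_resolvent (α := -α) hr (neg_ne_zero.2 hβ) (by rw [hαβ]; ring)
  have ek : (((-α : ℝ) : ℂ) - ((-β : ℝ) : ℂ)) / ((-β : ℝ) : ℂ) = ((α : ℂ) - β) / β := by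
    push_cast
    rw [div_neg, ← neg_div]
    congr 1
    ring
  rw [ek, Complex.ofReal_neg, mul_neg, map_neg C (Complex.I * α : ℂ), sub_neg_eq_add] at he'
  have h := bilinear_reduced_flow (N := N) (constantCoeff_add_ne_zero (β := β) hr)
    (spec_sub_mul_inv (β := β) hr α) (spec_neg_add_mul_inv (β := β) hr α) he he'
    (C Complex.I * Φ) (conjSeries Φ)
  simp only [gramDet, flowTrace, one_mul, neg_mul] at h0 h ⊢
  simp only [mul_assoc (spec β r), mul_assoc (spec (-β) r)]
  exact h h0

/-- The double shift equation at `c = b`, divided by one power of `p`; the reduction identifies the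
remaining determinant with `τ_{-1,1,0}`. -/
theorem bilinear_inv_shift (hr : r ≠ 0) (hαβ : r ^ 2 = β * (α - β))
    (h0 : gramDet N β r (spec β r) 1 Φ ≠ 0) :
    multiplier α β r ^ N * (Complex.I * β * (
      flowTrace N β r (spec β r)⁻¹ (spec (-β) r)⁻¹ (spec β r - C (Complex.I * β))
        (spec (-β) r * (spec (-β) r + C (Complex.I * β))⁻¹) Φ *
          gramDet N β r (-1) (spec (-β) r) Φ
      - gramDet N β r (spec β r - C (Complex.I * β))
        (spec (-β) r * (spec (-β) r + C (Complex.I * β))⁻¹) Φ *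
        flowTrace N β r (spec β r)⁻¹ (spec (-β) r)⁻¹ (-1) (spec (-β) r) Φ)
      + gramDet N β r (spec β r - C (Complex.I * β))
        (spec (-β) r * (spec (-β) r + C (Complex.I * β))⁻¹) Φ *
          gramDet N β r (-1) (spec (-β) r) Φ)
    = gramDet N β r (spec β r - C (Complex.I * α))
        (spec (-β) r * (spec (-β) r + C (Complex.I * α))⁻¹) Φ * gramDet N β r (spec β r) 1 Φ := by
  have hcc := constantCoeff_add_ne_zero (β := β) hr
  have ha := spec_neg_add_mul_inv (β := β) hr α
  have hb := spec_neg_add_mul_inv (β := β) hr β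
  have hb' := spec_sub_mul_inv (β := β) hr β
  have hP := spec_mul_inv (β := β) hr
  have hQ := spec_mul_inv (β := -β) hr
  have hred := det_gram_reduction (N := N) (α := α) hr hαβ
    ((spec β r - C (Complex.I * β)) * ((spec β r)⁻¹ * (C Complex.I * Φ)))
    (spec (-β) r * ((spec (-β) r + C (Complex.I * α))⁻¹ * conjSeries Φ))
  simp only [gramDet, flowTrace_inv hr, one_mul, neg_mul] at h0 ⊢
  generalize C Complex.I * Φ = F at h0 hred ⊢
  generalize conjSeries Φ = H at h0 hred ⊢
  generalize spec β r = P at *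
  generalize spec (-β) r = Q at *
  have eH : (Q + C (Complex.I * β)) * ((Q + C (Complex.I * β))⁻¹ * H) = H := by
    rw [← mul_assoc, hb, one_mul]
  have eF : P * (P⁻¹ * F) = F := by rw [← mul_assoc, hP, one_mul]
  have h := bilinear_double_shift (N := N) hcc (Complex.I * β) (P⁻¹ * F)
    ((Q + C (Complex.I * β))⁻¹ * H) (by rwa [eF, eH])
  have e1 : P * (P - C (Complex.I * α)) * (P - C (Complex.I * β))⁻¹ *
      ((P - C (Complex.I * β)) * (P⁻¹ * F)) = (P - C (Complex.I * α)) * F := by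
    linear_combination (P - C (Complex.I * α)) * F * (P * P⁻¹ * hb' + hP)
  have e2 : Q * (Q + C (Complex.I * α)) * (Q + C (Complex.I * β))⁻¹ *
      (Q * ((Q + C (Complex.I * α))⁻¹ * H)) = Q * (Q * ((Q + C (Complex.I * β))⁻¹ * H)) := by
    linear_combination Q * Q * (Q + C (Complex.I * β))⁻¹ * H * ha
  have e3 : Q⁻¹ * (Q * (Q + C (Complex.I * β))⁻¹ * H) = (Q + C (Complex.I * β))⁻¹ * H := by
    linear_combination (Q + C (Complex.I * β))⁻¹ * H * hQ
  have e4 : Q⁻¹ * (Q * H) = H := by linear_combination H * hQ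
  have e5 : P⁻¹ * ((P - C (Complex.I * β)) * F) = (P - C (Complex.I * β)) * (P⁻¹ * F) := by ring
  rw [e1, e2, gram_neg_left, det_neg] at hred
  rw [eH, eF, gram_neg_left ((P - C (Complex.I * β)) * (P⁻¹ * F)), det_neg, ← mul_assoc Q _ H] at h
  rw [e3, e4, e5, mul_neg P⁻¹ F, oddVec_neg, neg_vecMulVec, h, mul_assoc Q _ H]
  have hs : (-1 : ℂ) ^ Fintype.card (Fin N) * (-1) ^ Fintype.card (Fin N) = 1 := by
    rw [← mul_pow]; norm_num
  rw [mul_assoc Q _ H]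
  linear_combination (-1 : ℂ) ^ Fintype.card (Fin N) *
    -(gram N P Q (P * F) H).det * hred + (gram N P Q ((P - C (Complex.I * α)) * F)
      (Q * ((Q + C (Complex.I * α))⁻¹ * H))).det * (gram N P Q (P * F) H).det * hs

end gramDet

/-! ### From bilinear equations to the massive Thirring model. -/

section Solution

variable {σ ρ₁ ρ₂ : ℝ}

theorem hasDerivAt_planeWave_left (x t : ℝ) :
    HasDerivAt (fun x => planeWave σ ρ₁ ρ₂ x t)
      (Complex.I * ((1 + σ * ρ₁ * ρ₂) * (ρ₂ / ρ₁)) * planeWave σ ρ₁ ρ₂ x t) x := by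
  have h : HasDerivAt (fun x : ℝ => (1 + σ * ρ₁ * ρ₂) * (ρ₂ / ρ₁ * x + ρ₁ / ρ₂ * t))
      ((1 + σ * ρ₁ * ρ₂) * (ρ₂ / ρ₁)) x := by
    simpa using (((hasDerivAt_id x).const_mul (ρ₂ / ρ₁)).add_const (ρ₁ / ρ₂ * t)).const_mul
      (1 + σ * ρ₁ * ρ₂)
  refine (h.ofReal_comp.const_mul Complex.I).cexp.congr_deriv ?_
  rw [mul_comm (Complex.exp _), planeWave]
  push_cast
  rfl

theorem hasDerivAt_planeWave_right (x t : ℝ) :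
    HasDerivAt (fun t => planeWave σ ρ₁ ρ₂ x t)
      (Complex.I * ((1 + σ * ρ₁ * ρ₂) * (ρ₁ / ρ₂)) * planeWave σ ρ₁ ρ₂ x t) t := by
  have h : HasDerivAt (fun t : ℝ => (1 + σ * ρ₁ * ρ₂) * (ρ₂ / ρ₁ * x + ρ₁ / ρ₂ * t))
      ((1 + σ * ρ₁ * ρ₂) * (ρ₁ / ρ₂)) t := by
    simpa using (((hasDerivAt_id t).const_mul (ρ₁ / ρ₂)).const_add (ρ₂ / ρ₁ * x)).const_mul
      (1 + σ * ρ₁ * ρ₂)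
  refine (h.ofReal_comp.const_mul Complex.I).cexp.congr_deriv ?_
  rw [mul_comm (Complex.exp _), planeWave]
  push_cast
  rfl

theorem contDiff_planeWave : ContDiff ℝ ∞ fun z : ℝ × ℝ => planeWave σ ρ₁ ρ₂ z.1 z.2 := by
  have h : ContDiff ℝ ∞ fun z : ℝ × ℝ =>
      (1 + σ * ρ₁ * ρ₂) * (ρ₂ / ρ₁ * z.1 + ρ₁ / ρ₂ * z.2) := by fun_prop
  exact (contDiff_const.mul (Complex.ofRealCLM.contDiff.comp h)).cexp

theorem norm_planeWave (x t : ℝ) : ‖planeWave σ ρ₁ ρ₂ x t‖ = 1 := by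
  rw [planeWave, mul_comm, Complex.norm_exp_ofReal_mul_I]

/-- The bilinear form of the massive Thirring model. -/
theorem isSolution_of_bilinear (hρ₁ : ρ₁ ≠ 0) (hρ₂ : ρ₂ ≠ 0) {F G H Fx Gx Fcx Ft Ht Fct : ℝ → ℝ → ℂ}
    (hF : ContDiff ℝ ∞ fun z : ℝ × ℝ => F z.1 z.2) (hG : ContDiff ℝ ∞ fun z : ℝ × ℝ => G z.1 z.2)
    (hH : ContDiff ℝ ∞ fun z : ℝ × ℝ => H z.1 z.2) (h0 : ∀ x t, F x t ≠ 0)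
    (hFcx : ∀ x t, HasDerivAt (fun x => conj (F x t)) (Fcx x t) x)
    (hGx : ∀ x t, HasDerivAt (fun x => G x t) (Gx x t) x)
    (hFt : ∀ x t, HasDerivAt (fun t => F x t) (Ft x t) t)
    (hHt : ∀ x t, HasDerivAt (fun t => H x t) (Ht x t) t)
    (h1 : ∀ x t, Complex.I * ρ₁ * (Gx x t * F x t - G x t * Fx x t)
      = ρ₂ * (G x t * F x t - H x t * conj (F x t)))
    (h2 : ∀ x t, Complex.I * (Fx x t * conj (F x t) - F x t * Fcx x t)
      = -σ * ρ₂ ^ 2 * (H x t * conj (H x t) - F x t * conj (F x t)))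
    (h3 : ∀ x t, Complex.I * ρ₂ * (Ht x t * conj (F x t) - H x t * Fct x t)
      = ρ₁ * (H x t * conj (F x t) - G x t * F x t))
    (h4 : ∀ x t, Complex.I * (Fct x t * F x t - conj (F x t) * Ft x t)
      = -σ * ρ₁ ^ 2 * (G x t * conj (G x t) - F x t * conj (F x t))) :
    IsSolution σ (fun x t => ρ₁ * (G x t / conj (F x t)) * planeWave σ ρ₁ ρ₂ x t)
      (fun x t => ρ₂ * (H x t / F x t) * planeWave σ ρ₁ ρ₂ x t) := by
  have hc : ContDiff ℝ ∞ fun z : ℝ × ℝ => conj (F z.1 z.2) := Complex.conjCLE.contDiff.comp hF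
  have h0c : ∀ x t, conj (F x t) ≠ 0 := fun x t => (map_ne_zero _).2 (h0 x t)
  have hρ₁' : (ρ₁ : ℂ) ≠ 0 := by exact_mod_cast hρ₁
  have hρ₂' : (ρ₂ : ℂ) ≠ 0 := by exact_mod_cast hρ₂
  have hn : ∀ (ρ : ℝ) (x t : ℝ) (A B : ℂ),
      ((‖(ρ : ℂ) * (A / B) * planeWave σ ρ₁ ρ₂ x t‖ ^ 2 : ℝ) : ℂ) =
        ρ ^ 2 * (A * conj A / (B * conj B)) := by
    intro ρ x t A B
    rw [norm_mul, norm_planeWave, mul_one, norm_mul, norm_div, mul_pow, div_pow, Complex.mul_conj',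
      Complex.mul_conj', Complex.norm_real, Real.norm_eq_abs, sq_abs]
    push_cast
    rfl
  constructor
  · exact (contDiff_const.mul (hG.mul (hc.inv fun z => h0c _ _))).mul contDiff_planeWave
  · exact (contDiff_const.mul (hH.mul (hF.inv fun z => h0 _ _))).mul contDiff_planeWave
  · intro x t
    have hd := (((hGx x t).fun_div (hFcx x t) (h0c x t)).const_mul (ρ₁ : ℂ)).fun_mul
      (hasDerivAt_planeWave_left (σ := σ) (ρ₁ := ρ₁) (ρ₂ := ρ₂) x t)
    rw [hd.deriv, hn]
    have e1 := h1 x t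
    have e2 := h2 x t
    have n1 := h0 x t
    have n2 := h0c x t
    generalize planeWave σ ρ₁ ρ₂ x t = E
    generalize conj (F x t) = Fc at *
    generalize conj (H x t) = Hc at *
    generalize F x t = f at *
    generalize H x t = h at *
    generalize G x t = g at *
    -- Eliminating the derivative of `F` between the two bilinear equations gives the field equation
    -- with denominators cleared.
    have key : Complex.I * ρ₁ * ((Gx x t * Fc - g * Fcx x t) * f) - (1 + σ * ρ₁ * ρ₂) * ρ₂ * g * Fc * f
        + ρ₂ * h * Fc ^ 2 + σ * ρ₁ * ρ₂ ^ 2 * g * h * Hc = 0 := by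
      linear_combination Fc * e1 + ρ₁ * g * e2
    have : Complex.I * (ρ₁ * ((Gx x t * Fc - g * Fcx x t) / Fc ^ 2) * E + ρ₁ * (g / Fc) *
        (Complex.I * ((1 + σ * ρ₁ * ρ₂) * (ρ₂ / ρ₁)) * E)) + ρ₂ * (h / f) * E +
        σ * (ρ₁ * (g / Fc) * E) * (ρ₂ ^ 2 * (h * Hc / (f * Fc))) =
        (Complex.I * ρ₁ * ((Gx x t * Fc - g * Fcx x t) * f) - (1 + σ * ρ₁ * ρ₂) * ρ₂ * g * Fc * f
        + ρ₂ * h * Fc ^ 2 + σ * ρ₁ * ρ₂ ^ 2 * g * h * Hc) * (E / (Fc ^ 2 * f)) := by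
      have hI := Complex.I_sq
      field_simp
      linear_combination E * (g * Fc * f * ρ₂ * (1 + σ * ρ₁ * ρ₂)) * hI
    rw [this, key, zero_mul]
  · intro x t
    have hd := (((hHt x t).fun_div (hFt x t) (h0 x t)).const_mul (ρ₂ : ℂ)).fun_mul
      (hasDerivAt_planeWave_right (σ := σ) (ρ₁ := ρ₁) (ρ₂ := ρ₂) x t)
    rw [hd.deriv, hn, Complex.conj_conj]
    have e1 := h3 x t
    have e2 := h4 x t
    have n1 := h0 x t
    have n2 := h0c x t
    generalize planeWave σ ρ₁ ρ₂ x t = E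
    generalize conj (F x t) = Fc at *
    generalize conj (G x t) = Gc at *
    generalize F x t = f at *
    generalize H x t = h at *
    generalize G x t = g at *
    have key : Complex.I * ρ₂ * ((Ht x t * f - h * Ft x t) * Fc) - (1 + σ * ρ₁ * ρ₂) * ρ₁ * h * Fc * f
        + ρ₁ * g * f ^ 2 + σ * ρ₂ * ρ₁ ^ 2 * g * h * Gc = 0 := by
      linear_combination f * e1 + ρ₂ * h * e2
    have : Complex.I * (ρ₂ * ((Ht x t * f - h * Ft x t) / f ^ 2) * E + ρ₂ * (h / f) *
        (Complex.I * ((1 + σ * ρ₁ * ρ₂) * (ρ₁ / ρ₂)) * E)) + ρ₁ * (g / Fc) * E +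
        σ * (ρ₂ * (h / f) * E) * (ρ₁ ^ 2 * (g * Gc / (Fc * f))) =
        (Complex.I * ρ₂ * ((Ht x t * f - h * Ft x t) * Fc) - (1 + σ * ρ₁ * ρ₂) * ρ₁ * h * Fc * f
        + ρ₁ * g * f ^ 2 + σ * ρ₂ * ρ₁ ^ 2 * g * h * Gc) * (E / (f ^ 2 * Fc)) := by
      have hI := Complex.I_sq
      field_simp
      linear_combination E * (h * Fc * f * ρ₁ * (1 + σ * ρ₁ * ρ₂)) * hI
    rw [this, key, zero_mul]

end Solution

/-! ### The determinant solution and its modulus at infinity. -/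

section Soliton

variable {N : ℕ} {α β r : ℝ}

theorem conjSeries_spec_neg : conjSeries (spec (-β) r) = spec β r := by
  rw [conjSeries_spec, neg_neg]

theorem conjSeries_spec_sub (s : ℝ) :
    conjSeries (spec β r - C (Complex.I * s)) = spec (-β) r + C (Complex.I * s) := by
  rw [map_sub, conjSeries_spec, conjSeries_C, map_mul, Complex.conj_I, Complex.conj_ofReal,
    neg_mul, map_neg, sub_neg_eq_add]

theorem conjSeries_inv_spec (hr : r ≠ 0) : conjSeries (spec β r)⁻¹ = (spec (-β) r)⁻¹ := by
  have := constantCoeff_spec_sub_ne_zero (β := β) hr 0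
  rw [conjSeries_inv (by simpa using this), conjSeries_spec]

theorem conjSeries_inv_spec_sub (hr : r ≠ 0) (s : ℝ) :
    conjSeries (spec β r - C (Complex.I * s))⁻¹ = (spec (-β) r + C (Complex.I * s))⁻¹ := by
  rw [conjSeries_inv (constantCoeff_spec_sub_ne_zero hr s), conjSeries_spec_sub]

theorem conj_gramDet_spec (hr : r ≠ 0) (Φ : ℂ⟦X⟧) :
    conj (gramDet N β r (spec β r) 1 Φ) = gramDet N β r (-1) (spec (-β) r) Φ := by
  rw [conj_gramDet hr, map_one, conjSeries_spec]

theorem conj_gramDet_shift (hr : r ≠ 0) (s : ℝ) (Φ : ℂ⟦X⟧) :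
    conj (gramDet N β r (spec β r - C (Complex.I * s))
        (spec (-β) r * (spec (-β) r + C (Complex.I * s))⁻¹) Φ) =
      gramDet N β r (-(spec β r * (spec β r - C (Complex.I * s))⁻¹))
        (spec (-β) r + C (Complex.I * s)) Φ := by
  rw [conj_gramDet hr, conjSeries_spec_sub, map_mul, conjSeries_spec_neg,
    ← conjSeries_inv_spec_sub hr, conjSeries_conjSeries]

theorem conj_I_mul_add (s : ℝ) : conj (Complex.I * s + r) = -(Complex.I * s) + r := by
  rw [map_add, map_mul, Complex.conj_I, Complex.conj_ofReal, Complex.conj_ofReal, neg_mul]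

/-- Numerator and denominator are complex conjugates. -/
theorem norm_multiplier (hr : r ≠ 0) : ‖multiplier α β r‖ = 1 := by
  have e1 : -(Complex.I * β) + (r : ℂ) = conj (Complex.I * β + r) := (conj_I_mul_add β).symm
  have e2 : -(Complex.I * β) + (r : ℂ) + Complex.I * α =
      conj (Complex.I * β + r - Complex.I * α) := by
    rw [map_sub, conj_I_mul_add, map_mul, Complex.conj_I, Complex.conj_ofReal]; ring
  have h := multiplier_ne_zero (α := α) (β := β) hr
  rw [multiplier, neg_ne_zero] at h
  rw [multiplier, norm_neg, norm_div, e2, e1, norm_mul, norm_mul, Complex.norm_conj,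
    Complex.norm_conj]
  refine div_self ?_
  rw [← norm_mul, norm_ne_zero_iff]
  exact fun h' => h (by rw [h', zero_div])

/-- Gram determinants along the flows of `p` and `1 / p` solve the massive Thirring model. -/
theorem isSolution_gramDet {σ ρ₁ ρ₂ : ℝ} (hρ₁ : ρ₁ ≠ 0) (hρ₂ : ρ₂ ≠ 0) (hβα : 0 < β * α)
    (hβ : β = α * (1 + σ * ρ₁ * ρ₂)) (hr : r ≠ 0) (hαβ : r ^ 2 = β * (α - β)) {Φ : ℝ → ℝ → ℂ⟦X⟧}
    (hΦ : ∀ n, ContDiff ℝ ∞ fun z : ℝ × ℝ => coeff n (Φ z.1 z.2))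
    (hΦ0 : ∀ x t, constantCoeff (Φ x t) ≠ 0)
    (hΦx : ∀ x t n, HasDerivAt (fun x => coeff n (Φ x t))
      (coeff n ((C ((ρ₂ / (α * ρ₁) : ℝ) : ℂ) * spec β r) * Φ x t)) x)
    (hΦt : ∀ x t n, HasDerivAt (fun t => coeff n (Φ x t))
      (coeff n ((C ((-(β * ρ₁ / ρ₂) : ℝ) : ℂ) * (spec β r)⁻¹) * Φ x t)) t) :
    IsSolution σ
      (fun x t => ρ₁ * (multiplier α β r ^ (-(N : ℤ)) * gramDet N β r (spec β r - C (Complex.I * α))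
        (spec (-β) r * (spec (-β) r + C (Complex.I * α))⁻¹) (Φ x t) /
        conj (gramDet N β r (spec β r) 1 (Φ x t))) * planeWave σ ρ₁ ρ₂ x t)
      (fun x t => ρ₂ * (gramDet N β r (spec β r - C (Complex.I * β))
        (spec (-β) r * (spec (-β) r + C (Complex.I * β))⁻¹) (Φ x t) /
        gramDet N β r (spec β r) 1 (Φ x t)) * planeWave σ ρ₁ ρ₂ x t) := by
  have h0 : ∀ x t, gramDet N β r (spec β r) 1 (Φ x t) ≠ 0 := fun x t =>
    gramDet_ne_zero hβα hr hαβ (hΦ0 x t)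
  have hx : ∀ A B x t, HasDerivAt (fun x => gramDet N β r A B (Φ x t))
      (((ρ₂ / (α * ρ₁) : ℝ) : ℂ) * flowTrace N β r (spec β r) (spec (-β) r) A B (Φ x t)) x := by
    intro A B x t
    rw [← conjSeries_spec]
    exact hasDerivAt_gramDet (hΦx x t) A B
  have ht : ∀ A B x t, HasDerivAt (fun t => gramDet N β r A B (Φ x t))
      (((-(β * ρ₁ / ρ₂) : ℝ) : ℂ) *
        flowTrace N β r (spec β r)⁻¹ (spec (-β) r)⁻¹ A B (Φ x t)) t := by
    intro A B x t
    rw [← conjSeries_inv_spec hr]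
    exact hasDerivAt_gramDet (hΦt x t) A B
  have hβ0 : β ≠ 0 := by rintro rfl; simp at hβα
  have hα0 : α ≠ 0 := by rintro rfl; simp at hβα
  have hβC : (β : ℂ) = α * (1 + σ * ρ₁ * ρ₂) := by exact_mod_cast congrArg Complex.ofReal hβ
  have hrC : (r : ℂ) ^ 2 = β * (α - β) := by exact_mod_cast congrArg Complex.ofReal hαβ
  have k1 : (ρ₁ : ℂ) ≠ 0 := by exact_mod_cast hρ₁
  have k2 : (ρ₂ : ℂ) ≠ 0 := by exact_mod_cast hρ₂
  have k3 : (α : ℂ) ≠ 0 := by exact_mod_cast hα0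
  have k4 : (β : ℂ) ≠ 0 := by exact_mod_cast hβ0
  have hI := Complex.I_sq
  have hΩ0 : multiplier α β r ^ (-(N : ℤ)) * multiplier α β r ^ N = 1 := by
    rw [_root_.zpow_neg, zpow_natCast, inv_mul_cancel₀ (pow_ne_zero _ (multiplier_ne_zero hr))]
  have hΩ1 : multiplier α β r ^ (-(N : ℤ)) * conj (multiplier α β r ^ (-(N : ℤ))) = 1 := by
    rw [Complex.mul_conj', norm_zpow, norm_multiplier hr, _root_.one_zpow]; simp
  refine isSolution_of_bilinear hρ₁ hρ₂
    (F := fun x t => gramDet N β r (spec β r) 1 (Φ x t))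
    (G := fun x t => multiplier α β r ^ (-(N : ℤ)) * gramDet N β r (spec β r - C (Complex.I * α))
        (spec (-β) r * (spec (-β) r + C (Complex.I * α))⁻¹) (Φ x t))
    (H := fun x t => gramDet N β r (spec β r - C (Complex.I * β))
        (spec (-β) r * (spec (-β) r + C (Complex.I * β))⁻¹) (Φ x t))
    (Fx := fun x t => ((ρ₂ / (α * ρ₁) : ℝ) : ℂ) *
      flowTrace N β r (spec β r) (spec (-β) r) (spec β r) 1 (Φ x t))
    (Fcx := fun x t => ((ρ₂ / (α * ρ₁) : ℝ) : ℂ) *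
      flowTrace N β r (spec β r) (spec (-β) r) (-1) (spec (-β) r) (Φ x t))
    (Fct := fun x t => ((-(β * ρ₁ / ρ₂) : ℝ) : ℂ) *
      flowTrace N β r (spec β r)⁻¹ (spec (-β) r)⁻¹ (-1) (spec (-β) r) (Φ x t))
    (contDiff_gramDet hΦ _ _)
    (contDiff_const.mul (contDiff_gramDet hΦ _ _)) (contDiff_gramDet hΦ _ _) h0
    (fun x t => ?_) (fun x t => (hx _ _ x t).const_mul _) (fun x t => ht _ _ x t)
    (fun x t => ht _ _ x t) (fun x t => ?_) (fun x t => ?_) (fun x t => ?_) (fun x t => ?_)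
  · simp only [conj_gramDet_spec hr]
    exact hx _ _ x t
  · have h := bilinear_spec_shift (N := N) hr hαβ (h0 x t)
    have e : (ρ₁ : ℂ) * ((ρ₂ / (α * ρ₁) : ℝ) : ℂ) * α = ρ₂ := by push_cast; field_simp
    simp only [conj_gramDet_spec hr]
    generalize ((ρ₂ / (α * ρ₁) : ℝ) : ℂ) = c at e ⊢
    set m := multiplier α β r ^ (-(N : ℤ))
    set M := multiplier α β r ^ N
    set F := gramDet N β r (spec β r) 1 (Φ x t)
    set Fc := gramDet N β r (-1) (spec (-β) r) (Φ x t)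
    set G := gramDet N β r (spec β r - C (Complex.I * α))
        (spec (-β) r * (spec (-β) r + C (Complex.I * α))⁻¹) (Φ x t)
    set H := gramDet N β r (spec β r - C (Complex.I * β))
        (spec (-β) r * (spec (-β) r + C (Complex.I * β))⁻¹) (Φ x t)
    linear_combination (Complex.I * ρ₁ * m * c) * h - α * ρ₁ * c * m * (G * F - M * H * Fc) * hI +
      (m * G * F - m * M * H * Fc) * e - ρ₂ * H * Fc * hΩ0
  · have h := bilinear_spec_norm (N := N) hr (h0 x t)
    -- The relation `α - β = -σαρ₁ρ₂` converts the flow speed into the nonlinear coefficient.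
    have e : ((ρ₂ / (α * ρ₁) : ℝ) : ℂ) * (α - β) = -σ * ρ₂ ^ 2 := by
      rw [hβC]; push_cast; field_simp; ring
    simp only [conj_gramDet_spec hr, conj_gramDet_shift hr]
    generalize ((ρ₂ / (α * ρ₁) : ℝ) : ℂ) = c at e ⊢
    refine mul_left_cancel₀ k4 ?_
    rw [← e]
    rw [hrC] at h
    linear_combination -c * h
  · have h := bilinear_inv_shift (N := N) hr hαβ (h0 x t)
    have e : (ρ₂ : ℂ) * ((-(β * ρ₁ / ρ₂) : ℝ) : ℂ) = -(β * ρ₁) := by push_cast; field_simp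
    simp only [conj_gramDet_spec hr]
    generalize ((-(β * ρ₁ / ρ₂) : ℝ) : ℂ) = c at e ⊢
    set m := multiplier α β r ^ (-(N : ℤ))
    set Fc := gramDet N β r (-1) (spec (-β) r) (Φ x t)
    set H := gramDet N β r (spec β r - C (Complex.I * β))
        (spec (-β) r * (spec (-β) r + C (Complex.I * β))⁻¹) (Φ x t)
    set X := flowTrace N β r (spec β r)⁻¹ (spec (-β) r)⁻¹ (spec β r - C (Complex.I * β))
        (spec (-β) r * (spec (-β) r + C (Complex.I * β))⁻¹) (Φ x t)
    set Y := flowTrace N β r (spec β r)⁻¹ (spec (-β) r)⁻¹ (-1) (spec (-β) r) (Φ x t)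
    linear_combination Complex.I * (X * Fc - H * Y) * e - ρ₁ * m * h +
      ρ₁ * (Complex.I * β * (X * Fc - H * Y) + H * Fc) * hΩ0
  · have h := bilinear_inv_norm (N := N) hr hβ0 hαβ (h0 x t)
    have e : ((-(β * ρ₁ / ρ₂) : ℝ) : ℂ) * ((α - β) / β) = α * (σ * ρ₁ ^ 2) := by
      have : (α : ℂ) - β = -(α * (σ * ρ₁ * ρ₂)) := by rw [hβC]; ring
      rw [this]; push_cast; field_simp
    simp only [conj_gramDet_spec hr, map_mul (starRingEnd ℂ), conj_gramDet_shift hr]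
    generalize ((-(β * ρ₁ / ρ₂) : ℝ) : ℂ) = c at e ⊢
    generalize ((α : ℂ) - β) / β = k at e h
    refine mul_left_cancel₀ k3 ?_
    set G := gramDet N β r (spec β r - C (Complex.I * α))
        (spec (-β) r * (spec (-β) r + C (Complex.I * α))⁻¹) (Φ x t)
    set Gc := gramDet N β r (-(spec β r * (spec β r - C (Complex.I * α))⁻¹))
          (spec (-β) r + C (Complex.I * α)) (Φ x t)
    set F := gramDet N β r (spec β r) 1 (Φ x t)
    set Fc := gramDet N β r (-1) (spec (-β) r) (Φ x t)
    linear_combination c * h - (G * Gc - F * Fc) * e + α * σ * ρ₁ ^ 2 * G * Gc * hΩ1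

/-- The limit of the ratio is `((p₀ - is) q₀ / ((q₀ + is) p₀))^N` with `q₀ = p₀*`, which has modulus
one. -/
theorem tendsto_norm_gramDet_div {ι : Type*} {l : Filter ι} (hr : r ≠ 0) {Φ L : ι → ℂ⟦X⟧}
    (hd : ∀ z, d⁄dX ℂ (Φ z) = L z * Φ z) (h0 : ∀ z, constantCoeff (Φ z) ≠ 0)
    (hθ : Tendsto (fun z => ‖constantCoeff (L z)‖) l atTop)
    (hL : ∀ k, 1 ≤ k → Tendsto (fun z => coeff k (L z) / constantCoeff (L z) ^ (k + 1)) l (𝓝 0))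
    (s : ℝ) :
    Tendsto (fun z => ‖gramDet N β r (spec β r - C (Complex.I * s))
        (spec (-β) r * (spec (-β) r + C (Complex.I * s))⁻¹) (Φ z)‖ /
        ‖gramDet N β r (spec β r) 1 (Φ z)‖) l (𝓝 1) := by
  have hQ : coeff 1 (spec (-β) r) ≠ 0 := by
    rw [spec, map_add, coeff_C_mul, coeff_exp, coeff_C]
    simpa using hr
  have hP0 : constantCoeff (spec β r * C Complex.I) ≠ 0 := by
    rw [map_mul, constantCoeff_C, constantCoeff_spec]
    exact mul_ne_zero (ofReal_add_I_mul_ne_zero hr β) Complex.I_ne_zero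
  have h := tendsto_det_gram_div (N := N) (constantCoeff_add_ne_zero (β := β) hr) conjSeries_spec
    hQ hd h0 hθ hL (spec β r * C Complex.I) 1 ((spec β r - C (Complex.I * s)) * C Complex.I)
    (spec (-β) r * (spec (-β) r + C (Complex.I * s))⁻¹) hP0 (by simp)
  have e0 : constantCoeff (spec (-β) r) = conj (constantCoeff (spec β r)) := by
    rw [← conjSeries_spec, ← coeff_zero_eq_constantCoeff_apply, coeff_conjSeries,
      coeff_zero_eq_constantCoeff_apply]
  have e1 : constantCoeff (spec (-β) r + C (Complex.I * s)) =
      conj (constantCoeff (spec β r - C (Complex.I * s))) := by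
    rw [← conjSeries_spec_sub, ← coeff_zero_eq_constantCoeff_apply, coeff_conjSeries,
      coeff_zero_eq_constantCoeff_apply]
  have hlim : ‖(constantCoeff ((spec β r - C (Complex.I * s)) * C Complex.I) *
      constantCoeff (spec (-β) r * (spec (-β) r + C (Complex.I * s))⁻¹) /
      (constantCoeff (spec β r * C Complex.I) * constantCoeff (1 : ℂ⟦X⟧))) ^ N‖ = 1 := by
    have n1 := norm_ne_zero_iff.2 (constantCoeff_spec_sub_ne_zero (β := β) hr s)
    have n2 := norm_ne_zero_iff.2 (ofReal_add_I_mul_ne_zero hr β)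
    rw [← constantCoeff_spec] at n2
    generalize Complex.I * (s : ℂ) = w at e1 n1 ⊢
    simp only [map_mul, norm_mul, norm_div, norm_pow, constantCoeff_inv, norm_inv, e0, e1,
      Complex.norm_conj, map_one, constantCoeff_C, norm_one, Complex.norm_I]
    rw [show ∀ x y : ℝ, x ≠ 0 → y ≠ 0 → x * 1 * (y * x⁻¹) / (y * 1 * 1) = 1 from
      fun x y hx hy => by field_simp]
    · exact one_pow N
    · exact n1
    · exact n2
  have h' := h.norm
  rw [hlim] at h'
  refine h'.congr fun z => ?_
  rw [norm_div, mul_assoc _ (C Complex.I), mul_assoc _ (C Complex.I)]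
  rfl

end Soliton

/-! ### Growth of affine functions of `(x, t)`. -/

section Growth

variable {u v : ℂ}

/-- `u` and `v` are linearly independent over `ℝ`; each coordinate is recovered as an imaginary part
against the conjugate of the other vector. -/
theorem exists_norm_le_mul_norm (h : (u * conj v).im ≠ 0) :
    ∃ K : ℝ, ∀ z : ℝ × ℝ, ‖z‖ ≤ K * ‖(z.1 : ℂ) * u + z.2 * v‖ := by
  have key : ∀ (w : ℂ) (z : ℝ × ℝ) (s : ℝ), |s * (u * conj v).im| ≤ ‖w‖ *
      ‖(z.1 : ℂ) * u + z.2 * v‖ → |s| ≤ ‖w‖ / |(u * conj v).im| * ‖(z.1 : ℂ) * u + z.2 * v‖ := by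
    intro w z s hs
    rw [abs_mul] at hs
    rw [div_mul_eq_mul_div, le_div_iff₀ (abs_pos.2 h)]
    exact hs
  refine ⟨max (‖v‖ / |(u * conj v).im|) (‖u‖ / |(u * conj v).im|), fun z => ?_⟩
  have e1 : z.1 * (u * conj v).im = (((z.1 : ℂ) * u + z.2 * v) * conj v).im := by
    simp; ring
  have e2 : z.2 * (u * conj v).im = -(((z.1 : ℂ) * u + z.2 * v) * conj u).im := by
    simp; ring
  have h1 := key v z z.1 (by
    rw [e1, ← Complex.norm_conj v, mul_comm, ← norm_mul, mul_comm]
    exact Complex.abs_im_le_norm _)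
  have h2 := key u z z.2 (by
    rw [e2, abs_neg, ← Complex.norm_conj u, mul_comm, ← norm_mul, mul_comm]
    exact Complex.abs_im_le_norm _)
  rw [Prod.norm_def]
  refine max_le (h1.trans ?_) (h2.trans ?_)
  · exact mul_le_mul_of_nonneg_right (le_max_left _ _) (norm_nonneg _)
  · exact mul_le_mul_of_nonneg_right (le_max_right _ _) (norm_nonneg _)

theorem tendsto_norm_affine (h : (u * conj v).im ≠ 0) (γ : ℂ) :
    Tendsto (fun z : ℝ × ℝ => ‖(z.1 : ℂ) * u + z.2 * v + γ‖) (cocompact (ℝ × ℝ)) atTop := by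
  obtain ⟨K, hK⟩ := exists_norm_le_mul_norm h
  have hz : Tendsto (fun z : ℝ × ℝ => ‖z‖) (cocompact (ℝ × ℝ)) atTop := tendsto_norm_cocompact_atTop
  have h1 : Tendsto (fun z : ℝ × ℝ => (|K| + 1)⁻¹ * ‖z‖ - ‖γ‖) (cocompact (ℝ × ℝ)) atTop :=
    tendsto_atTop_add_const_right _ _ (hz.const_mul_atTop (by positivity))
  refine tendsto_atTop_mono (fun z => ?_) h1
  have h2 : ‖z‖ ≤ (|K| + 1) * ‖(z.1 : ℂ) * u + z.2 * v‖ := (hK z).trans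
    (mul_le_mul_of_nonneg_right ((le_abs_self K).trans (by linarith)) (norm_nonneg _))
  have h3 : (|K| + 1)⁻¹ * ‖z‖ ≤ ‖(z.1 : ℂ) * u + z.2 * v‖ := by
    rwa [inv_mul_le_iff₀ (by positivity)]
  have h4 := norm_sub_le ((z.1 : ℂ) * u + z.2 * v + γ) γ
  rw [add_sub_cancel_right] at h4
  linarith

/-- The numerator is at most linear in the modulus of the affine form below it, while the
denominator has degree at least two. -/
theorem tendsto_affine_div_pow (h : (u * conj v).im ≠ 0) (γ u' v' γ' : ℂ) {k : ℕ} (hk : 1 ≤ k) :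
    Tendsto (fun z : ℝ × ℝ => ((z.1 : ℂ) * u' + z.2 * v' + γ') /
      ((z.1 : ℂ) * u + z.2 * v + γ) ^ (k + 1)) (cocompact (ℝ × ℝ)) (𝓝 0) := by
  obtain ⟨K, hK⟩ := exists_norm_le_mul_norm h
  have hw := tendsto_norm_affine h γ
  set w : ℝ × ℝ → ℂ := fun z => (z.1 : ℂ) * u + z.2 * v + γ with hw_def
  set D : ℝ := (‖u'‖ + ‖v'‖) * |K| with hD
  have hnum : ∀ z : ℝ × ℝ, ‖(z.1 : ℂ) * u' + z.2 * v' + γ'‖ ≤ D * ‖w z‖ + (D * ‖γ‖ + ‖γ'‖) := by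
    intro z
    have h1 : ‖(z.1 : ℂ) * u' + z.2 * v' + γ'‖ ≤ |z.1| * ‖u'‖ + |z.2| * ‖v'‖ + ‖γ'‖ := by
      refine (norm_add_le _ _).trans (add_le_add_left ((norm_add_le _ _).trans ?_) _)
      simp
    have h2 : |z.1| ≤ ‖z‖ := norm_fst_le z
    have h3 : |z.2| ≤ ‖z‖ := norm_snd_le z
    have h4 : ‖z‖ ≤ |K| * (‖w z‖ + ‖γ‖) := by
      have h5 : ‖(z.1 : ℂ) * u + z.2 * v‖ ≤ ‖w z‖ + ‖γ‖ := by
        have := norm_sub_le (w z) γ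
        rwa [hw_def, add_sub_cancel_right] at this
      exact (hK z).trans ((mul_le_mul_of_nonneg_right (le_abs_self K) (norm_nonneg _)).trans
        (mul_le_mul_of_nonneg_left h5 (abs_nonneg K)))
    calc _ ≤ |z.1| * ‖u'‖ + |z.2| * ‖v'‖ + ‖γ'‖ := h1
      _ ≤ ‖z‖ * ‖u'‖ + ‖z‖ * ‖v'‖ + ‖γ'‖ := by gcongr
      _ = (‖u'‖ + ‖v'‖) * ‖z‖ + ‖γ'‖ := by ring
      _ ≤ (‖u'‖ + ‖v'‖) * (|K| * (‖w z‖ + ‖γ‖)) + ‖γ'‖ := by gcongr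
      _ = D * ‖w z‖ + (D * ‖γ‖ + ‖γ'‖) := by rw [hD]; ring
  have hinv : Tendsto (fun z => ‖w z‖⁻¹) (cocompact (ℝ × ℝ)) (𝓝 0) := tendsto_inv_atTop_zero.comp hw
  have hlim : Tendsto (fun z => D * ‖w z‖⁻¹ ^ k + (D * ‖γ‖ + ‖γ'‖) * ‖w z‖⁻¹ ^ (k + 1))
      (cocompact (ℝ × ℝ)) (𝓝 0) := by
    have := ((hinv.pow k).const_mul D).add ((hinv.pow (k + 1)).const_mul (D * ‖γ‖ + ‖γ'‖))
    rwa [zero_pow (by omega), zero_pow (by omega), mul_zero, mul_zero, add_zero] at this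
  refine squeeze_zero_norm' ?_ hlim
  filter_upwards [hw.eventually_gt_atTop 0] with z hz
  rw [norm_div, norm_pow, div_le_iff₀ (pow_pos hz _)]
  refine (hnum z).trans (le_of_eq ?_)
  change 0 < ‖w z‖ at hz
  change _ = _ * ‖w z‖ ^ (k + 1)
  generalize ‖w z‖ = y at hz ⊢
  rw [inv_pow, inv_pow]
  field_simp
  ring

end Growth

section InverseSpec

variable {β r : ℝ}

theorem coeff_one_spec : coeff 1 (spec β r) = r := by
  rw [spec, map_add, coeff_C_mul, coeff_exp, coeff_C]
  simp

theorem coeff_one_inv_spec (hr : r ≠ 0) :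
    coeff 1 (spec β r)⁻¹ = -(r / (Complex.I * β + r) ^ 2) := by
  have h0 := ofReal_add_I_mul_ne_zero hr β
  have h := congrArg (coeff 1) (spec_mul_inv (β := β) hr)
  rw [coeff_one_mul, coeff_one_spec, constantCoeff_inv, constantCoeff_spec, coeff_one,
    if_neg one_ne_zero] at h
  field_simp at h ⊢
  linear_combination h

/-- The product is a nonzero real multiple of `p₀²`, and `Im p₀² = 2rβ`. It makes the linear
coefficient of the exponent large in every direction. -/
theorem im_spec_ne_zero {c₁ c₂ : ℝ} (hc₁ : c₁ ≠ 0) (hc₂ : c₂ ≠ 0) (hβ : β ≠ 0) (hr : r ≠ 0) :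
    (((c₁ : ℂ) * r) * conj ((c₂ : ℂ) * -(r / (Complex.I * β + r) ^ 2))).im ≠ 0 := by
  have h0 := ofReal_add_I_mul_ne_zero hr β
  have h0' : conj (Complex.I * β + r) ≠ 0 := (map_ne_zero _).2 h0
  have e : ((c₁ : ℂ) * r) * conj ((c₂ : ℂ) * -(r / (Complex.I * β + r) ^ 2)) =
      ((-(c₁ * c₂ * r ^ 2 / ‖Complex.I * β + r‖ ^ 4) : ℝ) : ℂ) * (Complex.I * β + r) ^ 2 := by
    have hn : ((‖Complex.I * β + r‖ ^ 4 : ℝ) : ℂ) =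
        (Complex.I * β + r) ^ 2 * conj (Complex.I * β + r) ^ 2 := by
      rw [← mul_pow, Complex.mul_conj']
      push_cast
      ring
    rw [Complex.ofReal_neg, Complex.ofReal_div, hn]
    simp only [map_mul, map_neg, map_div₀, map_pow, Complex.conj_ofReal]
    push_cast
    field_simp
  rw [e, Complex.im_ofReal_mul]
  refine mul_ne_zero (neg_ne_zero.2 ?_) ?_
  · have := norm_ne_zero_iff.2 h0
    positivity
  · rw [pow_two, Complex.mul_im]
    simp only [Complex.add_re, Complex.add_im, Complex.mul_re, Complex.mul_im, Complex.I_re,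
      Complex.I_im, Complex.ofReal_re, Complex.ofReal_im]
    intro h
    have : r * β = 0 := by linarith
    exact mul_ne_zero hr hβ this

end InverseSpec

/-! ### The free parameters and the concrete jets. -/

theorem analyticAt_series {c : ℕ → ℂ} (hc : ∃ R : ℝ, 0 < R ∧ Summable fun r : ℕ => ‖c r‖ * R ^ r) :
    AnalyticAt ℂ (series c) 0 := by
  obtain ⟨R, hR, hs⟩ := hc
  have hd : DifferentiableOn ℂ (series c) (Metric.ball 0 R) := by
    refine Complex.differentiableOn_tsum_of_summable_norm ((summable_nat_add_iff 1).2 hs) (fun i => ?_)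
      Metric.isOpen_ball fun i w hw => ?_
    · exact ((differentiable_id.pow (i + 1)).const_mul (c (i + 1))).differentiableOn
    · rw [norm_mul, norm_pow]
      have : ‖w‖ ≤ R := (mem_ball_zero_iff.1 hw).le
      gcongr
  exact hd.analyticAt (Metric.ball_mem_nhds 0 hR)

theorem conj_series (c : ℕ → ℂ) (z : ℂ) :
    conj (series c z) = series (fun r => conj (c r)) (conj z) := by
  rw [series, series, Complex.conj_tsum]
  simp only [map_mul, map_pow]

/-- The free part of the exponent. -/
def phase (c : ℕ → ℂ) (β r : ℝ) (p : ℂ) : ℂ := series c (Complex.log ((p - Complex.I * β) / r))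

section phase

variable {β r : ℝ} {c : ℕ → ℂ}

theorem analyticAt_phase (hr : r ≠ 0)
    (hc : ∃ R : ℝ, 0 < R ∧ Summable fun r : ℕ => ‖c r‖ * R ^ r) :
    AnalyticAt ℂ (phase c β r) (Complex.I * β + r) := by
  have hr' : (r : ℂ) ≠ 0 := by exact_mod_cast hr
  have h1 : (Complex.I * β + r - Complex.I * β) / (r : ℂ) = 1 := by
    rw [add_sub_cancel_left, div_self hr']
  have hlog : AnalyticAt ℂ (fun p : ℂ => Complex.log ((p - Complex.I * β) / r))
      (Complex.I * β + r) := by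
    refine AnalyticAt.clog ((analyticAt_id.sub analyticAt_const).div analyticAt_const hr') ?_
    rw [h1]
    exact Complex.one_mem_slitPlane
  refine AnalyticAt.comp_of_eq (analyticAt_series hc) hlog ?_
  rw [h1, Complex.log_one]

/-- Conjugation commutes with the logarithm only off the cut; near `p₀*` its argument is near `1`.
-/
theorem conj_phase (hr : r ≠ 0) : ∀ᶠ q in 𝓝 (conj (Complex.I * β + r : ℂ)),
    conj (phase c β r (conj q)) =
      series (fun n => conj (c n)) (Complex.log ((q + Complex.I * β) / r)) := by
  have hr' : (r : ℂ) ≠ 0 := by exact_mod_cast hr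
  have hcont : Continuous fun q : ℂ => (q + Complex.I * β) / r := by fun_prop
  have h1 : (conj (Complex.I * β + r : ℂ) + Complex.I * β) / r = 1 := by
    rw [conj_I_mul_add, neg_add_cancel_comm, div_self hr']
  have hmem : ∀ᶠ q in 𝓝 (conj (Complex.I * β + r : ℂ)),
      (q + Complex.I * β) / (r : ℂ) ∈ Complex.slitPlane :=
    hcont.continuousAt.eventually_mem (Complex.isOpen_slitPlane.mem_nhds (by
      rw [h1]; exact Complex.one_mem_slitPlane))
  filter_upwards [hmem] with q hq
  have e : (conj q - Complex.I * β) / (r : ℂ) = conj ((q + Complex.I * β) / r) := by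
    rw [map_div₀, map_add, map_mul, Complex.conj_I, Complex.conj_ofReal, Complex.conj_ofReal]
    ring
  rw [phase, e, conj_series, Complex.log_conj _ (Complex.slitPlane_arg_ne_pi hq), Complex.conj_conj]

/-- `p - iβ` is an eigenfunction of `(p - iβ)∂` with eigenvalue one, so its jet is `r e^X`. -/
theorem jet_id (β r : ℝ) : jet (fun p => p - Complex.I * β) (Complex.I * β + r) (fun p => p) =
    spec β r := by
  have h1 : ∀ n : ℕ, (weightedDeriv fun p => p - Complex.I * β)^[n] (fun p => p - Complex.I * β)
      = fun p => p - Complex.I * β := by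
    intro n
    induction n with
    | zero => rfl
    | succ n ih =>
      rw [Function.iterate_succ_apply', ih]
      funext p
      simp [weightedDeriv]
  refine jet_eq_of_derivative constantCoeff_spec.symm ?_
  have e : weightedDeriv (fun p => p - Complex.I * β) (fun p => p) = fun p => p - Complex.I * β := by
    funext p
    simp [weightedDeriv]
  rw [e]
  ext n
  rw [jet, coeff_mk, h1, spec, map_add, derivative_C, zero_add, Derivation.leibniz, derivative_C]
  have he : coeff n (d⁄dX ℂ (exp ℂ)) = ((n ! : ℕ) : ℂ)⁻¹ := by
    rw [derivative_exp, coeff_exp]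
    simp
  simp [div_eq_mul_inv, he]

theorem jet_id_conj (β r : ℝ) : jet (fun q => q + Complex.I * β) (conj (Complex.I * β + r : ℂ))
    (fun q => q) = spec (-β) r := by
  have h := jet_conj (fun p => p - Complex.I * β) (fun p => p) (Complex.I * β + r)
  rw [jet_id, conjSeries_spec] at h
  rw [← h]
  congr 1
  · funext q
    rw [map_sub, map_mul, Complex.conj_I, Complex.conj_ofReal, Complex.conj_conj]
    ring
  · funext q
    rw [Complex.conj_conj]

theorem jet_exp_conj (hr : r ≠ 0) (c₁ c₂ x t : ℝ) :
    jet (fun q => q + Complex.I * β) (conj (Complex.I * β + r : ℂ))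
      (fun q => Complex.exp (c₁ * q * x + c₂ * q⁻¹ * t +
        series (fun n => conj (c n)) (Complex.log ((q + Complex.I * β) / r)))) =
    conjSeries (expJet (fun p => p - Complex.I * β) (Complex.I * β + r) c₁ c₂ (phase c β r) x t) := by
  rw [expJet, ← jet_conj]
  have e : (fun q => conj (conj q - Complex.I * β)) = fun q : ℂ => q + Complex.I * β := by
    funext q
    rw [map_sub, map_mul, Complex.conj_I, Complex.conj_ofReal, Complex.conj_conj]
    ring
  rw [e]
  refine jet_congr ?_
  filter_upwards [conj_phase (c := c) hr] with q hq
  rw [← Complex.exp_conj, map_add, hq]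
  simp only [map_add, map_mul, map_inv₀, Complex.conj_ofReal, Complex.conj_conj]

end phase

/-! ### Identification of `τ` with Gram determinants. -/

section bridge

variable {σ ρ₁ ρ₂ α β r : ℝ} {â : ℕ → ℂ} {N : ℕ}

/-- Since `a` and `b` are imaginary, both flow speeds are real; the exponential then splits into
conjugate factors in `p` and `q`. -/
theorem exp_Θ (hb : b σ ρ₁ ρ₂ α = Complex.I * β) (hrt : rt σ ρ₁ ρ₂ α = r) (x t : ℝ) (p q : ℂ) :
    Complex.exp (Θ σ ρ₁ ρ₂ α â x t p q) =
      Complex.exp (((ρ₂ / (α * ρ₁) : ℝ) : ℂ) * p * x + ((-(β * ρ₁ / ρ₂) : ℝ) : ℂ) * p⁻¹ * t +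
        phase â β r p) *
      Complex.exp (((ρ₂ / (α * ρ₁) : ℝ) : ℂ) * q * x + ((-(β * ρ₁ / ρ₂) : ℝ) : ℂ) * q⁻¹ * t +
        series (fun n => conj (â n)) (Complex.log ((q + Complex.I * β) / r))) := by
  rw [← Complex.exp_add, Θ, hb, hrt, phase, a]
  congr 1
  have h1 : Complex.I * ρ₂ / (Complex.I * α * ρ₁) = ((ρ₂ / (α * ρ₁) : ℝ) : ℂ) := by
    rw [mul_assoc, mul_div_mul_left _ _ Complex.I_ne_zero]
    push_cast
    rfl
  have h2 : Complex.I * ρ₁ * (Complex.I * β) / ρ₂ = ((-(β * ρ₁ / ρ₂) : ℝ) : ℂ) := by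
    push_cast
    linear_combination (ρ₁ * β / ρ₂ : ℂ) * Complex.I_sq
  rw [h1, h2]
  ring

theorem τ_eq_gramDet (hr : r ≠ 0) (hb : b σ ρ₁ ρ₂ α = Complex.I * β) (hrt : rt σ ρ₁ ρ₂ α = r)
    (hâ : ∃ R : ℝ, 0 < R ∧ Summable fun r : ℕ => ‖â r‖ * R ^ r)
    {n k l : ℤ} {A B : ℂ → ℂ} (hA : AnalyticAt ℂ A (Complex.I * β + r))
    (hB : AnalyticAt ℂ B (conj (Complex.I * β + r))) {A' B' : ℂ⟦X⟧}
    (hA' : jet (fun p => p - Complex.I * β) (Complex.I * β + r) A = A')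
    (hB' : jet (fun q => q + Complex.I * β) (conj (Complex.I * β + r : ℂ)) B = B')
    (hm : ∀ p q : ℂ, p ≠ 0 → Complex.I * p / (p + q) * (-(p / q)) ^ n
      * (-((p - Complex.I * α) / (q + Complex.I * α))) ^ k
      * (-((p - Complex.I * β) / (q + Complex.I * β))) ^ l
      = Complex.I * A p * B q * (p + q)⁻¹) (x t : ℝ) :
    τ σ ρ₁ ρ₂ α â N n k l x t = gramDet N β r A' B'
      (expJet (fun p => p - Complex.I * β) (Complex.I * β + r) ((ρ₂ / (α * ρ₁) : ℝ) : ℂ)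
        ((-(β * ρ₁ / ρ₂) : ℝ) : ℂ) (phase â β r) x t) := by
  have hp₀ : p₀ σ ρ₁ ρ₂ α = Complex.I * β + r := by rw [p₀, hb, hrt, add_comm]
  have h0 := ofReal_add_I_mul_ne_zero hr β
  have h0' : conj (Complex.I * β + r : ℂ) ≠ 0 := (map_ne_zero _).2 h0
  have hsum : Complex.I * β + r + conj (Complex.I * β + r : ℂ) ≠ 0 := by
    rw [conj_I_mul_add]
    have hr' : (r : ℂ) ≠ 0 := by exact_mod_cast hr
    intro h
    exact hr' (by linear_combination h / 2)
  have hwp : AnalyticAt ℂ (fun p => p - Complex.I * β) (Complex.I * β + r : ℂ) :=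
    analyticAt_id.sub analyticAt_const
  have hwq : AnalyticAt ℂ (fun q => q + Complex.I * β) (conj (Complex.I * β + r : ℂ)) :=
    analyticAt_id.add analyticAt_const
  set c₁ : ℝ := ρ₂ / (α * ρ₁)
  set c₂ : ℝ := -(β * ρ₁ / ρ₂)
  set Ep : ℂ → ℂ := fun p => Complex.exp (c₁ * p * x + c₂ * p⁻¹ * t + phase â β r p) with hEp
  set Eq : ℂ → ℂ := fun q => Complex.exp (c₁ * q * x + c₂ * q⁻¹ * t +
        series (fun n => conj (â n)) (Complex.log ((q + Complex.I * β) / r))) with hEq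
  have hEpA : AnalyticAt ℂ Ep (Complex.I * β + r) := by
    refine AnalyticAt.cexp' (((analyticAt_const.fun_mul analyticAt_id).fun_mul
      analyticAt_const).fun_add ((analyticAt_const.fun_mul (analyticAt_id.fun_inv h0)).fun_mul
      analyticAt_const) |>.fun_add (analyticAt_phase hr hâ))
  have hSq : AnalyticAt ℂ (fun q => series (fun n => conj (â n))
      (Complex.log ((q + Complex.I * β) / r))) (conj (Complex.I * β + r)) := by
    have h := analyticAt_phase (β := -β) (c := fun n => conj (â n)) hr (by simpa using hâ)
    have e : conj (Complex.I * β + r : ℂ) = Complex.I * ((-β : ℝ) : ℂ) + r := by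
      rw [conj_I_mul_add, Complex.ofReal_neg, mul_neg]
    rw [e]
    refine h.congr (Eventually.of_forall fun q => ?_)
    simp only [phase, Complex.ofReal_neg, mul_neg, sub_neg_eq_add]
  have hEqA : AnalyticAt ℂ Eq (conj (Complex.I * β + r)) := by
    exact AnalyticAt.cexp' (((analyticAt_const.fun_mul analyticAt_id).fun_mul
      analyticAt_const).fun_add ((analyticAt_const.fun_mul (analyticAt_id.fun_inv h0')).fun_mul
      analyticAt_const) |>.fun_add hSq)
  rw [τ, gramDet]
  congr 1
  ext i j
  rw [of_apply, gram, of_apply]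
  have e1 : mTilde σ ρ₁ ρ₂ α â (2 * (i : ℕ) + 1) (2 * (j : ℕ) + 1) n k l x t =
      coeff (2 * (i : ℕ) + 1) (jet (fun p => p - Complex.I * β) (Complex.I * β + r) fun p =>
        coeff (2 * (j : ℕ) + 1) (jet (fun q => q + Complex.I * β) (conj (Complex.I * β + r : ℂ))
          fun q => m σ ρ₁ ρ₂ α â n k l x t p q)) := by
    simp only [mTilde, jet, coeff_mk, hb, hp₀]
  have e2 : jet (fun p => p - Complex.I * β) (Complex.I * β + r) (fun p =>
        coeff (2 * (j : ℕ) + 1) (jet (fun q => q + Complex.I * β) (conj (Complex.I * β + r : ℂ))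
          fun q => m σ ρ₁ ρ₂ α â n k l x t p q)) =
      jet (fun p => p - Complex.I * β) (Complex.I * β + r) (fun p =>
        coeff (2 * (j : ℕ) + 1) (jet (fun q => q + Complex.I * β) (conj (Complex.I * β + r : ℂ))
          fun q => (Complex.I * (A p * Ep p)) * (B q * Eq q) * (p + q)⁻¹)) := by
    refine jet_congr ?_
    -- Only `p` near `p₀ ≠ 0` matters for the outer jet, whereas the factorisation is used as an
    -- identity of functions of all `q`.
    filter_upwards [isOpen_ne.mem_nhds h0] with p hp
    congr 2
    funext q
    rw [m, exp_Θ hb hrt, hb, a, hm p q hp]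
    ring
  rw [e1, e2, coeff_jet_jet hwp hwq hsum (analyticAt_const.fun_mul (hA.fun_mul hEpA))
    (hB.fun_mul hEqA), jet_const_mul hwp _ (hA.fun_mul hEpA), jet_mul hwp hA hEpA,
    jet_mul hwq hB hEqA, hA', hB', jet_id, jet_id_conj, hEq, jet_exp_conj hr, mul_left_comm]
  rfl

end bridge

section tau

variable {σ ρ₁ ρ₂ α β r : ℝ} {â : ℕ → ℂ} {N : ℕ}

theorem jet_sub_const (β r s : ℝ) : jet (fun p => p - Complex.I * β) (Complex.I * β + r)
    (fun p => p - Complex.I * s) = spec β r - C (Complex.I * s) := by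
  have hw : AnalyticAt ℂ (fun p => p - Complex.I * β) (Complex.I * β + r : ℂ) :=
    analyticAt_id.sub analyticAt_const
  have hid : AnalyticAt ℂ (fun p => p) (Complex.I * β + r : ℂ) := analyticAt_id
  simp only [sub_eq_add_neg _ (Complex.I * (s : ℂ))]
  rw [jet_add hw hid analyticAt_const, jet_const, jet_id, map_neg, ← sub_eq_add_neg]

theorem add_I_mul_ne_zero (hr : r ≠ 0) (β s : ℝ) :
    conj (Complex.I * β + r : ℂ) + Complex.I * s ≠ 0 := by
  intro h
  apply hr
  simpa using congrArg Complex.re h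

theorem analyticAt_ratio (hr : r ≠ 0) (β s : ℝ) :
    AnalyticAt ℂ (fun q => q * (q + Complex.I * s)⁻¹) (conj (Complex.I * β + r : ℂ)) :=
  analyticAt_id.fun_mul ((analyticAt_id.fun_add analyticAt_const).fun_inv (add_I_mul_ne_zero hr β s))

theorem jet_ratio (hr : r ≠ 0) (β s : ℝ) :
    jet (fun q => q + Complex.I * β) (conj (Complex.I * β + r : ℂ))
      (fun q => q * (q + Complex.I * s)⁻¹) =
      spec (-β) r * (spec (-β) r + C (Complex.I * s))⁻¹ := by
  have hw : AnalyticAt ℂ (fun q => q + Complex.I * β) (conj (Complex.I * β + r : ℂ)) :=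
    analyticAt_id.add analyticAt_const
  have h1 : AnalyticAt ℂ (fun q => q + Complex.I * s) (conj (Complex.I * β + r : ℂ)) :=
    analyticAt_id.fun_add analyticAt_const
  have hid : AnalyticAt ℂ (fun q => q) (conj (Complex.I * β + r : ℂ)) := analyticAt_id
  rw [jet_mul hw hid (h1.fun_inv (add_I_mul_ne_zero hr β s)),
    jet_inv hw h1 (add_I_mul_ne_zero hr β s), jet_add hw hid analyticAt_const,
    jet_const, jet_id_conj]

/-- The jet of the exponential factor of `m`. -/
def flowJet (ρ₁ ρ₂ α β r : ℝ) (â : ℕ → ℂ) (x t : ℝ) : ℂ⟦X⟧ :=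
  expJet (fun p => p - Complex.I * β) (Complex.I * β + r) ((ρ₂ / (α * ρ₁) : ℝ) : ℂ)
        ((-(β * ρ₁ / ρ₂) : ℝ) : ℂ) (phase â β r) x t

theorem τ_zero (hr : r ≠ 0) (hb : b σ ρ₁ ρ₂ α = Complex.I * β) (hrt : rt σ ρ₁ ρ₂ α = r)
    (hâ : ∃ R : ℝ, 0 < R ∧ Summable fun r : ℕ => ‖â r‖ * R ^ r) (x t : ℝ) :
    τ σ ρ₁ ρ₂ α â N 0 0 0 x t =
      gramDet N β r (spec β r) 1 (flowJet ρ₁ ρ₂ α β r â x t) := by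
  refine τ_eq_gramDet hr hb hrt hâ (A := fun p => p) (B := fun _ => 1) analyticAt_id
    analyticAt_const (jet_id β r) ((jet_const 1).trans (map_one C)) (fun p q _ => ?_) x t
  simp only [zpow_zero, mul_one, div_eq_mul_inv]

theorem mul_div_mul_neg_div_zpow {p q : ℂ} (hp : p ≠ 0) :
    Complex.I * p / (p + q) * (-(p / q)) ^ (-1 : ℤ) = -(Complex.I * q * (p + q)⁻¹) := by
  rw [_root_.zpow_neg_one, inv_neg, inv_div]
  field_simp

theorem τ_neg_one (hr : r ≠ 0) (hb : b σ ρ₁ ρ₂ α = Complex.I * β) (hrt : rt σ ρ₁ ρ₂ α = r)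
    (hâ : ∃ R : ℝ, 0 < R ∧ Summable fun r : ℕ => ‖â r‖ * R ^ r) (x t : ℝ) :
    τ σ ρ₁ ρ₂ α â N (-1) 0 0 x t =
      gramDet N β r (-1) (spec (-β) r) (flowJet ρ₁ ρ₂ α β r â x t) := by
  refine τ_eq_gramDet hr hb hrt hâ (A := fun _ => -1) (B := fun q => q) analyticAt_const
    analyticAt_id ((jet_const (-1)).trans (by rw [map_neg, map_one])) (jet_id_conj β r)
    (fun p q hp => ?_) x t
  rw [mul_div_mul_neg_div_zpow hp]
  simp only [zpow_zero, mul_one]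
  ring

theorem τ_shift_a (hr : r ≠ 0) (hb : b σ ρ₁ ρ₂ α = Complex.I * β) (hrt : rt σ ρ₁ ρ₂ α = r)
    (hâ : ∃ R : ℝ, 0 < R ∧ Summable fun r : ℕ => ‖â r‖ * R ^ r) (x t : ℝ) :
    τ σ ρ₁ ρ₂ α â N (-1) 1 0 x t =
      gramDet N β r (spec β r - C (Complex.I * α))
        (spec (-β) r * (spec (-β) r + C (Complex.I * α))⁻¹) (flowJet ρ₁ ρ₂ α β r â x t) := by
  refine τ_eq_gramDet hr hb hrt hâ (A := fun p => p - Complex.I * α)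
    (analyticAt_id.fun_sub analyticAt_const) (analyticAt_ratio hr β α) (jet_sub_const β r α)
    (jet_ratio hr β α) (fun p q hp => ?_) x t
  rw [mul_div_mul_neg_div_zpow hp]
  simp only [zpow_zero, mul_one, zpow_one]
  ring

theorem τ_shift_b (hr : r ≠ 0) (hb : b σ ρ₁ ρ₂ α = Complex.I * β) (hrt : rt σ ρ₁ ρ₂ α = r)
    (hâ : ∃ R : ℝ, 0 < R ∧ Summable fun r : ℕ => ‖â r‖ * R ^ r) (x t : ℝ) :
    τ σ ρ₁ ρ₂ α â N (-1) 0 1 x t =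
      gramDet N β r (spec β r - C (Complex.I * β))
        (spec (-β) r * (spec (-β) r + C (Complex.I * β))⁻¹) (flowJet ρ₁ ρ₂ α β r â x t) := by
  refine τ_eq_gramDet hr hb hrt hâ (A := fun p => p - Complex.I * β)
    (analyticAt_id.fun_sub analyticAt_const) (analyticAt_ratio hr β β) (jet_sub_const β r β)
    (jet_ratio hr β β) (fun p q hp => ?_) x t
  rw [mul_div_mul_neg_div_zpow hp]
  simp only [zpow_zero, mul_one, zpow_one]
  ring

theorem Ω₀_eq_multiplier (hb : b σ ρ₁ ρ₂ α = Complex.I * β) (hrt : rt σ ρ₁ ρ₂ α = r) :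
    Ω₀ σ ρ₁ ρ₂ α = multiplier α β r := by
  have hp₀ : p₀ σ ρ₁ ρ₂ α = Complex.I * β + r := by rw [p₀, hb, hrt, add_comm]
  rw [Ω₀, hp₀, conj_I_mul_add, multiplier]

/-- Every coefficient of the differentiated exponent `L` is affine in `(x, t)`, so the growth lemmas
supply the hypotheses of the general limit. -/
theorem tendsto_norm_τ_ratio (hρ₁ : ρ₁ ≠ 0) (hρ₂ : ρ₂ ≠ 0) (hα : α ≠ 0) (hβ : β ≠ 0) (hr : r ≠ 0)
    (hâ : ∃ R : ℝ, 0 < R ∧ Summable fun r : ℕ => ‖â r‖ * R ^ r) (s : ℝ) :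
    Tendsto (fun z : ℝ × ℝ => ‖gramDet N β r (spec β r - C (Complex.I * s))
        (spec (-β) r * (spec (-β) r + C (Complex.I * s))⁻¹) (flowJet ρ₁ ρ₂ α β r â z.1 z.2)‖ /
        ‖gramDet N β r (spec β r) 1 (flowJet ρ₁ ρ₂ α β r â z.1 z.2)‖) (cocompact (ℝ × ℝ))
      (𝓝 1) := by
  have hz := ofReal_add_I_mul_ne_zero hr β
  have hw : AnalyticAt ℂ (fun p => p - Complex.I * β) (Complex.I * β + r : ℂ) :=
    analyticAt_id.sub analyticAt_const
  have hS := analyticAt_phase (β := β) hr hâ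
  have hc₁ : ρ₂ / (α * ρ₁) ≠ 0 := div_ne_zero hρ₂ (mul_ne_zero hα hρ₁)
  have hc₂ : -(β * ρ₁ / ρ₂) ≠ 0 := neg_ne_zero.2 (div_ne_zero (mul_ne_zero hβ hρ₁) hρ₂)
  have him := im_spec_ne_zero hc₁ hc₂ hβ hr
  set c₁ : ℝ := ρ₂ / (α * ρ₁) with hc₁'
  set c₂ : ℝ := -(β * ρ₁ / ρ₂) with hc₂'
  set T := jet (fun p => p - Complex.I * β) (Complex.I * β + r) (phase â β r) with hT
  set L : ℝ × ℝ → ℂ⟦X⟧ := fun z => d⁄dX ℂ (C (z.1 : ℂ) * (C (c₁ : ℂ) * spec β r) +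
      C (z.2 : ℂ) * (C (c₂ : ℂ) * (spec β r)⁻¹) + T) with hL
  have hcoeff : ∀ k z, coeff k (L z) = (z.1 : ℂ) * (c₁ * coeff (k + 1) (spec β r) * (k + 1)) +
      z.2 * (c₂ * coeff (k + 1) (spec β r)⁻¹ * (k + 1)) + coeff (k + 1) T * (k + 1) := by
    intro k z
    rw [hL]
    simp only [coeff_derivative, map_add, coeff_C_mul]
    ring
  have hcc : ∀ z, constantCoeff (L z) = (z.1 : ℂ) * (c₁ * r) +
      z.2 * (c₂ * -(r / (Complex.I * β + r) ^ 2)) + coeff 1 T := by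
    intro z
    rw [← coeff_zero_eq_constantCoeff_apply, hcoeff, zero_add, coeff_one_spec,
      coeff_one_inv_spec hr]
    simp
  refine tendsto_norm_gramDet_div hr (L := L) (fun z => ?_) (fun z => ?_) ?_ (fun k hk => ?_) s
  · rw [flowJet, derivative_expJet hw hS hz, jet_id]
  · rw [flowJet, constantCoeff_expJet]
    exact Complex.exp_ne_zero _
  · simp only [hcc]
    exact tendsto_norm_affine him _
  · simp only [hcc, hcoeff]
    exact tendsto_affine_div_pow him _ _ _ _ hk

end tau

end MT

end

/-! ### The main theorem. -/

theorem theorem2 (σ ρ₁ ρ₂ α : ℝ)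
    (hσ : (σ = 1 ∧ -1 < ρ₁ * ρ₂ ∧ ρ₁ * ρ₂ < 0) ∨ (σ = -1 ∧ 0 < ρ₁ * ρ₂ ∧ ρ₁ * ρ₂ < 1))
    (hα : α ≠ 0)
    (â : ℕ → ℂ) (hâ : ∃ R : ℝ, 0 < R ∧ Summable (fun r : ℕ => ‖â r‖ * R ^ r))
    (N : ℕ) :
    (∀ x t : ℝ, MT.f σ ρ₁ ρ₂ α â N x t ≠ 0) ∧
    (∀ x t : ℝ, (starRingEnd ℂ) (MT.f σ ρ₁ ρ₂ α â N x t) = MT.τ σ ρ₁ ρ₂ α â N (-1) 0 0 x t) ∧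
    MT.IsSolution σ (MT.u σ ρ₁ ρ₂ α â N) (MT.v σ ρ₁ ρ₂ α â N) ∧
    MT.TendsToBackground ρ₁ ρ₂ (MT.u σ ρ₁ ρ₂ α â N) (MT.v σ ρ₁ ρ₂ α â N) := by
  -- Both sign cases say that `β/α = 1 + σρ₁ρ₂` lies in `(0, 1)`, which gives `βα > 0` and `r² = β(α
  -- - β) > 0`.
  obtain ⟨hκ0, hκ1⟩ : 0 < 1 + σ * ρ₁ * ρ₂ ∧ 1 + σ * ρ₁ * ρ₂ < 1 := by
    rcases hσ with ⟨rfl, h1, h2⟩ | ⟨rfl, h1, h2⟩ <;> constructor <;> linarith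
  have hρ : ρ₁ * ρ₂ ≠ 0 := by
    rcases hσ with ⟨-, -, h⟩ | ⟨-, h, -⟩
    · exact h.ne
    · exact h.ne'
  have hρ₁ : ρ₁ ≠ 0 := left_ne_zero_of_mul hρ
  have hρ₂ : ρ₂ ≠ 0 := right_ne_zero_of_mul hρ
  obtain ⟨β, hβ⟩ : ∃ β, β = α * (1 + σ * ρ₁ * ρ₂) := ⟨_, rfl⟩
  have hα2 : 0 < α ^ 2 := by positivity
  have hβα : 0 < β * α := by
    rw [hβ, show α * (1 + σ * ρ₁ * ρ₂) * α = α ^ 2 * (1 + σ * ρ₁ * ρ₂) by ring]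
    exact mul_pos hα2 hκ0
  have hβ0 : β ≠ 0 := left_ne_zero_of_mul hβα.ne'
  have hpos : 0 < β * (α - β) := by
    rw [hβ, show α * (1 + σ * ρ₁ * ρ₂) * (α - α * (1 + σ * ρ₁ * ρ₂)) =
      α ^ 2 * ((1 + σ * ρ₁ * ρ₂) * (1 - (1 + σ * ρ₁ * ρ₂))) by ring]
    exact mul_pos hα2 (mul_pos hκ0 (sub_pos.2 hκ1))
  obtain ⟨r, hr_def⟩ : ∃ r, r = √(β * (α - β)) := ⟨_, rfl⟩
  have hr : r ≠ 0 := by rw [hr_def]; exact (Real.sqrt_pos.2 hpos).ne'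
  have hαβ : r ^ 2 = β * (α - β) := by rw [hr_def]; exact Real.sq_sqrt hpos.le
  have hb : MT.b σ ρ₁ ρ₂ α = Complex.I * β := by
    rw [MT.b, MT.a, hβ]
    push_cast
    ring
  have hrt : MT.rt σ ρ₁ ρ₂ α = r := by
    have e : MT.b σ ρ₁ ρ₂ α * (MT.b σ ρ₁ ρ₂ α - MT.a α) = ((β * (α - β) : ℝ) : ℂ) := by
      rw [hb, MT.a]
      push_cast
      linear_combination (β * (β - α) : ℂ) * Complex.I_sq
    rw [MT.rt, e, hr_def, Complex.sqrt_of_nonneg (Complex.zero_le_real.2 hpos.le),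
      Complex.ofReal_re]
  have hw : AnalyticAt ℂ (fun p => p - Complex.I * β) (Complex.I * β + r : ℂ) :=
    analyticAt_id.sub analyticAt_const
  have hS := MT.analyticAt_phase (β := β) hr hâ
  have hz := MT.ofReal_add_I_mul_ne_zero hr β
  have hΦ0 : ∀ x t, PowerSeries.constantCoeff (MT.flowJet ρ₁ ρ₂ α β r â x t) ≠ 0 := by
    intro x t
    rw [MT.flowJet, MT.constantCoeff_expJet]
    exact Complex.exp_ne_zero _
  have hf : ∀ x t, MT.f σ ρ₁ ρ₂ α â N x t =
      MT.gramDet N β r (MT.spec β r) 1 (MT.flowJet ρ₁ ρ₂ α β r â x t) := MT.τ_zero hr hb hrt hâ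
  have hg := MT.τ_shift_a (N := N) hr hb hrt hâ
  have hh := MT.τ_shift_b (N := N) hr hb hrt hâ
  have hΩ := MT.Ω₀_eq_multiplier hb hrt
  have hu : MT.u σ ρ₁ ρ₂ α â N = fun x t => ρ₁ * (MT.multiplier α β r ^ (-(N : ℤ)) *
      MT.gramDet N β r (MT.spec β r - PowerSeries.C (Complex.I * α))
        (MT.spec (-β) r * (MT.spec (-β) r + PowerSeries.C (Complex.I * α))⁻¹)
        (MT.flowJet ρ₁ ρ₂ α β r â x t) /
      (starRingEnd ℂ) (MT.gramDet N β r (MT.spec β r) 1 (MT.flowJet ρ₁ ρ₂ α β r â x t))) *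
      MT.planeWave σ ρ₁ ρ₂ x t := by
    funext x t
    rw [MT.u, MT.g, hg, hf, hΩ]
  have hv : MT.v σ ρ₁ ρ₂ α â N = fun x t => ρ₂ *
      (MT.gramDet N β r (MT.spec β r - PowerSeries.C (Complex.I * β))
        (MT.spec (-β) r * (MT.spec (-β) r + PowerSeries.C (Complex.I * β))⁻¹)
        (MT.flowJet ρ₁ ρ₂ α β r â x t) /
      MT.gramDet N β r (MT.spec β r) 1 (MT.flowJet ρ₁ ρ₂ α β r â x t)) *
      MT.planeWave σ ρ₁ ρ₂ x t := by
    funext x t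
    rw [MT.v, MT.h, hh, hf]
  have hf0 : ∀ x t, MT.f σ ρ₁ ρ₂ α â N x t ≠ 0 := by
    intro x t
    rw [hf]
    exact MT.gramDet_ne_zero hβα hr hαβ (hΦ0 x t)
  refine ⟨hf0, fun x t => ?_, ?_, ?_, ?_⟩
  · rw [hf, MT.conj_gramDet_spec hr, MT.τ_neg_one hr hb hrt hâ]
  · rw [hu, hv]
    refine MT.isSolution_gramDet hρ₁ hρ₂ hβα hβ hr hαβ (fun n => MT.contDiff_expJet hw hS hz n)
      hΦ0 (fun x t n => ?_) (fun x t n => ?_)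
    · rw [← MT.jet_id]
      exact MT.hasDerivAt_expJet_left hw hS hz x t n
    · rw [← MT.jet_id]
      exact MT.hasDerivAt_expJet_right hw hS hz x t n
  -- The multiplier `Ω₀`, the plane wave and the conjugation in the denominator do not affect the
  -- modulus, so the ratio with `s = α` decides.
  · have h := (MT.tendsto_norm_τ_ratio (N := N) hρ₁ hρ₂ hα hβ0 hr hâ α).const_mul |ρ₁|
    rw [mul_one] at h
    refine h.congr fun z => ?_
    rw [hu]
    simp only [norm_mul, norm_div, norm_zpow, MT.norm_multiplier hr, one_zpow, one_mul,
      Complex.norm_conj, MT.norm_planeWave, mul_one, Complex.norm_real, Real.norm_eq_abs]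
  · have h := (MT.tendsto_norm_τ_ratio (N := N) hρ₁ hρ₂ hα hβ0 hr hâ β).const_mul |ρ₂|
    rw [mul_one] at h
    refine h.congr fun z => ?_
    rw [hv]
    simp only [norm_mul, norm_div, MT.norm_planeWave, mul_one, Complex.norm_real,
      Real.norm_eq_abs]
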